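/- Let $K$ be a field, $s\in K^\times$, $q=s^2$ (so $q^{1/2}:=s$), $m\in\mathbb N$, $N=2m+1$, $\delta=q-q^{-1}$, $\lambda=q^{1-N}$, $q_0=q^{-1}$, $q_1=q^{-1}-1$, and let $I=\{-N+2,-N+4,\dots,-3,-1,0,1,3,\dots,N-2\}$. Assume $\delta\neq0$ and $x\ne0$, where $x\delta=\delta-\lambda+\lambda^{-1}$ (equivalently $x=\sum_{i\in I}q^i$). Then $q_0\lambda\neq1$; put $A=q_1x/(1-q_0\lambda)$. For $n\ge1$ let ${\rm BB}_n$ be the unital $K$-algebra generated by invertible $Y,X_1,\dots,X_{n-1}$ with the relations, where $e_i:=1-(X_i-X_i^{-1})/\delta$, $$X_iX_j=X_jX_i\ (|i-j|>1),\quad X_iX_jX_i=X_jX_iX_j\ (|i-j|=1),\quad X_ie_i=e_iX_i=\lambda e_i,\quad e_iX_{i-1}^{\pm1}e_i=\lambda^{\mp1}e_i,$$ $$X_1YX_1Y=YX_1YX_1,\quad Y^2=q_1Y+q_0,\quad YX_1Ye_1=e_1,\quad YX_i=X_iY\ (i>1),\quad e_1Ye_1=Ae_1,$$ and let ${\rm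 BB}_0=K$. Elements of ${\rm BB}_n$ are also regarded as elements of ${\rm BB}_{n+1}$ via the canonical homomorphism ${\rm BB}_n\to{\rm BB}_{n+1}$, $Y\mapsto Y$, $X_i\mapsto X_i$. A conditional expectation is a family of maps $\epsilon_n:{\rm BB}_{n+1}\to{\rm BB}_n$ ($n\ge0$) with $e_{n+1}ae_{n+1}=x\,\epsilon_n(a)e_{n+1}$ in ${\rm BB}_{n+2}$ for all $a\in{\rm BB}_{n+1}$; the Markov trace is its iteration: ${\rm tr}(a)={\rm tr}(\epsilon_{n-1}(a))$ for $a\in{\rm BB}_n$, $n\geq1$, and ${\rm tr}$ is the identity on ${\rm BB}_0=K$. Let $V$ be the $K$-vector space with basis $(v_i)_{i\in I}$, let $f_{i,j}$ be the matrix units, and let $$B=\sum_{i\neq0}(q f_{i,i}\otimes f_{i,i}+q^{-1}f_{i,-i}\otimes f_{-i,i})+f_{0,0}\otimes f_{0,0}+\sum_{i\neq j,-j}f_{i,j}\otimes f_{j,i}+(q-q^{-1})\Big(\sum_{i<j}f_{i,i}\otimes f_{j,j}-\sum_{j<-i}q^{\frac{i+j}2}f_{i,j}\otimes f_{-i,-j}\Big),$$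 $$F=-f_{0,0}+q^{-1/2}\sum_{i\neq0}f_{-i,i}+(q^{-1}-1)\sum_{i>0}f_{i,i},\qquad D=\sum_{i\in I}q^if_{i,i}.$$ Then: (1) for every $n$ there is an algebra homomorphism $\phi:{\rm BB}_n\to{\rm End}(V^{\otimes n})$ sending $Y$ to $F\otimes1\otimes\cdots\otimes1$ and $X_i$ to $B$ acting on the tensor factors $i,i+1$; (2) a conditional expectation exists, and its members $\epsilon_n$ can be chosen $K$-linear; (3) for every conditional expectation the Markov trace satisfies ${\rm tr}=\Psi\circ\phi$ on ${\rm BB}_n$ for every $n\geq 0$, where $\Psi(a)={\rm Tr}(aD^{\otimes n})/{\rm Tr}(D^{\otimes n})$. In particular ${\rm tr}$ does not depend on the choice of the conditional expectation. -/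

import Mathlib

open scoped Kronecker

/-! ### The reduced Birman–Murakami–Wenzl algebra of Coxeter type B -/

/-- The parameters of the algebra over a field `K`. -/
structure BBParams (K : Type*) where
  /-- the parameter `q` -/
  q : K
  /-- the parameter `λ` -/
  lam : K
  /-- the parameter `q₀` -/
  q0 : K
  /-- the parameter `q₁` -/
  q1 : K
  /-- the parameter `A` -/
  A : K

/-- `δ = q - q⁻¹`. -/
def BBParams.delta {K : Type*} [Field K] (p : BBParams K) : K := p.q - p.q⁻¹

/-- `x`, the solution of `x δ = δ - λ + λ⁻¹` (for invertible `δ`). -/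
def BBParams.x {K : Type*} [Field K] (p : BBParams K) : K :=
  (p.delta - p.lam + p.lam⁻¹) / p.delta

/-- Generators on `n` strands. Indices start at `0`: `X i` is the generator usually written
`X_{i+1}`, so `0 ≤ i < n - 1`. There is no generator for `n = 0`, and only `Y`, `Y⁻¹` for
`n = 1`. -/
inductive BBGen (n : ℕ) : Type
  | Y (h : 0 < n) : BBGen n
  | Yinv (h : 0 < n) : BBGen n
  | X (i : ℕ) (h : i + 1 < n) : BBGen n
  | Xinv (i : ℕ) (h : i + 1 < n) : BBGen n

namespace BBFree

variable {K : Type*} [Field K] {n : ℕ}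

/-- The letter `Y`. -/
def Y (K : Type*) [Field K] {n : ℕ} (h : 0 < n) : FreeAlgebra K (BBGen n) :=
  FreeAlgebra.ι K (BBGen.Y h)

/-- The letter `Y⁻¹`. -/
def Yinv (K : Type*) [Field K] {n : ℕ} (h : 0 < n) : FreeAlgebra K (BBGen n) :=
  FreeAlgebra.ι K (BBGen.Yinv h)

/-- The letter `X_{i+1}`. -/
def X (K : Type*) [Field K] {n : ℕ} (i : ℕ) (h : i + 1 < n) : FreeAlgebra K (BBGen n) :=
  FreeAlgebra.ι K (BBGen.X i h)

/-- The letter `X_{i+1}⁻¹`. -/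
def Xinv (K : Type*) [Field K] {n : ℕ} (i : ℕ) (h : i + 1 < n) : FreeAlgebra K (BBGen n) :=
  FreeAlgebra.ι K (BBGen.Xinv i h)

/-- `e_{i+1} = 1 - (X_{i+1} - X_{i+1}⁻¹) / δ`. -/
def e (p : BBParams K) (i : ℕ) (h : i + 1 < n) : FreeAlgebra K (BBGen n) :=
  1 - p.delta⁻¹ • (X K i h - Xinv K i h)

end BBFree

open BBFree in
/-- The defining relations. -/
inductive BBRel {K : Type*} [Field K] (p : BBParams K) (n : ℕ) :
    FreeAlgebra K (BBGen n) → FreeAlgebra K (BBGen n) → Prop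
  | Y_inv (h : 0 < n) : BBRel p n (Y K h * Yinv K h) 1
  | inv_Y (h : 0 < n) : BBRel p n (Yinv K h * Y K h) 1
  | X_inv (i : ℕ) (h : i + 1 < n) : BBRel p n (X K i h * Xinv K i h) 1
  | inv_X (i : ℕ) (h : i + 1 < n) : BBRel p n (Xinv K i h * X K i h) 1
  | comm (i j : ℕ) (hi : i + 1 < n) (hj : j + 1 < n) (hij : i + 1 < j) :
      BBRel p n (X K i hi * X K j hj) (X K j hj * X K i hi)
  | braid (i : ℕ) (hi : i + 1 < n) (hj : (i + 1) + 1 < n) :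
      BBRel p n (X K i hi * X K (i + 1) hj * X K i hi)
        (X K (i + 1) hj * X K i hi * X K (i + 1) hj)
  | X_e (i : ℕ) (h : i + 1 < n) : BBRel p n (X K i h * e p i h) (p.lam • e p i h)
  | e_X (i : ℕ) (h : i + 1 < n) : BBRel p n (e p i h * X K i h) (p.lam • e p i h)
  | e_X_e (i : ℕ) (hi : i + 1 < n) (hj : (i + 1) + 1 < n) :
      BBRel p n (e p (i + 1) hj * X K i hi * e p (i + 1) hj) (p.lam⁻¹ • e p (i + 1) hj)
  | e_Xinv_e (i : ℕ) (hi : i + 1 < n) (hj : (i + 1) + 1 < n) :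
      BBRel p n (e p (i + 1) hj * Xinv K i hi * e p (i + 1) hj) (p.lam • e p (i + 1) hj)
  | braidB (hY : 0 < n) (hX : 0 + 1 < n) :
      BBRel p n (X K 0 hX * Y K hY * X K 0 hX * Y K hY) (Y K hY * X K 0 hX * Y K hY * X K 0 hX)
  | Y_sq (h : 0 < n) :
      BBRel p n (Y K h * Y K h) (p.q1 • Y K h + algebraMap K _ p.q0)
  | YXYe (hY : 0 < n) (hX : 0 + 1 < n) :
      BBRel p n (Y K hY * X K 0 hX * Y K hY * e p 0 hX) (e p 0 hX)
  | Y_comm (hY : 0 < n) (i : ℕ) (hi : i + 1 < n) (hpos : 0 < i) :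
      BBRel p n (Y K hY * X K i hi) (X K i hi * Y K hY)
  | eYe (hY : 0 < n) (hX : 0 + 1 < n) :
      BBRel p n (e p 0 hX * Y K hY * e p 0 hX) (p.A • e p 0 hX)

/-- The algebra `BB_n` with parameters `p`. -/
abbrev BB {K : Type*} [Field K] (p : BBParams K) (n : ℕ) : Type _ := RingQuot (BBRel p n)

namespace BB

variable {K : Type*} [Field K] (p : BBParams K) {n : ℕ}

/-- The generator `Y` of `BB_n`. -/
noncomputable def Y (h : 0 < n) : BB p n := RingQuot.mkAlgHom K (BBRel p n) (BBFree.Y K h)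

/-- The generator `X_{i+1}` of `BB_n`. -/
noncomputable def X (i : ℕ) (h : i + 1 < n) : BB p n :=
  RingQuot.mkAlgHom K (BBRel p n) (BBFree.X K i h)

/-- The element `e_{i+1}` of `BB_n`. -/
noncomputable def e (i : ℕ) (h : i + 1 < n) : BB p n :=
  RingQuot.mkAlgHom K (BBRel p n) (BBFree.e p i h)

/-- Adding a strand on the right, on generators. -/
def genSucc : BBGen n → BBGen (n + 1)
  | BBGen.Y h => BBGen.Y (Nat.lt_succ_of_lt h)
  | BBGen.Yinv h => BBGen.Yinv (Nat.lt_succ_of_lt h)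
  | BBGen.X i h => BBGen.X i (Nat.lt_succ_of_lt h)
  | BBGen.Xinv i h => BBGen.Xinv i (Nat.lt_succ_of_lt h)

/-- Adding a strand on the right, on the free algebras. -/
noncomputable def freeSucc (K : Type*) [Field K] (n : ℕ) :
    FreeAlgebra K (BBGen n) →ₐ[K] FreeAlgebra K (BBGen (n + 1)) :=
  FreeAlgebra.lift K (fun g => FreeAlgebra.ι K (genSucc g))

theorem freeSucc_Y (h : 0 < n) :
    freeSucc K n (BBFree.Y K h) = BBFree.Y K (Nat.lt_succ_of_lt h) := by
  simp [freeSucc, BBFree.Y, genSucc]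

theorem freeSucc_Yinv (h : 0 < n) :
    freeSucc K n (BBFree.Yinv K h) = BBFree.Yinv K (Nat.lt_succ_of_lt h) := by
  simp [freeSucc, BBFree.Yinv, genSucc]

theorem freeSucc_X (i : ℕ) (h : i + 1 < n) :
    freeSucc K n (BBFree.X K i h) = BBFree.X K i (Nat.lt_succ_of_lt h) := by
  simp [freeSucc, BBFree.X, genSucc]

theorem freeSucc_Xinv (i : ℕ) (h : i + 1 < n) :
    freeSucc K n (BBFree.Xinv K i h) = BBFree.Xinv K i (Nat.lt_succ_of_lt h) := by
  simp [freeSucc, BBFree.Xinv, genSucc]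

theorem freeSucc_e (i : ℕ) (h : i + 1 < n) :
    freeSucc K n (BBFree.e p i h) = BBFree.e p i (Nat.lt_succ_of_lt h) := by
  simp [BBFree.e, freeSucc_X, freeSucc_Xinv]

theorem freeSucc_rel {a b : FreeAlgebra K (BBGen n)} (h : BBRel p n a b) :
    BBRel p (n + 1) (freeSucc K n a) (freeSucc K n b) := by
  induction h
  all_goals
    simp only [map_mul, map_add, map_smul, map_one, AlgHom.commutes, freeSucc_Y, freeSucc_Yinv,
      freeSucc_X, freeSucc_Xinv, freeSucc_e]
  case Y_inv h => exact BBRel.Y_inv (Nat.lt_succ_of_lt h)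
  case inv_Y h => exact BBRel.inv_Y (Nat.lt_succ_of_lt h)
  case X_inv i h => exact BBRel.X_inv i (Nat.lt_succ_of_lt h)
  case inv_X i h => exact BBRel.inv_X i (Nat.lt_succ_of_lt h)
  case comm i j hi hj hij => exact BBRel.comm i j (Nat.lt_succ_of_lt hi) (Nat.lt_succ_of_lt hj) hij
  case braid i hi hj => exact BBRel.braid i (Nat.lt_succ_of_lt hi) (Nat.lt_succ_of_lt hj)
  case X_e i h => exact BBRel.X_e i (Nat.lt_succ_of_lt h)
  case e_X i h => exact BBRel.e_X i (Nat.lt_succ_of_lt h)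
  case e_X_e i hi hj => exact BBRel.e_X_e i (Nat.lt_succ_of_lt hi) (Nat.lt_succ_of_lt hj)
  case e_Xinv_e i hi hj => exact BBRel.e_Xinv_e i (Nat.lt_succ_of_lt hi) (Nat.lt_succ_of_lt hj)
  case braidB hY hX => exact BBRel.braidB (Nat.lt_succ_of_lt hY) (Nat.lt_succ_of_lt hX)
  case Y_sq h => exact BBRel.Y_sq (Nat.lt_succ_of_lt h)
  case YXYe hY hX => exact BBRel.YXYe (Nat.lt_succ_of_lt hY) (Nat.lt_succ_of_lt hX)
  case Y_comm hY i hi hpos => exact BBRel.Y_comm (Nat.lt_succ_of_lt hY) i (Nat.lt_succ_of_lt hi) hpos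
  case eYe hY hX => exact BBRel.eYe (Nat.lt_succ_of_lt hY) (Nat.lt_succ_of_lt hX)

/-- The canonical homomorphism `BB_n → BB_{n+1}` that adds a strand on the right: it sends
`Y` to `Y` and `X_i` to `X_i`. -/
noncomputable def succHom (n : ℕ) : BB p n →ₐ[K] BB p (n + 1) :=
  RingQuot.liftAlgHom K
    ⟨(RingQuot.mkAlgHom K (BBRel p (n + 1))).comp (freeSucc K n), fun _ _ h =>
      RingQuot.mkAlgHom_rel K (freeSucc_rel p h)⟩

/-- `BB_0` is the ground field: the identification `BB_0 → K`. -/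
noncomputable def zeroHom : BB p 0 →ₐ[K] K :=
  RingQuot.liftAlgHom K
    ⟨FreeAlgebra.lift K (fun g : BBGen 0 => nomatch g), fun _ _ h => by
      cases h <;> omega⟩

/-- The family `ε_n : BB_{n+1} → BB_n` is the conditional expectation: in `BB_{n+2}`,
`e_{n+1} a e_{n+1} = x ε_n(a) e_{n+1}` for all `a ∈ BB_{n+1}`. -/
def IsCondExp (ε : ∀ n, BB p (n + 1) → BB p n) : Prop :=
  ∀ (n : ℕ) (a : BB p (n + 1)),
    e p n (Nat.lt_succ_self (n + 1)) * succHom p (n + 1) a * e p n (Nat.lt_succ_self (n + 1)) =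
      p.x • (succHom p (n + 1) (succHom p n (ε n a)) * e p n (Nat.lt_succ_self (n + 1)))

/-- The Markov trace: the iterated conditional expectation, `tr(a) = tr(ε_{n-1}(a))`, which is
the identity on the ground field `BB_0 = K`. -/
noncomputable def markovTrace (ε : ∀ n, BB p (n + 1) → BB p n) : ∀ n, BB p n → K
  | 0 => fun a => zeroHom p a
  | n + 1 => fun a => markovTrace ε n (ε n a)

end BB

/-! ### The tensor representation -/

noncomputable section

namespace TensorRep

/-- The index set `I = {-N+2, -N+4, …, -1, 0, 1, …, N-4, N-2}` with `N = 2 m + 1`: zero, and the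
odd integers of absolute value at most `N - 2`. -/
def idxSet (m : ℕ) : Finset ℤ :=
  insert 0 ((Finset.Icc (-(2 * (m : ℤ) - 1)) (2 * (m : ℤ) - 1)).filter Odd)

/-- The basis index set of the `N`-dimensional space `V`. -/
abbrev Idx (m : ℕ) : Type := {i : ℤ // i ∈ idxSet m}

theorem neg_mem {m : ℕ} {i : ℤ} (h : i ∈ idxSet m) : -i ∈ idxSet m := by
  simp only [idxSet, Finset.mem_insert, Finset.mem_filter, Finset.mem_Icc] at h ⊢
  rcases h with h | ⟨h, ho⟩
  · left; omega
  · right; exact ⟨⟨by omega, by omega⟩, ho.neg⟩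

instance instNegIdx (m : ℕ) : Neg (Idx m) := ⟨fun i => ⟨-i.1, neg_mem i.2⟩⟩

instance instZeroIdx (m : ℕ) : Zero (Idx m) := ⟨⟨0, by simp [idxSet]⟩⟩

variable {K : Type*} [Field K]

/-- The matrix unit `f_{i,j}`. -/
def f (K : Type*) [Field K] {m : ℕ} (i j : Idx m) : Matrix (Idx m) (Idx m) K :=
  Matrix.single i j 1

/-- The permuting R-matrix `B` of `U_q(so_N)` on `V ⊗ V`, where `q = s ^ 2`, so that
`q ^ ((i + j) / 2) = s ^ (i + j)`. -/
def B (m : ℕ) (s : K) : Matrix (Idx m × Idx m) (Idx m × Idx m) K :=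
  (∑ i : Idx m with i ≠ 0,
      ((s ^ 2) • (f K i i ⊗ₖ f K i i) + (s ^ 2)⁻¹ • (f K i (-i) ⊗ₖ f K (-i) i)))
    + f K 0 0 ⊗ₖ f K 0 0
    + (∑ ij : Idx m × Idx m with ij.1 ≠ ij.2 ∧ ij.1 ≠ -ij.2, f K ij.1 ij.2 ⊗ₖ f K ij.2 ij.1)
    + (s ^ 2 - (s ^ 2)⁻¹) •
      ((∑ ij : Idx m × Idx m with ij.1 < ij.2, f K ij.1 ij.1 ⊗ₖ f K ij.2 ij.2)
        - ∑ ij : Idx m × Idx m with ij.2 < -ij.1,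
            s ^ (ij.1.1 + ij.2.1) • (f K ij.1 ij.2 ⊗ₖ f K (-ij.1) (-ij.2)))

/-- The matrix `F` representing `Y`, where `q = s ^ 2`. -/
def F (m : ℕ) (s : K) : Matrix (Idx m) (Idx m) K :=
  -f K 0 0 + s⁻¹ • (∑ i : Idx m with i ≠ 0, f K (-i) i)
    + ((s ^ 2)⁻¹ - 1) • ∑ i : Idx m with 0 < i.1, f K i i

/-- The diagonal matrix `D` with `D_{i,i} = q ^ i`, where `q = s ^ 2`. -/
def D (m : ℕ) (s : K) : Matrix (Idx m) (Idx m) K :=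
  Matrix.diagonal fun i => (s ^ 2) ^ i.1

/-- `End(V^{⊗ n})`, written as matrices in the basis `v_{u 0} ⊗ ⋯ ⊗ v_{u (n-1)}`,
`u : Fin n → I`. -/
abbrev EndTensor (K : Type*) (m n : ℕ) : Type _ :=
  Matrix (Fin n → Idx m) (Fin n → Idx m) K

/-- `M ⊗ 1 ⊗ ⋯ ⊗ 1`: the operator `M` on the first tensor factor. -/
def onFirst {m n : ℕ} (M : Matrix (Idx m) (Idx m) K) (h : 0 < n) : EndTensor K m n :=
  fun u v => if ∀ k : Fin n, k ≠ ⟨0, h⟩ → u k = v k then M (u ⟨0, h⟩) (v ⟨0, h⟩) else 0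

/-- `1 ⊗ ⋯ ⊗ 1 ⊗ M ⊗ 1 ⊗ ⋯ ⊗ 1`: the operator `M` of `V ⊗ V` on the adjacent tensor factors
`i` and `i + 1` (counted from `0`). -/
def onPair {m n : ℕ} (M : Matrix (Idx m × Idx m) (Idx m × Idx m) K) (i : ℕ) (h : i + 1 < n) :
    EndTensor K m n :=
  fun u v =>
    if ∀ k : Fin n, k.1 ≠ i → k.1 ≠ i + 1 → u k = v k then
      M (u ⟨i, Nat.lt_of_succ_lt h⟩, u ⟨i + 1, h⟩) (v ⟨i, Nat.lt_of_succ_lt h⟩, v ⟨i + 1, h⟩)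
    else 0

/-- The tensor power `M^{⊗ n}`. -/
def tensorPower {m : ℕ} (M : Matrix (Idx m) (Idx m) K) (n : ℕ) : EndTensor K m n :=
  fun u v => ∏ k, M (u k) (v k)

/-- The parameters of the tensor representation: `q = s ^ 2`, `λ = q ^ (1 - N) = q ^ (-2 m)`,
`q₀ = q⁻¹`, `q₁ = q⁻¹ - 1`, and `A` is determined by `A (1 - q₀ λ) = q₁ x`, where
`x = ∑ i, q ^ i`. -/
def params (m : ℕ) (s : K) : BBParams K where
  q := s ^ 2
  lam := (s ^ 2) ^ (-(2 * (m : ℤ)))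
  q0 := (s ^ 2)⁻¹
  q1 := (s ^ 2)⁻¹ - 1
  A := ((s ^ 2)⁻¹ - 1) * (∑ i : Idx m, (s ^ 2) ^ i.1) /
    (1 - (s ^ 2)⁻¹ * (s ^ 2) ^ (-(2 * (m : ℤ))))

/-- `φ` is the tensor representation: the homomorphisms `φ_n : BB_n → End(V^{⊗ n})` with
`Y ↦ F ⊗ 1 ⊗ ⋯ ⊗ 1` and `X_i ↦ B` on the factors `i` and `i + 1`. -/
def IsTensorRep (m : ℕ) (s : K) (φ : ∀ n, BB (params m s) n →ₐ[K] EndTensor K m n) : Prop :=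
  (∀ (n : ℕ) (h : 0 < n), φ n (BB.Y (params m s) h) = onFirst (F m s) h) ∧
  ∀ (n i : ℕ) (h : i + 1 < n), φ n (BB.X (params m s) i h) = onPair (B m s) i h

/-- `Ψ(a) = Tr(a D^{⊗ n}) / Tr(D^{⊗ n})`. -/
def Psi (m : ℕ) (s : K) (n : ℕ) (a : EndTensor K m n) : K :=
  Matrix.trace (a * tensorPower (D m s) n) / Matrix.trace (tensorPower (D m s) n)

end TensorRep

end

/-! ### Relations between the generators -/

/-- Elements of an algebra satisfying the defining relations of `BB` on `L + 1` strands. -/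
structure BBSystem {K R : Type*} [Field K] [Ring R] [Algebra K R] (p : BBParams K) (L : ℕ)
    (y y' : R) (X X' e : ℕ → R) : Prop where
  delta_ne : p.delta ≠ 0
  lam_ne : p.lam ≠ 0
  y_mul_y' : y * y' = 1
  y'_mul_y : y' * y = 1
  X_mul_X' : ∀ i, i < L → X i * X' i = 1
  X'_mul_X : ∀ i, i < L → X' i * X i = 1
  e_eq : ∀ i, i < L → e i = 1 - p.delta⁻¹ • (X i - X' i)
  comm : ∀ i j, i + 1 < j → j < L → X i * X j = X j * X i
  braid : ∀ i, i + 1 < L → X i * X (i + 1) * X i = X (i + 1) * X i * X (i + 1)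
  X_e : ∀ i, i < L → X i * e i = p.lam • e i
  e_X : ∀ i, i < L → e i * X i = p.lam • e i
  e_X_e : ∀ i, i + 1 < L → e (i + 1) * X i * e (i + 1) = p.lam⁻¹ • e (i + 1)
  e_X'_e : ∀ i, i + 1 < L → e (i + 1) * X' i * e (i + 1) = p.lam • e (i + 1)
  braidB : 0 < L → X 0 * y * X 0 * y = y * X 0 * y * X 0
  y_sq : y * y = p.q1 • y + algebraMap K R p.q0
  yXye : 0 < L → y * X 0 * y * e 0 = e 0
  y_comm : ∀ i, 0 < i → i < L → y * X i = X i * y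
  eye : 0 < L → e 0 * y * e 0 = p.A • e 0

namespace BBSystem

variable {K R : Type*} [Field K] [Ring R] [Algebra K R] {p : BBParams K} {L : ℕ}
  {y y' : R} {X X' e : ℕ → R}

theorem X'_eq (h : BBSystem p L y y' X X' e) {i : ℕ} (hi : i < L) :
    X' i = X i - p.delta • (1 : R) + p.delta • e i := by
  rw [h.e_eq i hi, smul_sub, smul_smul, mul_inv_cancel₀ h.delta_ne]
  module

theorem X_sq (h : BBSystem p L y y' X X' e) {i : ℕ} (hi : i < L) :
    X i * X i = 1 + p.delta • X i - (p.delta * p.lam) • e i := by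
  have h1 := h.X_mul_X' i hi
  rw [h.X'_eq hi, mul_add, mul_sub, mul_smul_comm, mul_smul_comm, h.X_e i hi, mul_one,
    smul_smul] at h1
  rw [← h1]; module

theorem X'_e (h : BBSystem p L y y' X X' e) {i : ℕ} (hi : i < L) :
    X' i * e i = p.lam⁻¹ • e i := by
  have h1 : X' i * (X i * e i) = e i := by rw [← mul_assoc, h.X'_mul_X i hi, one_mul]
  rw [h.X_e i hi, mul_smul_comm] at h1
  rw [← h1, smul_smul, h1, inv_mul_cancel₀ h.lam_ne, one_smul]

theorem X'_sq (h : BBSystem p L y y' X X' e) {i : ℕ} (hi : i < L) :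
    X' i * X' i = 1 - p.delta • X' i + (p.delta * p.lam⁻¹) • e i := by
  nth_rw 2 [h.X'_eq hi]
  rw [mul_add, mul_sub, h.X'_mul_X i hi, mul_smul_comm, mul_smul_comm, h.X'_e hi, mul_one,
    smul_smul]

theorem e_sq (h : BBSystem p L y y' X X' e) {i : ℕ} (hi : i < L) :
    e i * e i = p.x • e i := by
  nth_rw 1 [h.e_eq i hi]
  rw [sub_mul, smul_mul_assoc, sub_mul, h.X_e i hi, h.X'_e hi, one_mul]
  have : p.x = 1 - p.delta⁻¹ * (p.lam - p.lam⁻¹) := by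
    rw [BBParams.x, div_eq_inv_mul]
    linear_combination inv_mul_cancel₀ h.delta_ne
  rw [this]; module

theorem X_commute (h : BBSystem p L y y' X X' e) {i j : ℕ} (hi : i < L) (hj : j < L)
    (hij : i + 1 < j ∨ j + 1 < i) : Commute (X i) (X j) := by
  rcases hij with hij | hij
  · exact h.comm i j hij hj
  · exact (h.comm j i hij hi).symm

theorem commute_X' (h : BBSystem p L y y' X X' e) {i : ℕ} (hi : i < L) {a : R}
    (ha : Commute a (X i)) : Commute a (X' i) := by
  have h1 : X' i * (a * X i) * X' i = X' i * (X i * a) * X' i := by rw [ha.eq]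
  rw [← mul_assoc (X' i) (X i), h.X'_mul_X i hi, one_mul, ← mul_assoc, mul_assoc,
    h.X_mul_X' i hi, mul_one] at h1
  exact h1.symm

theorem commute_e (h : BBSystem p L y y' X X' e) {i : ℕ} (hi : i < L) {a : R}
    (ha : Commute a (X i)) : Commute a (e i) := by
  rw [h.e_eq i hi]
  exact (Commute.one_right _).sub_right ((ha.sub_right (h.commute_X' hi ha)).smul_right _)

theorem commute_y' (h : BBSystem p L y y' X X' e) {a : R}
    (ha : Commute a y) : Commute a y' := by
  have h1 : y' * (a * y) * y' = y' * (y * a) * y' := by rw [ha.eq]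
  rw [← mul_assoc y' y, h.y'_mul_y, one_mul, ← mul_assoc, mul_assoc,
    h.y_mul_y', mul_one] at h1
  exact h1.symm

/-- Conjugation by a unit relating `X i` and `X j` also relates `e i` and `e j`. -/
theorem semiconj_e (h : BBSystem p L y y' X X' e) {i j : ℕ} (hi : i < L) (hj : j < L) {g : R}
    (hg : SemiconjBy g (X i) (X j)) : SemiconjBy g (e i) (e j) := by
  have h1 : SemiconjBy g (X' i) (X' j) := by
    have h2 : X' j * (g * X i) * X' i = X' j * (X j * g) * X' i := by rw [hg.eq]
    rw [← mul_assoc (X' j) (X j), h.X'_mul_X j hj, one_mul, ← mul_assoc, mul_assoc,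
      h.X_mul_X' i hi, mul_one] at h2
    exact h2.symm
  rw [SemiconjBy, h.e_eq i hi, h.e_eq j hj, mul_sub, sub_mul, mul_smul_comm, smul_mul_assoc,
    mul_sub, sub_mul, hg.eq, h1.eq, mul_one, one_mul]

theorem semiconj_up (h : BBSystem p L y y' X X' e) {i : ℕ} (hi : i + 1 < L) :
    SemiconjBy (X i * X (i + 1)) (X i) (X (i + 1)) := by
  rw [SemiconjBy, h.braid i hi, mul_assoc]

theorem semiconj_down (h : BBSystem p L y y' X X' e) {i : ℕ} (hi : i + 1 < L) :
    SemiconjBy (X (i + 1) * X i) (X (i + 1)) (X i) := by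
  rw [SemiconjBy, ← h.braid i hi, mul_assoc]

theorem XX_e_up (h : BBSystem p L y y' X X' e) {i : ℕ} (hi : i + 1 < L) :
    X i * X (i + 1) * e i = e (i + 1) * (X i * X (i + 1)) :=
  h.semiconj_e (by omega) hi (h.semiconj_up hi)

theorem XX_e_down (h : BBSystem p L y y' X X' e) {i : ℕ} (hi : i + 1 < L) :
    X (i + 1) * X i * e (i + 1) = e i * (X (i + 1) * X i) :=
  h.semiconj_e hi (by omega) (h.semiconj_down hi)

theorem e_succ_e_e_succ (h : BBSystem p L y y' X X' e) {i : ℕ} (hi : i + 1 < L) :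
    e (i + 1) * e i * e (i + 1) = e (i + 1) := by
  rw [h.e_eq i (by omega), mul_sub, sub_mul, mul_one, h.e_sq hi, mul_smul_comm, smul_mul_assoc,
    mul_sub, sub_mul, h.e_X_e i hi, h.e_X'_e i hi]
  have : p.x = 1 + p.delta⁻¹ * (p.lam⁻¹ - p.lam) := by
    rw [BBParams.x, div_eq_inv_mul]
    linear_combination inv_mul_cancel₀ h.delta_ne
  rw [this]; module

/-- `X i * X (i+1) * X i` intertwines the indices `i` and `i + 1`. -/
theorem semiconj_half_twist (h : BBSystem p L y y' X X' e) {i : ℕ} (hi : i + 1 < L) :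
    SemiconjBy (X i * X (i + 1) * X i) (X i) (X (i + 1)) ∧
      SemiconjBy (X i * X (i + 1) * X i) (X (i + 1)) (X i) := by
  constructor
  · exact (h.semiconj_up hi).mul_left rfl
  · rw [SemiconjBy, mul_assoc, mul_assoc, ← mul_assoc (X (i + 1)), ← h.braid i hi]

theorem mul_left_cancel_X (h : BBSystem p L y y' X X' e) {i : ℕ} (hi : i < L) {a b : R}
    (hab : X i * a = X i * b) : a = b := by
  have := congrArg (X' i * ·) hab
  simpa only [← mul_assoc, h.X'_mul_X i hi, one_mul] using this

theorem e_e_succ_e (h : BBSystem p L y y' X X' e) {i : ℕ} (hi : i + 1 < L) :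
    e i * e (i + 1) * e i = e i := by
  obtain ⟨h1, h2⟩ := h.semiconj_half_twist hi
  have h3 := (h.semiconj_e (by omega) hi h1)
  have h4 := (h.semiconj_e hi (by omega) h2)
  have h5 := (h3.mul_right h4).mul_right h3
  rw [h.e_succ_e_e_succ hi] at h5
  have h6 := h5.eq.trans h3.eq.symm
  simp only [mul_assoc] at h6
  rw [mul_assoc]
  exact h.mul_left_cancel_X (by omega) (h.mul_left_cancel_X hi
    (h.mul_left_cancel_X (by omega) h6))

theorem e_X_succ_e (h : BBSystem p L y y' X X' e) {i : ℕ} (hi : i + 1 < L) :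
    e i * X (i + 1) * e i = p.lam⁻¹ • e i := by
  obtain ⟨h1, h2⟩ := h.semiconj_half_twist hi
  have h3 := (h.semiconj_e (by omega) hi h1)
  have h5 := ((h3.mul_right h2).mul_right h3).eq
  rw [h.e_X_e i hi, smul_mul_assoc, ← h3.eq, ← mul_smul_comm] at h5
  simp only [mul_assoc] at h5
  have h6 := h.mul_left_cancel_X (by omega) (h.mul_left_cancel_X hi
    (h.mul_left_cancel_X (by omega) h5))
  rw [mul_assoc]
  exact h6

theorem XX_e (h : BBSystem p L y y' X X' e) {i : ℕ} (hi : i + 1 < L) :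
    X i * X (i + 1) * e i = e (i + 1) * e i :=
  calc X i * X (i + 1) * e i = X i * X (i + 1) * e i * e (i + 1) * e i := by
        rw [mul_assoc _ (e i), mul_assoc _ (e i * _), h.e_e_succ_e hi]
    _ = e (i + 1) * X i * (X (i + 1) * e (i + 1)) * e i := by
        rw [h.XX_e_up hi]; simp only [mul_assoc]
    _ = e (i + 1) * e i := by
        rw [h.X_e _ hi, mul_smul_comm, h.e_X_e i hi, smul_smul, mul_inv_cancel₀ h.lam_ne, one_smul]

theorem e_XX (h : BBSystem p L y y' X X' e) {i : ℕ} (hi : i + 1 < L) :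
    e (i + 1) * (X i * X (i + 1)) = e (i + 1) * e i := by
  rw [← h.XX_e_up hi, h.XX_e hi]

theorem XX_e_succ (h : BBSystem p L y y' X X' e) {i : ℕ} (hi : i + 1 < L) :
    X (i + 1) * X i * e (i + 1) = e i * e (i + 1) :=
  calc X (i + 1) * X i * e (i + 1) = X (i + 1) * X i * e (i + 1) * e i * e (i + 1) := by
        rw [mul_assoc _ (e (i + 1)), mul_assoc _ (e (i + 1) * _), h.e_succ_e_e_succ hi]
    _ = e i * X (i + 1) * (X i * e i) * e (i + 1) := by
        rw [h.XX_e_down hi]; simp only [mul_assoc]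
    _ = e i * e (i + 1) := by
        rw [h.X_e _ (by omega), mul_smul_comm, h.e_X_succ_e hi, smul_smul,
          mul_inv_cancel₀ h.lam_ne, one_smul]

theorem e_XX_succ (h : BBSystem p L y y' X X' e) {i : ℕ} (hi : i + 1 < L) :
    e i * (X (i + 1) * X i) = e i * e (i + 1) := by
  rw [← h.XX_e_down hi, h.XX_e_succ hi]

theorem X_succ_e (h : BBSystem p L y y' X X' e) {i : ℕ} (hi : i + 1 < L) :
    X (i + 1) * e i = X' i * e (i + 1) * e i := by
  rw [mul_assoc, ← h.XX_e hi, ← mul_assoc, ← mul_assoc, h.X'_mul_X i (by omega), one_mul]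

theorem e_e_X_succ (h : BBSystem p L y y' X X' e) {i : ℕ} (hi : i + 1 < L) :
    e (i + 1) * e i * X (i + 1) = e (i + 1) * X' i := by
  nth_rw 2 [← h.e_succ_e_e_succ hi]
  rw [mul_assoc (e (i + 1)), mul_assoc (e (i + 1)), mul_assoc (e (i + 1)), ← h.e_XX_succ hi,
    mul_assoc, mul_assoc, h.X_mul_X' i (by omega), mul_one]

theorem X_succ_e_X_succ (h : BBSystem p L y y' X X' e) {i : ℕ} (hi : i + 1 < L) :
    X (i + 1) * e i * X (i + 1) = X' i * e (i + 1) * X' i := by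
  rw [h.X_succ_e hi, mul_assoc (X' i), mul_assoc (X' i), h.e_e_X_succ hi, mul_assoc]

theorem X_succ_e_e_succ (h : BBSystem p L y y' X X' e) {i : ℕ} (hi : i + 1 < L) :
    X (i + 1) * e i * e (i + 1) = X' i * e (i + 1) := by
  rw [h.X_succ_e hi, mul_assoc (X' i), mul_assoc (X' i), h.e_succ_e_e_succ hi]

theorem e_succ_X (h : BBSystem p L y y' X X' e) {i : ℕ} (hi : i + 1 < L) :
    e (i + 1) * X i = e (i + 1) * e i * X' (i + 1) := by
  rw [← h.e_XX hi, mul_assoc, mul_assoc, h.X_mul_X' _ hi, mul_one]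

theorem X_e_succ (h : BBSystem p L y y' X X' e) {i : ℕ} (hi : i + 1 < L) :
    X i * e (i + 1) = X' (i + 1) * (e i * e (i + 1)) := by
  rw [← h.XX_e_succ hi, ← mul_assoc, ← mul_assoc, h.X'_mul_X _ hi, one_mul]

end BBSystem

namespace BBSystem

variable {K R : Type*} [Field K] [Ring R] [Algebra K R] {p : BBParams K} {L : ℕ}
  {y y' : R} {X X' e : ℕ → R}

/-! ### Strand subalgebras -/

/-- The letters on the first `k` strands. -/
def letters (y y' : R) (X X' : ℕ → R) (k : ℕ) : Set R :=
  {a | (0 < k ∧ (a = y ∨ a = y')) ∨ ∃ i, i + 1 < k ∧ (a = X i ∨ a = X' i)}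

/-- The subalgebra generated by the letters on the first `k` strands. -/
def strand (K : Type*) {R : Type*} [Field K] [Ring R] [Algebra K R] (y y' : R) (X X' : ℕ → R)
    (k : ℕ) : Subalgebra K R :=
  Algebra.adjoin K (letters y y' X X' k)

theorem y_mem {k : ℕ} (hk : 0 < k) : y ∈ strand K y y' X X' k :=
  Algebra.subset_adjoin (Or.inl ⟨hk, Or.inl rfl⟩)

theorem y'_mem {k : ℕ} (hk : 0 < k) : y' ∈ strand K y y' X X' k :=
  Algebra.subset_adjoin (Or.inl ⟨hk, Or.inr rfl⟩)

theorem X_mem {i k : ℕ} (hk : i + 1 < k) : X i ∈ strand K y y' X X' k :=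
  Algebra.subset_adjoin (Or.inr ⟨i, hk, Or.inl rfl⟩)

theorem X'_mem {i k : ℕ} (hk : i + 1 < k) : X' i ∈ strand K y y' X X' k :=
  Algebra.subset_adjoin (Or.inr ⟨i, hk, Or.inr rfl⟩)

theorem e_mem (h : BBSystem p L y y' X X' e) {i k : ℕ} (hi : i < L) (hk : i + 1 < k) :
    e i ∈ strand K y y' X X' k := by
  rw [h.e_eq i hi]
  exact sub_mem (one_mem _) (Subalgebra.smul_mem _ (sub_mem (X_mem hk) (X'_mem hk)) _)

theorem strand_mono {k l : ℕ} (hkl : k ≤ l) : strand K y y' X X' k ≤ strand K y y' X X' l := by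
  refine Algebra.adjoin_mono ?_
  rintro a (⟨hk, ha⟩ | ⟨i, hi, ha⟩)
  · exact Or.inl ⟨by omega, ha⟩
  · exact Or.inr ⟨i, by omega, ha⟩

theorem commute_of_mem_strand {k : ℕ} {a b : R} (ha : a ∈ strand K y y' X X' k)
    (hb : ∀ c ∈ letters y y' X X' k, Commute b c) : Commute b a := by
  have : strand K y y' X X' k ≤ Subalgebra.centralizer K {b} :=
    Algebra.adjoin_le fun c hc => by
      rw [SetLike.mem_coe, Subalgebra.mem_centralizer_iff]
      rintro _ rfl
      exact (hb c hc)
  exact (Subalgebra.mem_centralizer_iff K).1 (this ha) b rfl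

theorem X_commute_strand (h : BBSystem p L y y' X X' e) {j k : ℕ} (hj : j < L) (hk : k ≤ j)
    {a : R} (ha : a ∈ strand K y y' X X' k) : Commute (X j) a := by
  refine commute_of_mem_strand ha ?_
  rintro c (⟨hk, rfl | rfl⟩ | ⟨i, hi, rfl | rfl⟩)
  · exact (h.y_comm j (by omega) hj).symm
  · exact h.commute_y' (h.y_comm j (by omega) hj).symm
  · exact h.X_commute hj (by omega) (by omega)
  · exact h.commute_X' (by omega) (h.X_commute hj (by omega) (by omega))

theorem e_commute_strand (h : BBSystem p L y y' X X' e) {j k : ℕ} (hj : j < L) (hk : k ≤ j)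
    {a : R} (ha : a ∈ strand K y y' X X' k) : Commute (e j) a :=
  (h.commute_e hj (h.X_commute_strand hj hk ha).symm).symm

/-! ### The twisted strands -/

/-- The last strand running around the pole: `X k ⋯ X 0 * y * X 0 ⋯ X k`. -/
def twist (y : R) (X : ℕ → R) : ℕ → R
  | 0 => y
  | k + 1 => X k * twist y X k * X k

theorem twist_mem (k : ℕ) : twist y X k ∈ strand K y y' X X' (k + 1) := by
  induction k with
  | zero => exact y_mem (by omega)
  | succ k ih =>
    exact mul_mem (mul_mem (X_mem (by omega)) (strand_mono (by omega) ih)) (X_mem (by omega))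

theorem twist'_mem (k : ℕ) : twist y' X' k ∈ strand K y y' X X' (k + 1) := by
  induction k with
  | zero => exact y'_mem (by omega)
  | succ k ih =>
    exact mul_mem (mul_mem (X'_mem (by omega)) (strand_mono (by omega) ih)) (X'_mem (by omega))

theorem twist'_mul_twist (h : BBSystem p L y y' X X' e) {k : ℕ} (hk : k ≤ L) :
    twist y' X' k * twist y X k = 1 := by
  induction k with
  | zero => exact h.y'_mul_y
  | succ k ih =>
    calc X' k * twist y' X' k * X' k * (X k * twist y X k * X k)
        = X' k * (twist y' X' k * (X' k * X k) * twist y X k) * X k := by simp only [mul_assoc]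
      _ = 1 := by rw [h.X'_mul_X k (by omega), mul_one, ih (by omega), mul_one,
                    h.X'_mul_X k (by omega)]

theorem twist_mul_twist' (h : BBSystem p L y y' X X' e) {k : ℕ} (hk : k ≤ L) :
    twist y X k * twist y' X' k = 1 := by
  induction k with
  | zero => exact h.y_mul_y'
  | succ k ih =>
    calc X k * twist y X k * X k * (X' k * twist y' X' k * X' k)
        = X k * (twist y X k * (X k * X' k) * twist y' X' k) * X' k := by simp only [mul_assoc]
      _ = 1 := by rw [h.X_mul_X' k (by omega), mul_one, ih (by omega), mul_one,
                    h.X_mul_X' k (by omega)]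

theorem twist_commute_X (h : BBSystem p L y y' X X' e) {i k : ℕ} (hk : k ≤ L) (hi : i + 1 < k) :
    Commute (twist y X k) (X i) := by
  induction k with
  | zero => omega
  | succ k ih =>
    rcases Nat.lt_or_ge (i + 1) k with hik | hik
    · have h1 : Commute (X k) (X i) := h.X_commute (by omega) (by omega) (by omega)
      exact (h1.mul_left (ih (by omega) hik)).mul_left h1
    · obtain rfl : k = i + 1 := by omega
      have hc : X (i + 1) * twist y X i = twist y X i * X (i + 1) :=
        h.X_commute_strand (by omega) le_rfl (twist_mem (K := K) (y' := y') (X' := X') i)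
      have hb := h.braid i (by omega)
      symm
      calc X i * (X (i + 1) * (X i * twist y X i * X i) * X (i + 1))
          = (X i * X (i + 1) * X i) * twist y X i * X i * X (i + 1) := by simp only [mul_assoc]
        _ = X (i + 1) * X i * (X (i + 1) * twist y X i) * X i * X (i + 1) := by
            rw [hb]; simp only [mul_assoc]
        _ = X (i + 1) * X i * twist y X i * (X (i + 1) * X i * X (i + 1)) := by
            rw [hc]; simp only [mul_assoc]
        _ = X (i + 1) * (X i * twist y X i * X i) * X (i + 1) * X i := by
            rw [← hb]; simp only [mul_assoc]

theorem twist_commute_y (h : BBSystem p L y y' X X' e) {k : ℕ} (hk : k ≤ L) (h0 : 0 < k) :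
    Commute (twist y X k) y := by
  induction k with
  | zero => omega
  | succ k ih =>
    rcases Nat.eq_zero_or_pos k with rfl | hk0
    · have := h.braidB (by omega)
      change X 0 * y * X 0 * y = y * (X 0 * y * X 0)
      rw [this]; simp only [mul_assoc]
    · have h1 : Commute (X k) y := (h.y_comm k hk0 (by omega)).symm
      exact (h1.mul_left (ih (by omega) hk0)).mul_left h1

theorem twist_commute_strand (h : BBSystem p L y y' X X' e) {k : ℕ} (hk : k ≤ L)
    {a : R} (ha : a ∈ strand K y y' X X' k) : Commute (twist y X k) a := by
  refine commute_of_mem_strand ha ?_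
  rintro c (⟨hk0, rfl | rfl⟩ | ⟨i, hi, rfl | rfl⟩)
  · exact h.twist_commute_y hk hk0
  · exact h.commute_y' (h.twist_commute_y hk hk0)
  · exact h.twist_commute_X hk hi
  · exact h.commute_X' (by omega) (h.twist_commute_X hk hi)

theorem twist_X_twist_e (h : BBSystem p L y y' X X' e) {k : ℕ} (hk : k < L) :
    twist y X k * X k * twist y X k * e k = e k := by
  induction k with
  | zero => exact h.yXye hk
  | succ k ih =>
    have hc : X (k + 1) * twist y X k = twist y X k * X (k + 1) :=
      h.X_commute_strand (by omega) le_rfl (twist_mem (K := K) (y' := y') (X' := X') k)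
    have hb := h.braid k hk
    calc X k * twist y X k * X k * X (k + 1) * (X k * twist y X k * X k) * e (k + 1)
        = X k * twist y X k * (X k * X (k + 1) * X k) * twist y X k * X k * e (k + 1) := by
          simp only [mul_assoc]
      _ = X k * (twist y X k * X (k + 1)) * X k * (X (k + 1) * twist y X k) * X k * e (k + 1) := by
          rw [hb]; simp only [mul_assoc]
      _ = X k * X (k + 1) * (twist y X k * X k * twist y X k) * (X (k + 1) * X k * e (k + 1)) := by
          rw [hc, ← hc]; simp only [mul_assoc]; rw [← mul_assoc (twist y X k) (X (k + 1)), ← hc]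
          simp only [mul_assoc]
      _ = X k * X (k + 1) * (twist y X k * X k * twist y X k * e k) * e (k + 1) := by
          rw [h.XX_e_succ hk]; simp only [mul_assoc]
      _ = e (k + 1) := by
          rw [ih (by omega), h.XX_e hk, h.e_succ_e_e_succ hk]

theorem X_twist_e (h : BBSystem p L y y' X X' e) {k : ℕ} (hk : k < L) :
    X k * twist y X k * e k = twist y' X' k * e k := by
  nth_rw 2 [← h.twist_X_twist_e hk]
  simp only [← mul_assoc]
  rw [h.twist'_mul_twist hk.le, one_mul]

theorem e_twist_X (h : BBSystem p L y y' X X' e) {k : ℕ} (hk : k < L) :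
    e k * twist y X k * X k = e k * twist y' X' k := by
  have hz : X k * twist y X k * X k * twist y X k = twist y X k * (X k * twist y X k * X k) :=
    h.twist_commute_strand (k := k + 1) hk (twist_mem k)
  have hc : Commute (twist y X k * X k * twist y X k) (X k) := by
    rw [Commute, SemiconjBy]
    simp only [mul_assoc] at hz ⊢
    exact hz.symm
  have h1 := (h.commute_e hk hc).eq
  rw [h.twist_X_twist_e hk] at h1
  nth_rw 2 [h1]
  simp only [mul_assoc]
  rw [h.twist_mul_twist' hk.le, mul_one]

/-! ### Spanning sets of the strand subalgebras -/

/-- The middle factors needed to span the subalgebra on `k + 1` strands over that on `k`. -/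
def middles (y : R) (X e : ℕ → R) (k : ℕ) : Set R :=
  {c | c = 1 ∨ c = twist y X k ∨ ∃ j, k = j + 1 ∧ (c = X j ∨ c = e j)}

/-- The span of the products `a * c * b` with `a`, `b` on `k` strands and `c` a middle factor. -/
def middleSpan (K : Type*) {R : Type*} [Field K] [Ring R] [Algebra K R] (y y' : R)
    (X X' e : ℕ → R) (k : ℕ) : Submodule K R :=
  Submodule.span K {r | ∃ a ∈ strand K y y' X X' k, ∃ c ∈ middles y X e k,
    ∃ b ∈ strand K y y' X X' k, r = a * c * b}

theorem middleSpan_mul_mem {k : ℕ} {a b t : R} (ha : a ∈ strand K y y' X X' k)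
    (hb : b ∈ strand K y y' X X' k) (ht : t ∈ middleSpan K y y' X X' e k) :
    a * t * b ∈ middleSpan K y y' X X' e k := by
  induction ht using Submodule.span_induction with
  | mem t ht =>
    obtain ⟨a', ha', c, hc, b', hb', rfl⟩ := ht
    refine Submodule.subset_span ⟨a * a', mul_mem ha ha', c, hc, b' * b, mul_mem hb' hb, ?_⟩
    simp only [mul_assoc]
  | zero => simp
  | add s t _ _ hs ht => rw [mul_add, add_mul]; exact add_mem hs ht
  | smul c t _ ht => rw [mul_smul_comm, smul_mul_assoc]; exact Submodule.smul_mem _ _ ht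

theorem middleSpan_mul_left_mem {k : ℕ} {a t : R} (ha : a ∈ strand K y y' X X' k)
    (ht : t ∈ middleSpan K y y' X X' e k) : a * t ∈ middleSpan K y y' X X' e k := by
  simpa using middleSpan_mul_mem ha (one_mem _) ht

theorem middleSpan_mul_right_mem {k : ℕ} {b t : R} (hb : b ∈ strand K y y' X X' k)
    (ht : t ∈ middleSpan K y y' X X' e k) : t * b ∈ middleSpan K y y' X X' e k := by
  simpa using middleSpan_mul_mem (one_mem _) hb ht

theorem middles_subset {k : ℕ} {c : R} (hc : c ∈ middles y X e k) :
    c ∈ middleSpan K y y' X X' e k :=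
  Submodule.subset_span ⟨1, one_mem _, c, hc, 1, one_mem _, by simp⟩

theorem one_mem_middleSpan {k : ℕ} : (1 : R) ∈ middleSpan K y y' X X' e k :=
  middles_subset (Or.inl rfl)

theorem twist_mem_middleSpan {k : ℕ} : twist y X k ∈ middleSpan K y y' X X' e k :=
  middles_subset (Or.inr (Or.inl rfl))

theorem X_mem_middleSpan {k : ℕ} : X k ∈ middleSpan K y y' X X' e (k + 1) :=
  middles_subset (Or.inr (Or.inr ⟨k, rfl, Or.inl rfl⟩))

theorem e_mem_middleSpan {k : ℕ} : e k ∈ middleSpan K y y' X X' e (k + 1) :=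
  middles_subset (Or.inr (Or.inr ⟨k, rfl, Or.inr rfl⟩))

theorem X_mul_twist_mem (h : BBSystem p L y y' X X' e) {j : ℕ} (hj : j < L) :
    X j * twist y X (j + 1) ∈ middleSpan K y y' X X' e (j + 1) := by
  have h1 : X j * twist y X (j + 1) = twist y X j * X j + p.delta • twist y X (j + 1)
      - (p.delta * p.lam) • (e j * twist y' X' j) := by
    rw [← h.e_twist_X hj]
    change X j * (X j * twist y X j * X j) = _ + p.delta • (X j * twist y X j * X j) - _
    rw [← mul_assoc, ← mul_assoc, h.X_sq hj]
    simp only [sub_mul, add_mul, smul_mul_assoc, one_mul]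
  rw [h1]
  exact sub_mem (add_mem (middleSpan_mul_left_mem (twist_mem j) X_mem_middleSpan)
    (Submodule.smul_mem _ _ twist_mem_middleSpan))
    (Submodule.smul_mem _ _ (middleSpan_mul_right_mem (twist'_mem j) e_mem_middleSpan))

theorem X_mul_middle_mul_middle_mem (h : BBSystem p L y y' X X' e) {j : ℕ} (hj : j < L) {c d : R}
    (hc : c ∈ middles y X e j) (hd : d ∈ middles y X e (j + 1)) :
    X j * c * d ∈ middleSpan K y y' X X' e (j + 1) := by
  have hcS : c ∈ strand K y y' X X' (j + 1) := by
    rcases hc with rfl | rfl | ⟨i, rfl, rfl | rfl⟩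
    · exact one_mem _
    · exact twist_mem j
    · exact X_mem (by omega)
    · exact h.e_mem (by omega) (by omega)
  rcases hd with rfl | rfl | ⟨j', hj', hd⟩
  · rw [mul_one]
    exact middleSpan_mul_right_mem hcS X_mem_middleSpan
  · rw [mul_assoc, ← (h.twist_commute_strand hj hcS).eq, ← mul_assoc]
    exact middleSpan_mul_right_mem hcS (h.X_mul_twist_mem hj)
  · obtain rfl : j = j' := by omega
    rcases hc with rfl | rfl | ⟨i, rfl, rfl | rfl⟩ <;> rcases hd with rfl | rfl
    · rw [mul_one, h.X_sq hj]
      exact sub_mem (add_mem one_mem_middleSpan (Submodule.smul_mem _ _ X_mem_middleSpan))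
        (Submodule.smul_mem _ _ e_mem_middleSpan)
    · rw [mul_one, h.X_e j hj]
      exact Submodule.smul_mem _ _ e_mem_middleSpan
    · exact twist_mem_middleSpan
    · rw [h.X_twist_e hj]
      exact middleSpan_mul_left_mem (twist'_mem j) e_mem_middleSpan
    · rw [← h.braid i hj]
      exact middleSpan_mul_mem (X_mem (by omega)) (X_mem (by omega)) X_mem_middleSpan
    · rw [h.XX_e_succ hj]
      exact middleSpan_mul_left_mem (h.e_mem (by omega) (by omega)) e_mem_middleSpan
    · rw [h.X_succ_e_X_succ hj]
      exact middleSpan_mul_mem (X'_mem (by omega)) (X'_mem (by omega)) e_mem_middleSpan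
    · rw [h.X_succ_e_e_succ hj]
      exact middleSpan_mul_left_mem (X'_mem (by omega)) e_mem_middleSpan

/-- Middle factors commute with everything on fewer strands. -/
theorem middles_commute (h : BBSystem p L y y' X X' e) {j : ℕ} (hj : j < L) {a d : R}
    (ha : a ∈ strand K y y' X X' j) (hd : d ∈ middles y X e (j + 1)) : Commute d a := by
  rcases hd with rfl | rfl | ⟨j', hj', rfl | rfl⟩
  · exact Commute.one_left _
  · exact h.twist_commute_strand hj (strand_mono (by omega) ha)
  · exact h.X_commute_strand (by omega) (by omega) ha
  · exact h.e_commute_strand (by omega) (by omega) ha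

theorem X_mul_mem_middleSpan (h : BBSystem p L y y' X X' e) {j : ℕ} (hj : j < L)
    (ih : ∀ a ∈ strand K y y' X X' (j + 1), a ∈ middleSpan K y y' X X' e j) {t : R}
    (ht : t ∈ middleSpan K y y' X X' e (j + 1)) :
    X j * t ∈ middleSpan K y y' X X' e (j + 1) := by
  have key : ∀ a ∈ middleSpan K y y' X X' e j, ∀ d ∈ middles y X e (j + 1),
      X j * a * d ∈ middleSpan K y y' X X' e (j + 1) := by
    intro a ha d hd
    induction ha using Submodule.span_induction with
    | mem a ha =>
      obtain ⟨a₁, ha₁, c, hc, a₂, ha₂, rfl⟩ := ha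
      have h1 : X j * (a₁ * c * a₂) * d = a₁ * (X j * c * d) * a₂ := by
        rw [← mul_assoc, ← mul_assoc, (h.X_commute_strand hj le_rfl ha₁).eq, mul_assoc _ a₂,
          ← (h.middles_commute hj ha₂ hd).eq]
        simp only [mul_assoc]
      rw [h1]
      exact middleSpan_mul_mem (strand_mono (by omega) ha₁) (strand_mono (by omega) ha₂)
        (h.X_mul_middle_mul_middle_mem hj hc hd)
    | zero => simp
    | add s t _ _ hs ht => rw [mul_add, add_mul]; exact add_mem hs ht
    | smul c t _ ht => rw [mul_smul_comm, smul_mul_assoc]; exact Submodule.smul_mem _ _ ht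
  induction ht using Submodule.span_induction with
  | mem t ht =>
    obtain ⟨a, ha, d, hd, b, hb, rfl⟩ := ht
    rw [← mul_assoc, ← mul_assoc]
    exact middleSpan_mul_right_mem hb (key a (ih a ha) d hd)
  | zero => simp
  | add s t _ _ hs ht => rw [mul_add]; exact add_mem hs ht
  | smul c t _ ht => rw [mul_smul_comm]; exact Submodule.smul_mem _ _ ht

/-- The elements whose left multiplication preserves a subspace form a subalgebra. -/
def stabilizer (T : Submodule K R) : Subalgebra K R where
  carrier := {r | ∀ t ∈ T, r * t ∈ T}
  mul_mem' {a b} ha hb t ht := by rw [mul_assoc]; exact ha _ (hb t ht)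
  add_mem' {a b} ha hb t ht := by rw [add_mul]; exact add_mem (ha t ht) (hb t ht)
  algebraMap_mem' c t ht := by
    rw [← Algebra.smul_def]; exact Submodule.smul_mem _ _ ht

theorem y_mul_mem_middleSpan (h : BBSystem p L y y' X X' e) {t : R}
    (ht : t ∈ middleSpan K y y' X X' e 0) : y * t ∈ middleSpan K y y' X X' e 0 := by
  have hcom : ∀ a ∈ strand K y y' X X' 0, Commute y a := by
    intro a ha
    refine commute_of_mem_strand ha ?_
    rintro c (⟨h0, _⟩ | ⟨i, hi, _⟩) <;> omega
  induction ht using Submodule.span_induction with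
  | mem t ht =>
    obtain ⟨a, ha, d, hd, b, hb, rfl⟩ := ht
    rw [← mul_assoc, ← mul_assoc, (hcom a ha).eq, mul_assoc a]
    refine middleSpan_mul_mem ha hb ?_
    rcases hd with hd | hd | ⟨i, hi, _⟩
    · rw [hd, mul_one]; exact twist_mem_middleSpan (k := 0)
    · rw [hd, twist, h.y_sq, Algebra.algebraMap_eq_smul_one]
      exact add_mem (Submodule.smul_mem _ _ (twist_mem_middleSpan (k := 0)))
        (Submodule.smul_mem _ _ one_mem_middleSpan)
    · omega
  | zero => simp
  | add s t _ _ hs ht => rw [mul_add]; exact add_mem hs ht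
  | smul c t _ ht => rw [mul_smul_comm]; exact Submodule.smul_mem _ _ ht

theorem y'_eq (h : BBSystem p L y y' X X' e) (hq0 : p.q0 ≠ 0) :
    y' = p.q0⁻¹ • (y - p.q1 • (1 : R)) := by
  have h1 : y' * (y * y) = y' * (p.q1 • y + algebraMap K R p.q0) := by rw [h.y_sq]
  rw [← mul_assoc, h.y'_mul_y, one_mul, mul_add, mul_smul_comm, h.y'_mul_y,
    Algebra.algebraMap_eq_smul_one, mul_smul_comm, mul_one] at h1
  rw [h1, add_sub_cancel_left, smul_smul, inv_mul_cancel₀ hq0, one_smul]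

theorem strand_succ_le (h : BBSystem p L y y' X X' e) (hq0 : p.q0 ≠ 0) {k : ℕ} (hk : k ≤ L) :
    ∀ a ∈ strand K y y' X X' (k + 1), a ∈ middleSpan K y y' X X' e k := by
  induction k with
  | zero =>
    have hy : y ∈ stabilizer (middleSpan K y y' X X' e 0) := fun t ht => h.y_mul_mem_middleSpan ht
    have : strand K y y' X X' 1 ≤ stabilizer (middleSpan K y y' X X' e 0) := by
      refine Algebra.adjoin_le ?_
      rintro c (⟨_, rfl | rfl⟩ | ⟨i, hi, _⟩)
      · exact hy
      · rw [SetLike.mem_coe]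
        nth_rw 2 [h.y'_eq hq0]
        exact Subalgebra.smul_mem _ (sub_mem hy (Subalgebra.smul_mem _ (one_mem _) _)) _
      · omega
    intro a ha
    simpa using this ha 1 one_mem_middleSpan
  | succ j ih =>
    have hX : X j ∈ stabilizer (middleSpan K y y' X X' e (j + 1)) :=
      fun t ht => h.X_mul_mem_middleSpan hk (ih (by omega)) ht
    have he : e j ∈ stabilizer (middleSpan K y y' X X' e (j + 1)) := by
      have h1 : e j = (p.delta * p.lam)⁻¹ • (1 + p.delta • X j - X j * X j) := by
        rw [h.X_sq hk, sub_sub_cancel, smul_smul,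
          inv_mul_cancel₀ (mul_ne_zero h.delta_ne h.lam_ne), one_smul]
      rw [h1]
      exact Subalgebra.smul_mem _ (sub_mem (add_mem (one_mem _) (Subalgebra.smul_mem _ hX _))
        (mul_mem hX hX)) _
    have hS : strand K y y' X X' (j + 1) ≤ stabilizer (middleSpan K y y' X X' e (j + 1)) :=
      fun a ha t ht => middleSpan_mul_left_mem ha ht
    have : strand K y y' X X' (j + 1 + 1) ≤ stabilizer (middleSpan K y y' X X' e (j + 1)) := by
      refine Algebra.adjoin_le ?_
      rintro c (⟨_, hc⟩ | ⟨i, hi, hc⟩)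
      · exact hS (Algebra.subset_adjoin (Or.inl ⟨by omega, hc⟩))
      · rcases Nat.lt_or_ge (i + 1) (j + 1) with hij | hij
        · exact hS (Algebra.subset_adjoin (Or.inr ⟨i, hij, hc⟩))
        · obtain rfl : i = j := by omega
          rcases hc with rfl | rfl
          · exact hX
          · rw [h.X'_eq hk]
            exact add_mem (sub_mem hX (Subalgebra.smul_mem _ (one_mem _) _))
              (Subalgebra.smul_mem _ he _)
    intro a ha
    simpa using this ha 1 one_mem_middleSpan

/-! ### Closing the last strand -/

/-- The products `b * e k` with `b` on `k` strands. -/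
def closure (K : Type*) {R : Type*} [Field K] [Ring R] [Algebra K R] (y y' : R)
    (X X' e : ℕ → R) (k : ℕ) : Submodule K R :=
  (Subalgebra.toSubmodule (strand K y y' X X' k)).map (LinearMap.mulRight K (e k))

theorem mem_closure {k : ℕ} {r : R} : r ∈ closure K y y' X X' e k ↔
    ∃ b ∈ strand K y y' X X' k, b * e k = r := by
  simp [closure]

theorem e_twist_e_mem (h : BBSystem p L y y' X X' e) {k : ℕ} (hk : k < L) :
    e k * twist y X k * e k ∈ closure K y y' X X' e k := by
  induction k with
  | zero =>
    rw [mem_closure]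
    exact ⟨algebraMap K R p.A, Subalgebra.algebraMap_mem _ _, by
      rw [← Algebra.smul_def]; exact (h.eye hk).symm⟩
  | succ i ih =>
    obtain ⟨b, hb, hbe⟩ := mem_closure.1 (ih (by omega))
    set z := twist y X i with hz
    have hzc : X' (i + 1) * z = z * X' (i + 1) :=
      (h.commute_X' hk (h.X_commute_strand hk le_rfl
        (twist_mem (K := K) (y' := y') (X' := X') i)).symm).symm
    have hze : e (i + 1) * z = z * e (i + 1) :=
      h.e_commute_strand hk le_rfl (twist_mem (K := K) (y' := y') (X' := X') i)
    have hz'e : e (i + 1) * twist y' X' i = twist y' X' i * e (i + 1) :=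
      h.e_commute_strand hk le_rfl (twist'_mem (K := K) (y := y) (X := X) i)
    have hbe' : e (i + 1) * b = b * e (i + 1) := h.e_commute_strand hk (by omega) hb
    have h1 : e (i + 1) * e i * z * e i * e (i + 1) = b * e (i + 1) := by
      rw [mul_assoc (e (i + 1)), mul_assoc (e (i + 1)), ← hbe, ← mul_assoc, hbe', mul_assoc b,
        mul_assoc b, h.e_succ_e_e_succ hk]
    have h2 : e (i + 1) * e i * z * X' (i + 1) * e i * e (i + 1)
        = twist y' X' i * e (i + 1) := by
      rw [mul_assoc _ z, ← hzc, ← mul_assoc, ← h.e_succ_X hk, mul_assoc (e (i + 1)),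
        mul_assoc (e (i + 1)), h.X_twist_e (by omega), ← mul_assoc, hz'e, mul_assoc _ _ (e i),
        mul_assoc, h.e_succ_e_e_succ hk]
    have h3 : e (i + 1) * e i * z * e (i + 1) * e i * e (i + 1) = z * e (i + 1) := by
      rw [mul_assoc, mul_assoc, ← mul_assoc (e (i + 1)) (e i) (e (i + 1)), h.e_succ_e_e_succ hk,
        mul_assoc, ← hze, ← mul_assoc, h.e_succ_e_e_succ hk, hze]
    have key : e (i + 1) * twist y X (i + 1) * e (i + 1)
        = b * e (i + 1) - p.delta • (twist y' X' i * e (i + 1))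
          + (p.delta * p.lam⁻¹) • (z * e (i + 1)) := by
      calc e (i + 1) * (X i * z * X i) * e (i + 1)
          = e (i + 1) * X i * z * (X i * e (i + 1)) := by simp only [mul_assoc]
        _ = e (i + 1) * e i * (X' (i + 1) * z) * X' (i + 1) * (e i * e (i + 1)) := by
            rw [h.e_succ_X hk, h.X_e_succ hk]; simp only [mul_assoc]
        _ = e (i + 1) * e i * z * (X' (i + 1) * X' (i + 1)) * e i * e (i + 1) := by
            rw [hzc]; simp only [mul_assoc]
        _ = _ := by
            rw [h.X'_sq hk, ← h1, ← h2, ← h3]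
            simp only [mul_add, mul_sub, add_mul, sub_mul, mul_one, mul_smul_comm, smul_mul_assoc]
    rw [key, mem_closure]
    refine ⟨b - p.delta • twist y' X' i + (p.delta * p.lam⁻¹) • z, ?_, ?_⟩
    · exact add_mem (sub_mem (strand_mono (by omega) hb) (Subalgebra.smul_mem _ (twist'_mem i) _))
        (Subalgebra.smul_mem _ (twist_mem i) _)
    · simp only [add_mul, sub_mul, smul_mul_assoc]

theorem e_mul_e_mem (h : BBSystem p L y y' X X' e) (hq0 : p.q0 ≠ 0) {k : ℕ} (hk : k < L) {a : R}
    (ha : a ∈ strand K y y' X X' (k + 1)) : e k * a * e k ∈ closure K y y' X X' e k := by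
  have ha' := h.strand_succ_le hq0 hk.le a ha
  clear ha
  induction ha' using Submodule.span_induction with
  | mem t ht =>
    obtain ⟨a, ha, c, hc, b, hb, rfl⟩ := ht
    have hae := (h.e_commute_strand hk le_rfl ha).eq
    have hbe := (h.e_commute_strand hk le_rfl hb).eq
    have h1 : e k * (a * c * b) * e k = a * (e k * c * e k) * b := by
      rw [← mul_assoc, ← mul_assoc, hae, mul_assoc _ b, ← hbe]
      simp only [mul_assoc]
    have h2 : e k * c * e k ∈ closure K y y' X X' e k := by
      rcases hc with rfl | rfl | ⟨j, rfl, rfl | rfl⟩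
      · rw [mul_one, h.e_sq hk]
        exact Submodule.smul_mem _ _ (mem_closure.2 ⟨1, one_mem _, one_mul _⟩)
      · exact h.e_twist_e_mem hk
      · rw [h.e_X_e j hk]
        exact Submodule.smul_mem _ _ (mem_closure.2 ⟨1, one_mem _, one_mul _⟩)
      · rw [h.e_succ_e_e_succ hk]
        exact mem_closure.2 ⟨1, one_mem _, one_mul _⟩
    obtain ⟨r, hr, hre⟩ := mem_closure.1 h2
    rw [h1, ← hre, mem_closure]
    refine ⟨a * r * b, mul_mem (mul_mem ha hr) hb, ?_⟩
    rw [mul_assoc _ b, ← hbe]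
    simp only [mul_assoc]
  | zero => simp
  | add s t _ _ hs ht => rw [mul_add, add_mul]; exact add_mem hs ht
  | smul c t _ ht => rw [mul_smul_comm, smul_mul_assoc]; exact Submodule.smul_mem _ _ ht

end BBSystem

namespace BB

variable {K : Type*} [Field K] (p : BBParams K) {n : ℕ}

/-- The inverse of the generator `Y`. -/
noncomputable def Yinv (h : 0 < n) : BB p n :=
  RingQuot.mkAlgHom K (BBRel p n) (BBFree.Yinv K h)

/-- The inverse of the generator `X_{i+1}`. -/
noncomputable def Xinv (i : ℕ) (h : i + 1 < n) : BB p n :=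
  RingQuot.mkAlgHom K (BBRel p n) (BBFree.Xinv K i h)

/-- The generator `X_{i+1}`, extended by zero to all indices. -/
noncomputable def Xtot (n i : ℕ) : BB p n := if h : i + 1 < n then X p i h else 0

/-- The inverse generator `X_{i+1}⁻¹`, extended by zero to all indices. -/
noncomputable def Xinvtot (n i : ℕ) : BB p n := if h : i + 1 < n then Xinv p i h else 0

/-- The element `e_{i+1}`, extended by zero to all indices. -/
noncomputable def etot (n i : ℕ) : BB p n := if h : i + 1 < n then e p i h else 0

theorem e_eq (i : ℕ) (h : i + 1 < n) :
    e p i h = 1 - p.delta⁻¹ • (X p i h - Xinv p i h) := by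
  simp only [e, BBFree.e, map_sub, map_one, map_smul, X, Xinv]

theorem rel {a b : FreeAlgebra K (BBGen n)} (h : BBRel p n a b) :
    RingQuot.mkAlgHom K (BBRel p n) a = RingQuot.mkAlgHom K (BBRel p n) b :=
  RingQuot.mkAlgHom_rel K h

theorem system (hδ : p.delta ≠ 0) (hlam : p.lam ≠ 0) (n : ℕ) :
    BBSystem p n (Y p (Nat.succ_pos n)) (Yinv p (Nat.succ_pos n)) (Xtot p (n + 1))
      (Xinvtot p (n + 1)) (etot p (n + 1)) where
  delta_ne := hδ
  lam_ne := hlam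
  y_mul_y' := by simpa only [map_mul, map_one, Y, Yinv] using rel p (BBRel.Y_inv (Nat.succ_pos n))
  y'_mul_y := by simpa only [map_mul, map_one, Y, Yinv] using rel p (BBRel.inv_Y (Nat.succ_pos n))
  X_mul_X' i hi := by
    have h : i + 1 < n + 1 := by omega
    simpa only [Xtot, Xinvtot, h, dif_pos, map_mul, map_one, X, Xinv] using rel p (BBRel.X_inv i h)
  X'_mul_X i hi := by
    have h : i + 1 < n + 1 := by omega
    simpa only [Xtot, Xinvtot, h, dif_pos, map_mul, map_one, X, Xinv] using rel p (BBRel.inv_X i h)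
  e_eq i hi := by
    have h : i + 1 < n + 1 := by omega
    simp only [Xtot, Xinvtot, etot, h, dif_pos, e_eq]
  comm i j hij hj := by
    have h : i + 1 < n + 1 := by omega
    have h' : j + 1 < n + 1 := by omega
    simpa only [Xtot, Y, X, h, h', dif_pos, map_mul] using rel p (BBRel.comm i j h h' hij)
  braid i hi := by
    have h : i + 1 < n + 1 := by omega
    have h' : i + 1 + 1 < n + 1 := by omega
    simpa only [Xtot, Y, X, h, h', dif_pos, map_mul] using rel p (BBRel.braid i h h')
  X_e i hi := by
    have h : i + 1 < n + 1 := by omega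
    simpa only [Xtot, etot, Y, X, e, h, dif_pos, map_mul, map_smul] using rel p (BBRel.X_e i h)
  e_X i hi := by
    have h : i + 1 < n + 1 := by omega
    simpa only [Xtot, etot, Y, X, e, h, dif_pos, map_mul, map_smul] using rel p (BBRel.e_X i h)
  e_X_e i hi := by
    have h : i + 1 < n + 1 := by omega
    have h' : i + 1 + 1 < n + 1 := by omega
    simpa only [Xtot, etot, Y, X, e, h, h', dif_pos, map_mul, map_smul] using rel p (BBRel.e_X_e i h h')
  e_X'_e i hi := by
    have h : i + 1 < n + 1 := by omega
    have h' : i + 1 + 1 < n + 1 := by omega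
    simpa only [Xinvtot, etot, Xinv, e, h, h', dif_pos, map_mul, map_smul] using
      rel p (BBRel.e_Xinv_e i h h')
  braidB h := by
    have h : 0 + 1 < n + 1 := by omega
    simpa only [Xtot, Y, X, h, dif_pos, map_mul] using rel p (BBRel.braidB (Nat.succ_pos n) h)
  y_sq := by
    simpa only [Y, map_mul, map_add, map_smul, AlgHom.commutes] using
      rel p (BBRel.Y_sq (Nat.succ_pos n))
  yXye h := by
    have h : 0 + 1 < n + 1 := by omega
    simpa only [Xtot, etot, Y, X, e, h, dif_pos, map_mul] using rel p (BBRel.YXYe (Nat.succ_pos n) h)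
  y_comm i h0 hi := by
    have h : i + 1 < n + 1 := by omega
    simpa only [Xtot, Y, X, h, dif_pos, map_mul] using rel p (BBRel.Y_comm (Nat.succ_pos n) i h h0)
  eye h := by
    have h : 0 + 1 < n + 1 := by omega
    simpa only [Xtot, etot, Y, X, e, h, dif_pos, map_mul, map_smul] using
      rel p (BBRel.eYe (Nat.succ_pos n) h)

/-- Induction principle: a subalgebra containing the generators is everything. -/
theorem mem_of_generators (S : Subalgebra K (BB p n)) (hY : ∀ h, Y p (n := n) h ∈ S)
    (hYi : ∀ h, Yinv p (n := n) h ∈ S) (hX : ∀ i h, X p (n := n) i h ∈ S)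
    (hXi : ∀ i h, Xinv p (n := n) i h ∈ S) (a : BB p n) : a ∈ S := by
  obtain ⟨b, rfl⟩ := RingQuot.mkAlgHom_surjective K (BBRel p n) a
  induction b using FreeAlgebra.induction with
  | grade0 r => rw [AlgHom.commutes]; exact S.algebraMap_mem r
  | grade1 g =>
    cases g with
    | Y h => exact hY h
    | Yinv h => exact hYi h
    | X i h => exact hX i h
    | Xinv i h => exact hXi i h
  | mul a b ha hb => rw [map_mul]; exact mul_mem ha hb
  | add a b ha hb => rw [map_add]; exact add_mem ha hb

theorem succHom_Y (h : 0 < n) : succHom p n (Y p h) = Y p (Nat.lt_succ_of_lt h) := by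
  exact (RingQuot.liftAlgHom_mkAlgHom_apply K _ _ _).trans (congrArg _ (freeSucc_Y _))

theorem succHom_Yinv (h : 0 < n) : succHom p n (Yinv p h) = Yinv p (Nat.lt_succ_of_lt h) := by
  exact (RingQuot.liftAlgHom_mkAlgHom_apply K _ _ _).trans (congrArg _ (freeSucc_Yinv _))

theorem succHom_X (i : ℕ) (h : i + 1 < n) :
    succHom p n (X p i h) = X p i (Nat.lt_succ_of_lt h) := by
  exact (RingQuot.liftAlgHom_mkAlgHom_apply K _ _ _).trans (congrArg _ (freeSucc_X _ _))

theorem succHom_Xinv (i : ℕ) (h : i + 1 < n) :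
    succHom p n (Xinv p i h) = Xinv p i (Nat.lt_succ_of_lt h) := by
  exact (RingQuot.liftAlgHom_mkAlgHom_apply K _ _ _).trans (congrArg _ (freeSucc_Xinv _ _))

theorem succHom_mem_strand (n : ℕ) (a : BB p (n + 1)) :
    succHom p (n + 1) a ∈ BBSystem.strand K (Y p (Nat.succ_pos (n + 1)))
      (Yinv p (Nat.succ_pos (n + 1))) (Xtot p (n + 2)) (Xinvtot p (n + 2)) (n + 1) := by
  refine mem_of_generators p ((BBSystem.strand K _ _ _ _ (n + 1)).comap (succHom p (n + 1)))
    ?_ ?_ ?_ ?_ a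
  · intro h
    rw [Subalgebra.mem_comap, succHom_Y]
    exact BBSystem.y_mem h
  · intro h
    rw [Subalgebra.mem_comap, succHom_Yinv]
    exact BBSystem.y'_mem h
  · intro i h
    rw [Subalgebra.mem_comap, succHom_X]
    have := BBSystem.X_mem (K := K) (y := Y p (Nat.succ_pos (n + 1)))
      (y' := Yinv p (Nat.succ_pos (n + 1))) (X := Xtot p (n + 2)) (X' := Xinvtot p (n + 2)) h
    rwa [Xtot, dif_pos (by omega)] at this
  · intro i h
    rw [Subalgebra.mem_comap, succHom_Xinv]
    have := BBSystem.X'_mem (K := K) (y := Y p (Nat.succ_pos (n + 1)))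
      (y' := Yinv p (Nat.succ_pos (n + 1))) (X := Xtot p (n + 2)) (X' := Xinvtot p (n + 2)) h
    rwa [Xinvtot, dif_pos (by omega)] at this

theorem strand_le_range (n : ℕ) :
    BBSystem.strand K (Y p (Nat.succ_pos (n + 1))) (Yinv p (Nat.succ_pos (n + 1)))
      (Xtot p (n + 2)) (Xinvtot p (n + 2)) n
      ≤ ((succHom p (n + 1)).comp (succHom p n)).range := by
  refine Algebra.adjoin_le ?_
  rintro c (⟨h, rfl | rfl⟩ | ⟨i, h, rfl | rfl⟩)
  · exact ⟨Y p h, by simp [succHom_Y]⟩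
  · exact ⟨Yinv p h, by simp [succHom_Yinv]⟩
  · refine ⟨X p i h, ?_⟩
    rw [Xtot, dif_pos (by omega)]
    simp [succHom_X]
  · refine ⟨Xinv p i h, ?_⟩
    rw [Xinvtot, dif_pos (by omega)]
    simp [succHom_Xinv]

/-- A conditional expectation exists, with linear members. -/
theorem exists_condExp (hδ : p.delta ≠ 0) (hlam : p.lam ≠ 0) (hq0 : p.q0 ≠ 0) (hx : p.x ≠ 0) :
    ∃ ε : ∀ n, BB p (n + 1) →ₗ[K] BB p n, IsCondExp p (fun n => ε n) := by
  suffices H : ∀ n, ∃ f : BB p (n + 1) →ₗ[K] BB p n, ∀ a,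
      e p n (Nat.lt_succ_self (n + 1)) * succHom p (n + 1) a * e p n (Nat.lt_succ_self (n + 1)) =
      p.x • (succHom p (n + 1) (succHom p n (f a)) * e p n (Nat.lt_succ_self (n + 1))) by
    choose ε hε using H
    exact ⟨ε, hε⟩
  intro n
  set E := e p n (Nat.lt_succ_self (n + 1)) with hE
  let g : BB p n →ₗ[K] BB p (n + 2) :=
    p.x • (LinearMap.mulRight K E ∘ₗ ((succHom p (n + 1)).comp (succHom p n)).toLinearMap)
  let f : BB p (n + 1) →ₗ[K] BB p (n + 2) :=
    LinearMap.mulRight K E ∘ₗ LinearMap.mulLeft K E ∘ₗ (succHom p (n + 1)).toLinearMap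
  have hfg : ∀ a, f a ∈ LinearMap.range g := by
    intro a
    have h1 := (system p hδ hlam (n + 1)).e_mul_e_mem hq0 (Nat.lt_succ_self n)
      (succHom_mem_strand p n a)
    obtain ⟨b, hb, hbe⟩ := BBSystem.mem_closure.1 h1
    obtain ⟨c, rfl⟩ := strand_le_range p n hb
    rw [etot, dif_pos (Nat.lt_succ_self (n + 1))] at hbe
    refine ⟨p.x⁻¹ • c, ?_⟩
    change p.x • (succHom p (n + 1) (succHom p n (p.x⁻¹ • c)) * E) = E * succHom p (n + 1) a * E
    rw [map_smul, map_smul, smul_mul_assoc, smul_smul, mul_inv_cancel₀ hx, one_smul]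
    exact hbe
  obtain ⟨k, hk⟩ := Module.projective_lifting_property g.rangeRestrict
    (f.codRestrict (LinearMap.range g) hfg) g.surjective_rangeRestrict
  refine ⟨k, fun a => ?_⟩
  have := congrArg Subtype.val (LinearMap.congr_fun hk a)
  exact this.symm

end BB

noncomputable section

namespace TensorRep

variable {K : Type*} [Field K] {m : ℕ}

/-! ### The index set -/

@[simp] theorem idx_neg_val (i : Idx m) : (-i).1 = -i.1 := rfl

@[simp] theorem idx_zero_val : (0 : Idx m).1 = 0 := rfl

@[simp] theorem idx_neg_neg (i : Idx m) : - -i = i := Subtype.ext (by simp)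

@[simp] theorem idx_neg_zero : -(0 : Idx m) = 0 := Subtype.ext (by simp)

theorem idx_eq_iff {i j : Idx m} : i = j ↔ i.1 = j.1 := Subtype.ext_iff

theorem idx_lt_iff {i j : Idx m} : i < j ↔ i.1 < j.1 := Iff.rfl

theorem idx_neg_inj {i j : Idx m} : -i = -j ↔ i = j := by
  simp only [idx_eq_iff, idx_neg_val]; omega

theorem idx_eq_neg_iff {i j : Idx m} : i = -j ↔ j = -i := by
  simp only [idx_eq_iff, idx_neg_val]; omega

/-! ### The braiding on basis vectors -/

/-- `q - q⁻¹` with `q = s ^ 2`. -/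
def dl (s : K) : K := s ^ 2 - (s ^ 2)⁻¹

/-- The weight of the transposition `v_a ⊗ v_b ↦ v_b ⊗ v_a` in `B`. -/
def ka (s : K) (a b : Idx m) : K :=
  if a = b then (if a = 0 then 1 else s ^ 2) else if a = -b then (s ^ 2)⁻¹ else 1

/-- The weight of the identity on `v_a ⊗ v_b` in `B`. -/
def th (s : K) (a b : Idx m) : K := if a < b then dl s else 0

theorem sum_f_smul {W : Type*} [AddCommGroup W] [Module K W] (w : Idx m × Idx m → W)
    (i j k l a b : Idx m) :
    ∑ p, (f K i j ⊗ₖ f K k l) p (a, b) • w p = if j = a ∧ l = b then w (i, k) else 0 := by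
  rw [Finset.sum_eq_single (i, k)]
  · by_cases h1 : j = a <;> by_cases h2 : l = b <;>
      simp [f, Matrix.kroneckerMap_apply, h1, h2]
  · rintro ⟨c, d⟩ - hp
    have : ¬ (i = c ∧ k = d) := fun h => hp (by rw [h.1, h.2])
    by_cases h1 : i = c
    · have h2 : k ≠ d := fun h => this ⟨h1, h⟩
      simp [f, Matrix.kroneckerMap_apply, h2]
    · simp [f, Matrix.kroneckerMap_apply, h1]
  · simp

/-- The column functional `M ↦ ∑ p, M p (a, b) • w p`. -/
def colSum {W P : Type*} [AddCommGroup W] [Module K W] [Fintype P] (w : P → W) (r : P) :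
    Matrix P P K →ₗ[K] W where
  toFun M := ∑ p, M p r • w p
  map_add' M N := by simp [add_smul, Finset.sum_add_distrib]
  map_smul' c M := by simp [mul_smul, Finset.smul_sum]

theorem sum_B_smul {W : Type*} [AddCommGroup W] [Module K W] (s : K) (w : Idx m × Idx m → W)
    (a b : Idx m) :
    ∑ p, B m s p (a, b) • w p = ka s a b • w (b, a) + th s a b • w (a, b)
      - if b = -a then dl s • ∑ j, (if j < -a then s ^ (j.1 + a.1) else 0) • w (j, -j) else 0 := by
  have hf : ∀ i j k l, colSum w (a, b) (f K i j ⊗ₖ f K k l) =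
      if j = a ∧ l = b then w (i, k) else 0 := fun i j k l => sum_f_smul w i j k l a b
  change colSum w (a, b) (B m s) = _
  have h1 : ∑ i : Idx m with i ≠ 0, (s ^ 2 • (if i = a ∧ i = b then w (i, i) else 0) +
      (s ^ 2)⁻¹ • (if -i = a ∧ i = b then w (i, -i) else 0)) =
      if b ≠ 0 then s ^ 2 • (if b = a then w (b, b) else 0) +
        (s ^ 2)⁻¹ • (if -b = a then w (b, -b) else 0) else 0 := by
    rw [Finset.sum_filter, Fintype.sum_eq_single b]
    · simp
    · intro i hi; simp [hi]
  have h2 : ∑ ij : Idx m × Idx m with ij.1 ≠ ij.2 ∧ ij.1 ≠ -ij.2,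
      (if ij.2 = a ∧ ij.1 = b then w (ij.1, ij.2) else 0) =
      if b ≠ a ∧ b ≠ -a then w (b, a) else 0 := by
    rw [Finset.sum_filter, Fintype.sum_eq_single (b, a)]
    · simp
    · rintro ⟨i, j⟩ hi
      have : ¬ (j = a ∧ i = b) := fun h => hi (by rw [h.1, h.2])
      simp [this]
  have h3 : ∑ ij : Idx m × Idx m with ij.1 < ij.2,
      (if ij.1 = a ∧ ij.2 = b then w (ij.1, ij.2) else 0) = if a < b then w (a, b) else 0 := by
    rw [Finset.sum_filter, Fintype.sum_eq_single (a, b)]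
    · simp
    · rintro ⟨i, j⟩ hi
      have : ¬ (i = a ∧ j = b) := fun h => hi (by rw [h.1, h.2])
      simp [this]
  have h4 : ∑ ij : Idx m × Idx m with ij.2 < -ij.1,
      s ^ (ij.1.1 + ij.2.1) • (if ij.2 = a ∧ -ij.2 = b then w (ij.1, -ij.1) else 0) =
      if b = -a then ∑ j, (if j < -a then s ^ (j.1 + a.1) else 0) • w (j, -j) else 0 := by
    rw [Finset.sum_filter, Fintype.sum_prod_type]
    by_cases hb : b = -a
    · rw [if_pos hb]
      refine Finset.sum_congr rfl fun i _ => ?_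
      rw [Fintype.sum_eq_single a]
      · have : a < -i ↔ i < -a := by simp only [idx_lt_iff, idx_neg_val]; omega
        simp [hb, this, ite_smul]
      · intro j hj; simp [hj]
    · rw [if_neg hb]
      refine Finset.sum_eq_zero fun i _ => Finset.sum_eq_zero fun j _ => ?_
      have : ¬ (j = a ∧ -j = b) := fun h => hb (by rw [← h.1, h.2])
      simp [this]
  simp only [B, map_add, map_sub, map_smul, map_sum, hf]
  rw [h1, h2, h3, h4, smul_sub, ← dl]
  have h5 : dl s • (if a < b then w (a, b) else 0) = th s a b • w (a, b) := by
    unfold th; split_ifs <;> simp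
  have h6 : dl s • (if b = -a then ∑ j, (if j < -a then s ^ (j.1 + a.1) else 0) • w (j, -j) else 0)
      = if b = -a then dl s • ∑ j, (if j < -a then s ^ (j.1 + a.1) else 0) • w (j, -j) else 0 := by
    split_ifs <;> simp
  rw [h5, h6, ← add_sub_assoc]
  congr 2
  by_cases hab : b = a
  · subst hab
    by_cases hb : b = 0
    · subst hb; simp [ka]
    · have hb' : -b ≠ b := by
        intro h; apply hb; rw [idx_eq_iff] at h ⊢; simp only [idx_neg_val, idx_zero_val] at *; omega
      have hb'' : ¬ (0 = b) := fun h => hb h.symm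
      simp [ka, hb, hb', hb'']
  · have hab' : ¬ a = b := fun h => hab h.symm
    by_cases h : b = -a
    · have h0 : b ≠ 0 := by
        rintro rfl; apply hab; rw [idx_eq_iff] at h ⊢
        simp only [idx_neg_val, idx_zero_val] at *; omega
      have ha : a ≠ 0 := by
        rintro rfl; apply h0; simpa using h
      subst h
      have ha' : ¬ (0 = a) := fun h => ha h.symm
      simp [ka, hab, hab', h0, ha']
    · have h' : ¬ a = -b := fun h' => h (by rw [h']; simp)
      have h'' : ¬ -b = a := fun h'' => h' h''.symm
      have h0 : ¬ (0 = a ∧ 0 = b) := fun h0 => hab (h0.2.symm.trans h0.1)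
      simp [ka, hab, hab', h, h', h'', h0]

/-- The entries of `B`. -/
theorem B_apply (s : K) (a b c d : Idx m) :
    B m s (c, d) (a, b) = (if c = b ∧ d = a then ka s a b else 0)
      + (if c = a ∧ d = b then th s a b else 0)
      - (if b = -a ∧ d = -c ∧ c < -a then dl s * s ^ (c.1 + a.1) else 0) := by
  have h := sum_B_smul (K := K) s (fun p => if p = (c, d) then (1 : K) else 0) a b
  have h1 : ∑ p, B m s p (a, b) • (if p = (c, d) then (1 : K) else 0) = B m s (c, d) (a, b) := by
    simp
  have h2 : ∑ j : Idx m, (if j < -a then s ^ (j.1 + a.1) else 0) •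
      (if (j, -j) = (c, d) then (1 : K) else 0) =
      if d = -c ∧ c < -a then s ^ (c.1 + a.1) else 0 := by
    rw [Fintype.sum_eq_single c]
    · by_cases hd : d = -c
      · simp [hd]
      · have : ¬ (-c = d) := fun h => hd h.symm
        simp [hd, this]
    · intro j hj; simp [hj]
  rw [h1, h2] at h
  rw [h]
  congr 1
  · congr 1 <;> · simp [eq_comm]
  · by_cases h3 : b = -a <;> by_cases h4 : d = -c ∧ c < -a <;> simp [h3, h4]

end TensorRep

end

noncomputable section

namespace TensorRep

variable {K : Type*} [Field K] {m : ℕ}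

/-! ### Partial sums of powers over the index set -/

theorem idxSet_zero : idxSet 0 = {0} := by
  ext i
  simp only [idxSet, Finset.mem_insert, Finset.mem_filter, Finset.mem_Icc, Finset.mem_singleton]
  constructor
  · rintro (h | ⟨⟨h1, h2⟩, -⟩)
    · exact h
    · push_cast at *; omega
  · exact Or.inl

theorem idxSet_succ (m : ℕ) :
    idxSet (m + 1) = insert (2 * (m : ℤ) + 1) (insert (-(2 * (m : ℤ) + 1)) (idxSet m)) := by
  ext i
  simp only [idxSet, Finset.mem_insert, Finset.mem_filter, Finset.mem_Icc, Int.odd_iff]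
  push_cast
  omega

theorem abs_lt_of_mem {m : ℕ} {c : ℤ} (hc : c ∈ idxSet m) :
    -(2 * (m : ℤ) + 1) < c ∧ c < 2 * (m : ℤ) + 1 := by
  simp only [idxSet, Finset.mem_insert, Finset.mem_filter, Finset.mem_Icc] at hc
  omega

theorem sum_idxSet_succ (m : ℕ) (g : ℤ → K) :
    ∑ j ∈ idxSet (m + 1), g j
      = g (2 * (m : ℤ) + 1) + (g (-(2 * (m : ℤ) + 1)) + ∑ j ∈ idxSet m, g j) := by
  rw [idxSet_succ, Finset.sum_insert, Finset.sum_insert]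
  · intro h; have := abs_lt_of_mem h; omega
  · rw [Finset.mem_insert]
    rintro (h | h)
    · omega
    · have := abs_lt_of_mem h; omega

/-- The partial sum `λ + δ ∑_{j < c} q ^ j`. -/
def partialSum (s : K) (c : ℤ) : K :=
  if c < 0 then s ^ (2 * c) * (s ^ 2)⁻¹ else if c = 0 then 1
  else s ^ (2 * c) * (s ^ 2)⁻¹ + dl s

theorem zpow_four_mul_succ (s : K) (hs : s ≠ 0) (m : ℕ) :
    s ^ (4 * ((m + 1 : ℕ) : ℤ)) = s ^ (4 * (m : ℤ)) * s ^ 4 ∧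
    s ^ (2 * (2 * (m : ℤ) + 1)) = s ^ (4 * (m : ℤ)) * s ^ 2 ∧
    s ^ (2 * -(2 * (m : ℤ) + 1)) = (s ^ (4 * (m : ℤ)) * s ^ 2)⁻¹ := by
  have h2 : s ^ (2 * (2 * (m : ℤ) + 1)) = s ^ (4 * (m : ℤ)) * s ^ 2 := by
    rw [← zpow_natCast s 2, ← zpow_add₀ hs]; congr 1; push_cast; ring
  refine ⟨?_, h2, ?_⟩
  · rw [← zpow_natCast s 4, ← zpow_add₀ hs]; congr 1
  · rw [← h2, ← zpow_neg]; congr 1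

theorem sum_pow_idxSet (s : K) (hs : s ≠ 0) (m : ℕ) :
    dl s * ∑ j ∈ idxSet m, s ^ (2 * j) = s ^ (4 * (m : ℤ)) - (s ^ (4 * (m : ℤ)))⁻¹ + dl s := by
  induction m with
  | zero => simp [idxSet_zero]
  | succ m ih =>
    obtain ⟨h1, h2, h3⟩ := zpow_four_mul_succ s hs m
    rw [sum_idxSet_succ, h1, h2, h3, mul_add, mul_add, ih]
    have hP : s ^ (4 * (m : ℤ)) ≠ 0 := zpow_ne_zero _ hs
    generalize s ^ (4 * (m : ℤ)) = P at *
    unfold dl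
    field_simp
    ring

theorem sum_pow_idxSet_lt (s : K) (hs : s ≠ 0) (m : ℕ) (c : ℤ) (hc : c ∈ idxSet m) :
    dl s * ∑ j ∈ idxSet m, (if j < c then s ^ (2 * j) else 0)
      = partialSum s c - (s ^ (4 * (m : ℤ)))⁻¹ := by
  induction m generalizing c with
  | zero =>
    rw [idxSet_zero, Finset.mem_singleton] at hc
    subst hc
    simp [idxSet_zero, partialSum]
  | succ m ih =>
    obtain ⟨h1, h2, h3⟩ := zpow_four_mul_succ s hs m
    have hP : s ^ (4 * (m : ℤ)) ≠ 0 := zpow_ne_zero _ hs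
    rw [sum_idxSet_succ, h1]
    rw [idxSet_succ, Finset.mem_insert, Finset.mem_insert] at hc
    rcases hc with hc | hc | hc
    · have h4 : ∑ j ∈ idxSet m, (if j < c then s ^ (2 * j) else 0)
          = ∑ j ∈ idxSet m, s ^ (2 * j) := by
        refine Finset.sum_congr rfl fun j hj => if_pos ?_
        have := abs_lt_of_mem hj; omega
      rw [h4, if_neg (by omega), if_pos (by omega), mul_add, mul_add, sum_pow_idxSet s hs, h3,
        partialSum, if_neg (by omega), if_neg (by omega), hc, h2]
      generalize s ^ (4 * (m : ℤ)) = P at *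
      unfold dl
      field_simp
      ring
    · have h4 : ∑ j ∈ idxSet m, (if j < c then s ^ (2 * j) else 0) = 0 := by
        refine Finset.sum_eq_zero fun j hj => if_neg ?_
        have := abs_lt_of_mem hj; omega
      rw [h4, if_neg (by omega), if_neg (by omega), partialSum, if_pos (by omega), hc, h3]
      generalize s ^ (4 * (m : ℤ)) = P at *
      field_simp
      ring
    · have := abs_lt_of_mem hc
      rw [if_neg (by omega), if_pos (by omega), mul_add, mul_add, ih c hc, h3]
      generalize s ^ (4 * (m : ℤ)) = P at *
      unfold dl
      field_simp
      ring

/-- `λ = q ^ (-2 m)`, with `q = s ^ 2`. -/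
def lm (m : ℕ) (s : K) : K := (s ^ (4 * (m : ℤ)))⁻¹

theorem sum_pow_lt (s : K) (hs : s ≠ 0) (c : Idx m) :
    dl s * ∑ j : Idx m, (if j < c then s ^ (2 * j.1) else 0) = partialSum s c.1 - lm m s := by
  rw [lm, ← sum_pow_idxSet_lt s hs m c.1 c.2]
  congr 1
  exact Finset.sum_coe_sort (idxSet m) fun j => if j < c.1 then s ^ (2 * j) else 0

/-! ### The braiding on the zero weight space -/

/-- The matrix of `B` on the vectors `v_i ⊗ v_{-i}`. -/
def M (s : K) (i a : Idx m) : K :=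
  (if i = -a then ka s a (-a) else 0) + (if i = a then th s a (-a) else 0)
    - (if i < -a then dl s * s ^ (i.1 + a.1) else 0)

theorem ka_neg (s : K) (a : Idx m) : ka s a (-a) = if a = 0 then 1 else (s ^ 2)⁻¹ := by
  unfold ka
  by_cases h : a = 0
  · subst h; simp
  · have : a ≠ -a := by
      intro h'; apply h; rw [idx_eq_iff] at *; simp only [idx_neg_val, idx_zero_val] at *; omega
    simp [h, this]

theorem sum_B_smul_neg {W : Type*} [AddCommGroup W] [Module K W] (s : K)
    (w : Idx m × Idx m → W) (a : Idx m) :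
    ∑ p, B m s p (a, -a) • w p = ∑ i, M s i a • w (i, -i) := by
  rw [sum_B_smul, if_pos rfl, Finset.smul_sum]
  simp only [M, sub_smul, add_smul, ite_smul, zero_smul, Finset.sum_sub_distrib,
    Finset.sum_add_distrib, Finset.sum_ite_eq', Finset.mem_univ, if_true,
    idx_neg_neg, smul_ite, smul_zero, smul_smul]

theorem th_neg (s : K) (a : Idx m) : th s a (-a) = if a.1 < 0 then dl s else 0 := by
  unfold th
  congr 1
  simp only [idx_lt_iff, idx_neg_val, eq_iff_iff]; omega

theorem M_symm (s : K) (i a : Idx m) : M s i a = M s a i := by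
  unfold M
  have h1 : i = -a ↔ a = -i := idx_eq_neg_iff
  have h2 : i < -a ↔ a < -i := by simp only [idx_lt_iff, idx_neg_val]; omega
  congr 1
  · congr 1
    · by_cases h : i = -a
      · have h' := h1.1 h
        subst h'
        rw [if_pos h, if_pos rfl, ka_neg, ka_neg]
        have : -i = 0 ↔ i = 0 := by simp only [idx_eq_iff, idx_neg_val, idx_zero_val]; omega
        simp only [this]
      · rw [if_neg h, if_neg (fun h' => h (h1.2 h'))]
    · by_cases h : i = a
      · subst h; rfl
      · rw [if_neg h, if_neg (fun h' => h h'.symm)]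
  · rw [add_comm i.1]; simp only [h2]

/-- Sums over a row of the zero weight block. -/
theorem sum_M_mul (s : K) (hs : s ≠ 0) (i : Idx m) (g : Idx m → K) :
    ∑ a, M s i a * g a = (if i.1 = 0 then 1 else (s ^ 2)⁻¹) * g (-i)
      + (if i.1 < 0 then dl s else 0) * g i
      - dl s * s ^ i.1 * ∑ a, (if a < -i then s ^ a.1 * g a else 0) := by
  have h0 : i.1 = 0 ↔ i = 0 := by rw [idx_eq_iff]; rfl
  have h1 : ∑ a, M s i a * g a = ∑ a, M s a i * g a :=
    Finset.sum_congr rfl fun a _ => by rw [M_symm]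
  rw [h1]
  simp only [M]
  simp only [sub_mul, add_mul, ite_mul, zero_mul, Finset.sum_sub_distrib, Finset.sum_add_distrib,
    Finset.sum_ite_eq', Finset.mem_univ, if_true, th_neg, ka_neg, h0, Finset.mul_sum, mul_ite,
    mul_zero]
  congr 1
  refine Finset.sum_congr rfl fun a _ => ?_
  rw [zpow_add₀ hs]
  split_ifs
  · ring
  · rfl

theorem sum_M_pow (s : K) (hs : s ≠ 0) (i : Idx m) :
    ∑ a, M s i a * s ^ a.1 = lm m s * s ^ i.1 := by
  rw [sum_M_mul s hs]
  have h1 : ∑ a : Idx m, (if a < -i then s ^ a.1 * s ^ a.1 else 0)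
      = ∑ a : Idx m, (if a < -i then s ^ (2 * a.1) else 0) := by
    refine Finset.sum_congr rfl fun a _ => ?_
    rw [← zpow_add₀ hs, two_mul]
  rw [h1, mul_right_comm, sum_pow_lt s hs, idx_neg_val, partialSum, mul_neg, zpow_neg, zpow_neg,
    two_mul, zpow_add₀ hs]
  have hu : s ^ i.1 ≠ 0 := zpow_ne_zero _ hs
  generalize hz : i.1 = z at *
  rcases lt_trichotomy z 0 with h | h | h
  · rw [if_neg (by omega), if_pos h, if_neg (by omega), if_neg (by omega)]
    field_simp
    ring
  · subst h; simp
  · rw [if_neg (by omega), if_neg (by omega), if_pos (by omega)]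
    field_simp
    ring

theorem M_sq_entry (s L : K) (hs : s ≠ 0) (x z : ℤ) :
    (if z = 0 then 1 else (s ^ 2)⁻¹) *
          (((if -z = -x then if x = 0 then 1 else (s ^ 2)⁻¹ else 0) +
            if -z = x then if x < 0 then dl s else 0 else 0) -
            if -z < -x then dl s * ((s ^ z)⁻¹ * s ^ x) else 0) +
        (if z < 0 then dl s else 0) *
          (((if z = -x then if x = 0 then 1 else (s ^ 2)⁻¹ else 0) +
            if z = x then if x < 0 then dl s else 0 else 0) -
            if z < -x then dl s * (s ^ z * s ^ x) else 0) -
      dl s * s ^ z *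
        ((((if x = 0 then 1 else (s ^ 2)⁻¹) * if -x < -z then (s ^ x)⁻¹ else 0) +
            (if x < 0 then dl s else 0) * if x < -z then s ^ x else 0) -
          s ^ x * (partialSum s (min (-x) (-z)) - L)) =
    (if z = x then 1 else 0) +
        dl s *
          (((if z = -x then if x = 0 then 1 else (s ^ 2)⁻¹ else 0) +
            if z = x then if x < 0 then dl s else 0 else 0) -
            if z < -x then dl s * (s ^ z * s ^ x) else 0) -
      dl s * L * (s ^ z * s ^ x) := by
  have hp : ∀ c : ℤ, s ^ (2 * -c) = ((s ^ c) ^ 2)⁻¹ := fun c => by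
    rw [mul_neg, zpow_neg, two_mul, zpow_add₀ hs, sq]
  have hu : s ^ x ≠ 0 := zpow_ne_zero _ hs
  have hv : s ^ z ≠ 0 := zpow_ne_zero _ hs
  by_cases hxz : z = x
  · subst hxz
    rw [min_self, partialSum, hp]
    rcases lt_trichotomy z 0 with h | h | h
    · simp only [h, h.ne, show ¬ -z < 0 by omega, show ¬ -z = 0 by omega, show ¬ -z = z by omega,
        show ¬ z = -z by omega, show z < -z by omega, if_true, if_false, lt_irrefl]
      unfold dl; field_simp; ring
    · subst h; simp; ring
    · simp only [h.ne', show -z < 0 by omega, show ¬ z < 0 by omega, show ¬ -z = z by omega,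
        show ¬ z = -z by omega, show ¬ z < -z by omega, if_true, if_false, lt_irrefl]
      unfold dl; field_simp; ring
  by_cases hxz' : z = -x
  · subst hxz'
    have hx0 : x ≠ 0 := by rintro rfl; simp at hxz
    simp only [zpow_neg] at hv ⊢
    rcases lt_or_gt_of_ne hx0 with h | h
    · rw [min_eq_right (by omega), partialSum, hp, zpow_neg]
      simp only [h, hx0, show ¬ -x < 0 by omega, show ¬ -x = 0 by omega, show ¬ x = -x by omega,
        show ¬ -x = x by omega, show x < -x by omega,
        show - -x = x by omega, show ¬ -x < x by omega, if_true, if_false, lt_irrefl]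
      unfold dl; field_simp; ring
    · rw [min_eq_left (by omega), partialSum, hp]
      simp only [show ¬ x < 0 by omega, hx0, show -x < 0 by omega, show ¬ -x = 0 by omega,
        show ¬ x = -x by omega, show ¬ -x = x by omega, show ¬ x < -x by omega,
        show - -x = x by omega, show -x < x by omega, if_true, if_false, lt_irrefl]
      unfold dl; field_simp; ring
  have e1 : ¬ -z = -x := by omega
  have e2 : ¬ -z = x := by omega
  simp only [hxz, hxz', e1, e2, if_false]
  rcases lt_or_gt_of_ne hxz with h1 | h1
  · rw [min_eq_left (by omega), partialSum, hp]
    simp only [show ¬ -z < -x by omega, show -x < -z by omega, if_true, if_false]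
    rcases lt_trichotomy x 0 with h2 | h2 | h2
    · simp only [h2, h2.ne, show ¬ -x < 0 by omega, show ¬ -x = 0 by omega, show z < 0 by omega,
        show x < -z by omega, show z < -x by omega, show ¬ z = 0 by omega, if_true, if_false]
      unfold dl; field_simp; ring
    · subst h2
      simp only [show z < 0 by omega, show ¬ z = 0 by omega, show (0 : ℤ) < -z by omega,
        show ¬ (0 : ℤ) < 0 by omega, neg_zero, zpow_zero, if_true, if_false]
      unfold dl; field_simp; ring
    · simp only [show ¬ x < 0 by omega, h2.ne', show -x < 0 by omega, if_true, if_false]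
      rcases lt_or_gt_of_ne hxz' with h3 | h3
      · simp only [h3, show z < 0 by omega, show ¬ z = 0 by omega, show x < -z by omega,
          if_true, if_false]
        unfold dl; field_simp; ring
      · simp only [show ¬ z < -x by omega, show ¬ x < -z by omega, if_false]
        rcases lt_trichotomy z 0 with h4 | h4 | h4
        · simp only [h4, h4.ne, if_true, if_false]
          unfold dl; field_simp; ring
        · subst h4; simp only [if_true, lt_irrefl, if_false, zpow_zero]
          unfold dl; field_simp; ring
        · simp only [h4.ne', show ¬ z < 0 by omega, if_false]
          unfold dl; field_simp; ring
  · rw [min_eq_right (by omega), partialSum, hp]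
    simp only [show -z < -x by omega, show ¬ -x < -z by omega, if_true, if_false]
    rcases lt_trichotomy z 0 with h2 | h2 | h2
    · simp only [h2, h2.ne, show ¬ -z < 0 by omega, show ¬ -z = 0 by omega, show x < 0 by omega,
        show x < -z by omega, show z < -x by omega, show ¬ x = 0 by omega, if_true, if_false]
      unfold dl; field_simp; ring
    · subst h2
      simp only [show x < 0 by omega, show ¬ x = 0 by omega, show (0 : ℤ) < -x by omega,
        show ¬ (0 : ℤ) < 0 by omega, neg_zero, zpow_zero, if_true, if_false]
      unfold dl; field_simp; ring
    · simp only [show ¬ z < 0 by omega, h2.ne', show -z < 0 by omega, if_true, if_false]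
      rcases lt_or_gt_of_ne hxz' with h3 | h3
      · simp only [h3, show x < 0 by omega, show ¬ x = 0 by omega, show x < -z by omega,
          if_true, if_false]
        unfold dl; field_simp; ring
      · simp only [show ¬ z < -x by omega, show ¬ x < -z by omega, if_false]
        rcases lt_trichotomy x 0 with h4 | h4 | h4
        · simp only [h4, h4.ne, if_true, if_false]
          unfold dl; field_simp; ring
        · subst h4; simp only [if_true, lt_irrefl, if_false, zpow_zero]
          unfold dl; field_simp; ring
        · simp only [h4.ne', show ¬ x < 0 by omega, if_false]
          unfold dl; field_simp; ring

theorem M_sq (s : K) (hs : s ≠ 0) (j a : Idx m) :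
    ∑ i, M s j i * M s i a
      = (if j = a then 1 else 0) + dl s * M s j a - dl s * lm m s * s ^ (j.1 + a.1) := by
  rw [sum_M_mul s hs]
  have h1 : ∑ i : Idx m, (if i < -j then s ^ i.1 * M s i a else 0)
      = ∑ i : Idx m, M s a i * (if i < -j then s ^ i.1 else 0) := by
    refine Finset.sum_congr rfl fun i _ => ?_
    rw [M_symm s i a]; split_ifs <;> ring
  have h2 : ∑ i : Idx m, (if i < -a then s ^ i.1 * (if i < -j then s ^ i.1 else 0) else 0)
      = ∑ i : Idx m, (if i < min (-a) (-j) then s ^ (2 * i.1) else 0) := by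
    refine Finset.sum_congr rfl fun i _ => ?_
    rw [two_mul, zpow_add₀ hs]
    simp only [lt_min_iff]
    by_cases h1 : i < -a <;> by_cases h2 : i < -j <;> simp [h1, h2]
  rw [h1, sum_M_mul s hs, h2]
  have h3 := sum_pow_lt s hs (min (-a) (-j))
  have h4 : (min (-a) (-j)).1 = min (-a.1) (-j.1) := by
    rcases le_total (-a) (-j) with h | h
    · rw [min_eq_left h, min_eq_left (show -a.1 ≤ -j.1 from h)]; rfl
    · rw [min_eq_right h, min_eq_right (show -j.1 ≤ -a.1 from h)]; rfl
  rw [h4] at h3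
  generalize ∑ i : Idx m, (if i < min (-a) (-j) then s ^ (2 * i.1) else 0) = S at h3
  have h5 : dl s * s ^ j.1 * ((if a.1 = 0 then 1 else (s ^ 2)⁻¹) *
        (if -a < -j then s ^ (-a).1 else 0) +
      (if a.1 < 0 then dl s else 0) * (if a < -j then s ^ a.1 else 0) - dl s * s ^ a.1 * S)
      = dl s * s ^ j.1 * ((if a.1 = 0 then 1 else (s ^ 2)⁻¹) *
        (if -a < -j then s ^ (-a).1 else 0) +
      (if a.1 < 0 then dl s else 0) * (if a < -j then s ^ a.1 else 0)
        - s ^ a.1 * (partialSum s (min (-a.1) (-j.1)) - lm m s)) := by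
    rw [← h3]; ring
  rw [h5]
  unfold M
  rw [ka_neg, th_neg]
  simp only [idx_eq_iff, idx_lt_iff, idx_neg_val, idx_zero_val, zpow_add₀ hs, zpow_neg]
  exact M_sq_entry s (lm m s) hs a.1 j.1

end TensorRep

end

noncomputable section

namespace TensorRep

variable {K : Type*} [Field K] {m : ℕ}

/-! ### The projection and the inverse braiding -/

/-- The invariant vector `∑ s ^ i v_i ⊗ v_{-i}`. -/
def cup (s : K) (p : Idx m × Idx m) : K := if p.2 = -p.1 then s ^ p.1.1 else 0

/-- The image of `e_i` on two factors. -/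
def E (m : ℕ) (s : K) : Matrix (Idx m × Idx m) (Idx m × Idx m) K :=
  Matrix.vecMulVec (cup s) (cup s)

/-- The inverse of `B`. -/
def Binv (m : ℕ) (s : K) : Matrix (Idx m × Idx m) (Idx m × Idx m) K :=
  B m s - dl s • 1 + dl s • E m s

theorem sum_cup_smul {W : Type*} [AddCommGroup W] [Module K W] (s : K) (w : Idx m × Idx m → W) :
    ∑ p, cup s p • w p = ∑ j : Idx m, s ^ j.1 • w (j, -j) := by
  rw [Fintype.sum_prod_type]
  refine Finset.sum_congr rfl fun j _ => ?_
  rw [Fintype.sum_eq_single (-j)]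
  · simp [cup]
  · intro k hk; simp [cup, hk]

theorem ka_symm (s : K) (a b : Idx m) : ka s a b = ka s b a := by
  unfold ka
  by_cases h : a = b
  · subst h; rfl
  · have h' : ¬ b = a := fun h' => h h'.symm
    rw [if_neg h, if_neg h']
    simp only [idx_eq_neg_iff (i := a)]

theorem B_symm (s : K) (p r : Idx m × Idx m) : B m s p r = B m s r p := by
  obtain ⟨a, b⟩ := p
  obtain ⟨c, d⟩ := r
  rw [B_apply, B_apply]
  congr 1
  · congr 1
    · by_cases h : a = d ∧ b = c
      · rw [if_pos h, if_pos ⟨h.2.symm, h.1.symm⟩, h.1, h.2, ka_symm]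
      · rw [if_neg h, if_neg fun h' => h ⟨h'.2.symm, h'.1.symm⟩]
    · by_cases h : a = c ∧ b = d
      · rw [if_pos h, if_pos ⟨h.1.symm, h.2.symm⟩, h.1, h.2]
      · rw [if_neg h, if_neg fun h' => h ⟨h'.1.symm, h'.2.symm⟩]
  · have : (d = -c ∧ b = -a ∧ a < -c) ↔ (b = -a ∧ d = -c ∧ c < -a) := by
      simp only [idx_lt_iff, idx_neg_val, idx_eq_iff]; omega
    simp only [this, add_comm a.1]

theorem B_transpose (s : K) : (B m s).transpose = B m s := by
  ext p r; exact B_symm s r p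

theorem E_transpose (s : K) : (E m s).transpose = E m s := by
  rw [E, Matrix.transpose_vecMulVec]

theorem B_apply_of_ne (s : K) {a b : Idx m} (h : b ≠ -a) (p : Idx m × Idx m) :
    B m s p (a, b) = (if p = (b, a) then ka s a b else 0) + (if p = (a, b) then th s a b else 0) := by
  obtain ⟨c, d⟩ := p
  rw [B_apply, if_neg (c := b = -a ∧ _) (fun h' => h h'.1), sub_zero]
  simp only [Prod.mk.injEq]

theorem B_apply_neg (s : K) (a c d : Idx m) :
    B m s (c, d) (a, -a) = if d = -c then M s c a else 0 := by
  rw [B_apply, M]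
  by_cases hd : d = -c
  · subst hd
    have h1 : (c = -a ∧ -c = a) ↔ c = -a := by simp only [idx_eq_iff, idx_neg_val]; omega
    have h2 : (c = a ∧ -c = -a) ↔ c = a := by simp only [idx_eq_iff, idx_neg_val]; omega
    simp [h1, h2]
  · have h1 : ¬ (c = -a ∧ d = a) := fun h => hd (by rw [h.1, h.2]; simp)
    have h2 : ¬ (c = a ∧ d = -a) := fun h => hd (by rw [h.1, h.2])
    simp [h1, h2, hd]

theorem B_mulVec_cup (s : K) (hs : s ≠ 0) : (B m s).mulVec (cup s) = lm m s • cup s := by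
  ext ⟨c, d⟩
  have h1 : (B m s).mulVec (cup s) (c, d) = ∑ p, cup s p • B m s (c, d) p := by
    simp only [Matrix.mulVec, dotProduct, smul_eq_mul]
    exact Finset.sum_congr rfl fun _ _ => mul_comm _ _
  rw [h1, sum_cup_smul]
  simp only [B_apply_neg, Pi.smul_apply, smul_eq_mul]
  by_cases hd : d = -c
  · simp only [hd, if_true, cup]
    rw [← sum_M_pow s hs]
    exact Finset.sum_congr rfl fun _ _ => mul_comm _ _
  · simp [hd, cup]

theorem B_mul_E (s : K) (hs : s ≠ 0) : B m s * E m s = lm m s • E m s := by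
  rw [E, Matrix.mul_vecMulVec, B_mulVec_cup s hs, Matrix.smul_vecMulVec]

theorem E_mul_B (s : K) (hs : s ≠ 0) : E m s * B m s = lm m s • E m s := by
  have := congrArg Matrix.transpose (B_mul_E (m := m) s hs)
  rwa [Matrix.transpose_mul, Matrix.transpose_smul, B_transpose, E_transpose] at this

theorem ne_neg_self {a : Idx m} (ha : a ≠ 0) : a ≠ -a := by
  intro h; apply ha; rw [idx_eq_iff] at *; simp only [idx_neg_val, idx_zero_val] at *; omega

theorem ka_sq (s : K) (hs : s ≠ 0) {a : Idx m} (ha : a ≠ 0) :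
    ka s a a = s ^ 2 ∧ s ^ 2 * s ^ 2 = 1 + dl s * s ^ 2 := by
  constructor
  · simp [ka, ha]
  · unfold dl; field_simp; ring

theorem ka_of_ne (s : K) {a b : Idx m} (h : a ≠ b) (h' : b ≠ -a) : ka s a b = 1 := by
  have : a ≠ -b := fun h'' => h' (idx_eq_neg_iff.1 h'')
  simp [ka, h, this]

theorem B_sq (s : K) (hs : s ≠ 0) :
    B m s * B m s = 1 + dl s • B m s - (dl s * lm m s) • E m s := by
  ext p ⟨a, b⟩
  have h1 : (B m s * B m s) p (a, b) = ∑ r, B m s r (a, b) • B m s p r := by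
    rw [Matrix.mul_apply]
    exact Finset.sum_congr rfl fun _ _ => mul_comm _ _
  rw [h1]
  simp only [Matrix.sub_apply, Matrix.add_apply, Matrix.smul_apply, smul_eq_mul, E,
    Matrix.vecMulVec_apply, Matrix.one_apply]
  by_cases hb : b = -a
  · subst hb
    have h2 := sum_B_smul_neg s (fun r => B m s p r) a
    simp only [smul_eq_mul] at h2
    rw [h2]
    obtain ⟨c, d⟩ := p
    simp only [B_apply_neg]
    by_cases hd : d = -c
    · subst hd
      have h3 : ((c, -c) = (a, -a)) ↔ c = a := by
        simp only [Prod.mk.injEq, idx_neg_inj, and_self]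
      have h4 : ∑ x, M s x a * M s c x = ∑ x, M s c x * M s x a :=
        Finset.sum_congr rfl fun _ _ => mul_comm _ _
      simp only [if_true, h3, cup, h4, M_sq s hs, zpow_add₀ hs]
    · have h3 : ¬ ((c, d) = (a, -a)) := fun h => by
        rw [Prod.mk.injEq] at h; exact hd (by rw [h.1, h.2])
      simp [hd, h3, cup]
  · have h2 := sum_B_smul s (fun r => B m s p r) a b
    simp only [smul_eq_mul] at h2
    have hb' : a ≠ -b := fun h => hb (idx_eq_neg_iff.1 h)
    rw [h2, if_neg hb, B_apply_of_ne s hb', B_apply_of_ne s hb]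
    have h3 : cup s (a, b) = 0 := by simp [cup, hb]
    rw [h3]
    by_cases hab : a = b
    · subst hab
      have ha : a ≠ 0 := by rintro rfl; simp at hb
      obtain ⟨h4, h5⟩ := ka_sq s hs ha
      have h6 : th s a a = 0 := by simp [th]
      rw [h4, h6]
      split_ifs
      · linear_combination h5
      · ring
    · rw [ka_of_ne s hab hb, ka_of_ne s (Ne.symm hab) hb']
      have h4 : (p = (a, b) ∧ ¬ p = (b, a)) ∨ (¬ p = (a, b) ∧ p = (b, a)) ∨
          (¬ p = (a, b) ∧ ¬ p = (b, a)) := by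
        by_cases h5 : p = (a, b)
        · left; refine ⟨h5, ?_⟩; rw [h5, Prod.mk.injEq]; exact fun h => hab h.1
        · by_cases h6 : p = (b, a)
          · exact Or.inr (Or.inl ⟨h5, h6⟩)
          · exact Or.inr (Or.inr ⟨h5, h6⟩)
      have h5 : th s a b + th s b a = dl s := by
        unfold th
        rcases lt_or_gt_of_ne hab with h | h
        · simp [h, h.not_gt]
        · simp [h, h.not_gt]
      have h6 : th s a b * th s a b = dl s * th s a b := by
        unfold th; split_ifs <;> simp
      rcases h4 with ⟨h7, h8⟩ | ⟨h7, h8⟩ | ⟨h7, h8⟩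
      · simp only [h7, if_true]
        have : ¬ ((a, b) = (b, a)) := fun h => hab (Prod.mk.injEq .. ▸ h).1
        simp only [this, if_false]
        linear_combination h6
      · simp only [h8, if_true]
        have : ¬ ((b, a) = (a, b)) := fun h => hab (Prod.mk.injEq .. ▸ h).2
        simp only [this, if_false]
        linear_combination h5
      · simp only [h7, h8, if_false]; ring

theorem B_mul_Binv (s : K) (hs : s ≠ 0) : B m s * Binv m s = 1 := by
  rw [Binv, mul_add, mul_sub, B_sq s hs, Matrix.mul_smul, Matrix.mul_smul, B_mul_E s hs, mul_one]
  module

theorem Binv_mul_B (s : K) (hs : s ≠ 0) : Binv m s * B m s = 1 := by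
  rw [Binv, add_mul, sub_mul, B_sq s hs, Matrix.smul_mul, Matrix.smul_mul, E_mul_B s hs, one_mul]
  module

theorem Binv_apply (s : K) (a b c d : Idx m) :
    Binv m s (c, d) (a, b) = B m s (c, d) (a, b) - (if c = a ∧ d = b then dl s else 0)
      + dl s * (cup s (c, d) * cup s (a, b)) := by
  simp [Binv, E, Matrix.vecMulVec_apply, Matrix.one_apply]

/-- Crossing symmetry: rotating the braiding gives its inverse. -/
theorem crossing (s : K) (hs : s ≠ 0) (c d e f : Idx m) :
    s ^ d.1 * B m s (e, f) (-d, c) = (s ^ f.1)⁻¹ * Binv m s (d, e) (c, -f) := by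
  have hu : s ^ d.1 ≠ 0 := zpow_ne_zero _ hs
  rw [Binv_apply, B_apply, B_apply]
  simp only [cup, ka, th, idx_neg_inj, idx_neg_neg]
  by_cases h1 : e = c ∧ f = -d
  · obtain ⟨rfl, rfl⟩ := h1
    by_cases h2 : e = -d
    · subst h2
      by_cases h0 : d = 0
      · subst h0; simp
      · have h3 := ne_neg_self h0
        have h4 : -d ≠ d := fun h => h3 h.symm
        have h0' : -d ≠ 0 := fun h => h0 (by rw [← idx_neg_neg d, h, idx_neg_zero])
        simp [h0', h3, h4, dl, zpow_neg]
        field_simp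
        left; ring
    · have h2' : ¬ -d = e := fun h => h2 h.symm
      by_cases h3 : e = d
      · subst h3
        have h0 : e ≠ 0 := by rintro rfl; simp at h2
        simp [h0, h2, h2', dl, zpow_neg]
      · have h3' : ¬ d = e := fun h => h3 h.symm
        simp [h2, h2', h3, h3', idx_neg_inj, zpow_neg]
  · have h1' : ¬ (d = -f ∧ e = c) := fun h => h1 ⟨h.2, idx_eq_neg_iff.1 h.1⟩
    rw [if_neg h1, if_neg h1']
    by_cases h2 : e = -d ∧ f = c
    · obtain ⟨rfl, rfl⟩ := h2
      have h3 : ¬ f = -d := fun h => h1 ⟨h.symm, h⟩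
      have h4 : -d < f ↔ ¬ d < -f := by
        simp only [idx_lt_iff, idx_eq_iff, idx_neg_val] at *; omega
      have hv : s ^ f.1 ≠ 0 := zpow_ne_zero _ hs
      by_cases h5 : f = d
      · subst h5
        by_cases h6 : f < -f
        · simp [h4, h6, zpow_add₀ hs]
        · simp [h4, h6, zpow_add₀ hs]; field_simp; ring
      · have h5' : ¬ d = f := fun h => h5 h.symm
        by_cases h6 : d < -f <;> simp [h4, h5, h5', h6, zpow_add₀ hs] <;> field_simp
    · have h2' : ¬ (f = c ∧ e = -d) := fun h => h2 ⟨h.2, h.1⟩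
      by_cases h3 : c = d ∧ f = -e
      · obtain ⟨rfl, rfl⟩ := h3
        have h3 : ¬ e = c := fun h => h1 ⟨h, by rw [h]⟩
        have h4 : c < e ↔ ¬ e < c := by
          simp only [idx_lt_iff, idx_eq_iff] at *; omega
        have h5 : ¬ e = -c := fun h => h2 ⟨h, by rw [h]; simp⟩
        by_cases h6 : e < c <;> simp [h4, h5, h6, zpow_add₀ hs, zpow_neg]
        field_simp
      · have h3' : ¬ (d = c ∧ e = -f) := fun h => h3 ⟨h.1.symm, idx_eq_neg_iff.1 h.2⟩
        have h4 : ¬ (c = d ∧ f = -e ∧ e < d) := fun h => h3 ⟨h.1, h.2.1⟩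
        have h5 : ¬ (f = c ∧ e = -d ∧ d < -c) := fun h => h2' ⟨h.1, h.2.1⟩
        rw [if_neg h2, if_neg h4, if_neg h3', if_neg h5, if_neg h3']
        by_cases h6 : e = -d
        · have h7 : ¬ f = c := fun h => h2 ⟨h6, h⟩
          simp [h7]
        · simp [h6]

theorem crossing_inv (s : K) (hs : s ≠ 0) (c d e f : Idx m) :
    (s ^ f.1)⁻¹ * B m s (d, e) (c, -f) = s ^ d.1 * Binv m s (e, f) (-d, c) := by
  have h := crossing s hs c d e f
  rw [Binv_apply] at h ⊢
  rw [mul_add, mul_sub, h]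
  have hf : s ^ f.1 ≠ 0 := zpow_ne_zero _ hs
  have hd : s ^ d.1 ≠ 0 := zpow_ne_zero _ hs
  have he : s ^ e.1 ≠ 0 := zpow_ne_zero _ hs
  have h1 : (s ^ f.1)⁻¹ * (if d = c ∧ e = -f then dl s else 0)
      = s ^ d.1 * (dl s * (cup s (e, f) * cup s (-d, c))) := by
    by_cases h1 : d = c ∧ e = -f
    · obtain ⟨rfl, rfl⟩ := h1
      simp only [cup, idx_neg_neg, if_true, and_self, idx_neg_val, zpow_neg] at *
      field_simp
    · have h2 : ¬ (f = -e ∧ c = d) := fun h => h1 ⟨h.2.symm, idx_eq_neg_iff.1 h.1⟩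
      rw [if_neg h1]
      by_cases h3 : f = -e
      · have h4 : ¬ c = d := fun h => h2 ⟨h3, h⟩
        simp [cup, h4]
      · simp [cup, h3]
  have h2 : (s ^ f.1)⁻¹ * (dl s * (cup s (d, e) * cup s (c, -f)))
      = s ^ d.1 * (if e = -d ∧ f = c then dl s else 0) := by
    by_cases h1 : e = -d ∧ f = c
    · obtain ⟨rfl, rfl⟩ := h1
      simp only [cup, if_true, and_self]
      field_simp
    · rw [if_neg h1]
      by_cases h3 : e = -d
      · have h4 : ¬ f = c := fun h => h1 ⟨h3, h⟩
        simp [cup, idx_neg_inj, h4]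
      · simp [cup, h3]
  linear_combination h1 - h2

end TensorRep

end

noncomputable section

namespace TensorRep

variable {K : Type*} [Field K] {m : ℕ}

/-! ### Three tensor factors -/

/-- Basis vectors of `V ⊗ V ⊗ V`. -/
def vec (K : Type*) [Field K] {m : ℕ} (a b c : Idx m) : Idx m × Idx m × Idx m → K :=
  Pi.single (a, b, c) 1

/-- `M ↦ M ⊗ 1` as an algebra homomorphism. -/
def kroneckerOne (K P Q : Type*) [Field K] [Fintype P] [DecidableEq P] [Fintype Q] [DecidableEq Q] :
    Matrix P P K →ₐ[K] Matrix (P × Q) (P × Q) K where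
  toFun A := A ⊗ₖ (1 : Matrix Q Q K)
  map_one' := Matrix.one_kronecker_one
  map_mul' A A' := by rw [← Matrix.mul_kronecker_mul, one_mul]
  map_zero' := Matrix.zero_kronecker _
  map_add' A A' := Matrix.add_kronecker _ _ _
  commutes' c := by
    rw [Algebra.algebraMap_eq_smul_one, Algebra.algebraMap_eq_smul_one, Matrix.smul_kronecker,
      Matrix.one_kronecker_one]

/-- `A` acting on the factors `P` of a product decomposition of the index set. -/
def place {K X P Q : Type*} [Field K] [Fintype X] [DecidableEq X] [Fintype P] [DecidableEq P]
    [Fintype Q] [DecidableEq Q] (ε : X ≃ P × Q) : Matrix P P K →ₐ[K] Matrix X X K :=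
  (Matrix.reindexAlgEquiv K K ε.symm).toAlgHom.comp (kroneckerOne K P Q)

theorem place_apply {K X P Q : Type*} [Field K] [Fintype X] [DecidableEq X] [Fintype P]
    [DecidableEq P] [Fintype Q] [DecidableEq Q] (ε : X ≃ P × Q) (A : Matrix P P K) (x y : X) :
    place ε A x y = if (ε x).2 = (ε y).2 then A (ε x).1 (ε y).1 else 0 := by
  change A (ε x).1 (ε y).1 * (1 : Matrix Q Q K) (ε x).2 (ε y).2 = _
  rw [Matrix.one_apply]
  split_ifs <;> simp

/-- Acting on the first two of three factors. -/
def left (K : Type*) [Field K] (m : ℕ) : Matrix (Idx m × Idx m) (Idx m × Idx m) K →ₐ[K]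
    Matrix (Idx m × Idx m × Idx m) (Idx m × Idx m × Idx m) K :=
  place (Equiv.prodAssoc _ _ _).symm

/-- Acting on the last two of three factors. -/
def right (K : Type*) [Field K] (m : ℕ) : Matrix (Idx m × Idx m) (Idx m × Idx m) K →ₐ[K]
    Matrix (Idx m × Idx m × Idx m) (Idx m × Idx m × Idx m) K :=
  place (Equiv.prodComm _ _)

theorem left_apply (A : Matrix (Idx m × Idx m) (Idx m × Idx m) K) (a b c a' b' c' : Idx m) :
    left K m A (a, b, c) (a', b', c') = if c = c' then A (a, b) (a', b') else 0 := by
  rw [left, place_apply]; rfl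

theorem right_apply (A : Matrix (Idx m × Idx m) (Idx m × Idx m) K) (a b c a' b' c' : Idx m) :
    right K m A (a, b, c) (a', b', c') = if a = a' then A (b, c) (b', c') else 0 := by
  rw [right, place_apply]; rfl

theorem left_mulVec (A : Matrix (Idx m × Idx m) (Idx m × Idx m) K) (a b c : Idx m) :
    (left K m A).mulVec (vec K a b c) = ∑ p : Idx m × Idx m, A p (a, b) • vec K p.1 p.2 c := by
  ext ⟨d, e, f⟩
  rw [vec, Matrix.mulVec_single_one, Matrix.col_apply, left_apply, Finset.sum_apply,
    Fintype.sum_eq_single (d, e)]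
  · simp [vec, Pi.single_apply]
  · rintro ⟨d', e'⟩ h
    have : ¬ ((d, e, f) = (d', e', c)) := fun h' => h (by simp_all)
    simp [vec, this]

theorem right_mulVec (A : Matrix (Idx m × Idx m) (Idx m × Idx m) K) (a b c : Idx m) :
    (right K m A).mulVec (vec K a b c) = ∑ p : Idx m × Idx m, A p (b, c) • vec K a p.1 p.2 := by
  ext ⟨d, e, f⟩
  rw [vec, Matrix.mulVec_single_one, Matrix.col_apply, right_apply, Finset.sum_apply,
    Fintype.sum_eq_single (e, f)]
  · simp [vec, Pi.single_apply]
  · rintro ⟨d', e'⟩ h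
    have : ¬ ((d, e, f) = (a, d', e')) := fun h' => h (by simp_all)
    simp [vec, this]

theorem left_transpose (A : Matrix (Idx m × Idx m) (Idx m × Idx m) K) :
    (left K m A).transpose = left K m A.transpose := by
  ext ⟨a, b, c⟩ ⟨a', b', c'⟩
  simp only [Matrix.transpose_apply, left_apply, eq_comm]

theorem right_transpose (A : Matrix (Idx m × Idx m) (Idx m × Idx m) K) :
    (right K m A).transpose = right K m A.transpose := by
  ext ⟨a, b, c⟩ ⟨a', b', c'⟩
  simp only [Matrix.transpose_apply, right_apply, eq_comm]

/-- `∑ s ^ j v_j ⊗ v_{-j} ⊗ v_c`. -/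
def cupLeft (s : K) (c : Idx m) : Idx m × Idx m × Idx m → K :=
  ∑ j : Idx m, s ^ j.1 • vec K j (-j) c

/-- `∑ s ^ j v_c ⊗ v_j ⊗ v_{-j}`. -/
def cupRight (s : K) (c : Idx m) : Idx m × Idx m × Idx m → K :=
  ∑ j : Idx m, s ^ j.1 • vec K c j (-j)

theorem left_E_mulVec (s : K) (a b c : Idx m) :
    (left K m (E m s)).mulVec (vec K a b c) = cup s (a, b) • cupLeft s c := by
  rw [left_mulVec]
  have h : ∀ p : Idx m × Idx m, E m s p (a, b) • vec K p.1 p.2 c = cup s (a, b) • cup s p • vec K p.1 p.2 c :=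
    fun p => by rw [E, Matrix.vecMulVec_apply, mul_comm, mul_smul]
  rw [Finset.sum_congr rfl fun p _ => h p, ← Finset.smul_sum,
    sum_cup_smul s (fun p => vec K p.1 p.2 c)]
  rfl

theorem right_E_mulVec (s : K) (a b c : Idx m) :
    (right K m (E m s)).mulVec (vec K a b c) = cup s (b, c) • cupRight s a := by
  rw [right_mulVec]
  have h : ∀ p : Idx m × Idx m, E m s p (b, c) • vec K a p.1 p.2 = cup s (b, c) • cup s p • vec K a p.1 p.2 :=
    fun p => by rw [E, Matrix.vecMulVec_apply, mul_comm, mul_smul]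
  rw [Finset.sum_congr rfl fun p _ => h p, ← Finset.smul_sum,
    sum_cup_smul s (fun p => vec K a p.1 p.2)]
  rfl

theorem right_E_cupLeft (s : K) (hs : s ≠ 0) (c : Idx m) :
    (right K m (E m s)).mulVec (cupLeft s c) = cupRight s c := by
  rw [cupLeft, Matrix.mulVec_sum]
  simp only [Matrix.mulVec_smul, right_E_mulVec]
  rw [Fintype.sum_eq_single c]
  · have : s ^ c.1 ≠ 0 := zpow_ne_zero _ hs
    simp [cup, smul_smul, zpow_neg, this]
  · intro j hj
    have : ¬ c = j := fun h => hj h.symm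
    simp [cup, this]

theorem left_E_cupRight (s : K) (hs : s ≠ 0) (c : Idx m) :
    (left K m (E m s)).mulVec (cupRight s c) = cupLeft s c := by
  rw [cupRight, Matrix.mulVec_sum]
  simp only [Matrix.mulVec_smul, left_E_mulVec]
  rw [Fintype.sum_eq_single (-c)]
  · have : s ^ c.1 ≠ 0 := zpow_ne_zero _ hs
    simp [cup, smul_smul, zpow_neg, this]
  · intro j hj
    simp [cup, hj]

theorem right_cupLeft_apply (s : K) (A : Matrix (Idx m × Idx m) (Idx m × Idx m) K)
    (c d e f : Idx m) :
    (right K m A).mulVec (cupLeft s c) (d, e, f) = s ^ d.1 * A (e, f) (-d, c) := by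
  rw [cupLeft, Matrix.mulVec_sum, Finset.sum_apply, Fintype.sum_eq_single d]
  · rw [Matrix.mulVec_smul, vec, Matrix.mulVec_single_one, Pi.smul_apply, Matrix.col_apply,
      right_apply, if_pos rfl, smul_eq_mul]
  · intro j hj
    rw [Matrix.mulVec_smul, vec, Matrix.mulVec_single_one, Pi.smul_apply, Matrix.col_apply,
      right_apply, if_neg (Ne.symm hj), smul_zero]

theorem left_cupRight_apply (s : K) (A : Matrix (Idx m × Idx m) (Idx m × Idx m) K)
    (c d e f : Idx m) :
    (left K m A).mulVec (cupRight s c) (d, e, f) = (s ^ f.1)⁻¹ * A (d, e) (c, -f) := by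
  rw [cupRight, Matrix.mulVec_sum, Finset.sum_apply, Fintype.sum_eq_single (-f)]
  · rw [Matrix.mulVec_smul, vec, Matrix.mulVec_single_one, Pi.smul_apply, Matrix.col_apply,
      left_apply, if_pos (by simp), smul_eq_mul, idx_neg_val, zpow_neg]
  · intro j hj
    rw [Matrix.mulVec_smul, vec, Matrix.mulVec_single_one, Pi.smul_apply, Matrix.col_apply,
      left_apply, if_neg (fun h => hj (idx_eq_neg_iff.1 h)), smul_zero]

theorem right_B_cupLeft (s : K) (hs : s ≠ 0) (c : Idx m) :
    (right K m (B m s)).mulVec (cupLeft s c) = (left K m (Binv m s)).mulVec (cupRight s c) := by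
  ext ⟨d, e, f⟩
  rw [right_cupLeft_apply, left_cupRight_apply, crossing s hs]

theorem left_B_cupRight (s : K) (hs : s ≠ 0) (c : Idx m) :
    (left K m (B m s)).mulVec (cupRight s c) = (right K m (Binv m s)).mulVec (cupLeft s c) := by
  ext ⟨d, e, f⟩
  rw [right_cupLeft_apply, left_cupRight_apply, crossing_inv s hs]

/-- Matrices are determined by their values on basis vectors. -/
theorem ext_vec {A A' : Matrix (Idx m × Idx m × Idx m) (Idx m × Idx m × Idx m) K}
    (h : ∀ a b c, A.mulVec (vec K a b c) = A'.mulVec (vec K a b c)) : A = A' := by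
  ext p ⟨a, b, c⟩
  have := congrFun (h a b c) p
  rwa [vec, Matrix.mulVec_single_one, Matrix.mulVec_single_one, Matrix.col_apply,
    Matrix.col_apply] at this

theorem BBE (s : K) (hs : s ≠ 0) :
    left K m (B m s) * right K m (B m s) * left K m (E m s)
      = right K m (E m s) * left K m (E m s) := by
  refine ext_vec fun a b c => ?_
  rw [← Matrix.mulVec_mulVec, ← Matrix.mulVec_mulVec, ← Matrix.mulVec_mulVec, left_E_mulVec]
  simp only [Matrix.mulVec_smul]
  rw [right_E_cupLeft s hs, right_B_cupLeft s hs, Matrix.mulVec_mulVec, ← map_mul,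
    B_mul_Binv s hs, map_one, Matrix.one_mulVec]

theorem BBE' (s : K) (hs : s ≠ 0) :
    right K m (B m s) * left K m (B m s) * right K m (E m s)
      = left K m (E m s) * right K m (E m s) := by
  refine ext_vec fun a b c => ?_
  rw [← Matrix.mulVec_mulVec, ← Matrix.mulVec_mulVec, ← Matrix.mulVec_mulVec, right_E_mulVec]
  simp only [Matrix.mulVec_smul]
  rw [left_E_cupRight s hs, left_B_cupRight s hs, Matrix.mulVec_mulVec, ← map_mul,
    B_mul_Binv s hs, map_one, Matrix.one_mulVec]

theorem EBB (s : K) (hs : s ≠ 0) :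
    left K m (E m s) * right K m (B m s) * left K m (B m s)
      = left K m (E m s) * right K m (E m s) := by
  have := congrArg Matrix.transpose (BBE (m := m) s hs)
  simp only [Matrix.transpose_mul, left_transpose, right_transpose, B_transpose,
    E_transpose] at this
  rw [mul_assoc]; exact this

theorem lm_ne (s : K) (hs : s ≠ 0) : lm m s ≠ 0 := inv_ne_zero (zpow_ne_zero _ hs)

theorem E_mul_Binv (s : K) (hs : s ≠ 0) : E m s * Binv m s = (lm m s)⁻¹ • E m s := by
  have h1 : E m s * B m s * Binv m s = E m s := by
    rw [mul_assoc, B_mul_Binv s hs, mul_one]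
  rw [E_mul_B s hs, Matrix.smul_mul] at h1
  nth_rw 2 [← h1]
  rw [smul_smul, inv_mul_cancel₀ (lm_ne s hs), one_smul]

theorem EBE (s : K) (hs : s ≠ 0) :
    right K m (E m s) * left K m (B m s) * right K m (E m s)
      = (lm m s)⁻¹ • right K m (E m s) := by
  refine ext_vec fun a b c => ?_
  rw [← Matrix.mulVec_mulVec, ← Matrix.mulVec_mulVec, Matrix.smul_mulVec, right_E_mulVec]
  simp only [Matrix.mulVec_smul]
  rw [left_B_cupRight s hs, Matrix.mulVec_mulVec, ← map_mul, E_mul_Binv s hs, map_smul,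
    Matrix.smul_mulVec, right_E_cupLeft s hs, smul_comm]

theorem EBinvE (s : K) (hs : s ≠ 0) :
    right K m (E m s) * left K m (Binv m s) * right K m (E m s)
      = lm m s • right K m (E m s) := by
  refine ext_vec fun a b c => ?_
  rw [← Matrix.mulVec_mulVec, ← Matrix.mulVec_mulVec, Matrix.smul_mulVec, right_E_mulVec]
  simp only [Matrix.mulVec_smul]
  rw [← right_B_cupLeft s hs, Matrix.mulVec_mulVec, ← map_mul, E_mul_B s hs, map_smul,
    Matrix.smul_mulVec, right_E_cupLeft s hs, smul_comm]

end TensorRep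

end

noncomputable section

namespace TensorRep

variable {K : Type*} [Field K] {m : ℕ}

/-! ### The braid relation -/

/-- The defect of the braid relation. -/
def braidDefect (m : ℕ) (s : K) :
    Matrix (Idx m × Idx m × Idx m) (Idx m × Idx m × Idx m) K :=
  left K m (B m s) * right K m (B m s) * left K m (B m s)
    - right K m (B m s) * left K m (B m s) * right K m (B m s)

theorem braidDefect_mul_left_E (s : K) (hs : s ≠ 0) :
    braidDefect m s * left K m (E m s) = 0 := by
  rw [braidDefect, sub_mul, mul_assoc _ (left K m (B m s)), ← map_mul, B_mul_E s hs, map_smul,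
    mul_smul_comm, BBE s hs, mul_assoc (right K m (B m s)), mul_assoc (right K m (B m s)),
    BBE s hs, ← mul_assoc, ← map_mul, B_mul_E s hs, map_smul, smul_mul_assoc, sub_self]

theorem braidDefect_mul_right_E (s : K) (hs : s ≠ 0) :
    braidDefect m s * right K m (E m s) = 0 := by
  rw [braidDefect, sub_mul, mul_assoc _ (right K m (B m s)) (right K m (E m s)), ← map_mul,
    B_mul_E s hs, map_smul,
    mul_smul_comm, BBE' s hs, mul_assoc (left K m (B m s)), mul_assoc (left K m (B m s)),
    BBE' s hs, ← mul_assoc, ← map_mul, B_mul_E s hs, map_smul, smul_mul_assoc, sub_self]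

theorem braidDefect_transpose (s : K) : (braidDefect m s).transpose = braidDefect m s := by
  simp only [braidDefect, Matrix.transpose_sub, Matrix.transpose_mul, left_transpose,
    right_transpose, B_transpose, mul_assoc]

theorem left_mul_braidDefect_mul_right (s : K) (hs : s ≠ 0) :
    left K m (B m s) * braidDefect m s * right K m (B m s) = -braidDefect m s := by
  have h1 : left K m (B m s) * left K m (B m s)
      = 1 + dl s • left K m (B m s) - (dl s * lm m s) • left K m (E m s) := by
    rw [← map_mul, B_sq s hs]; simp only [map_add, map_sub, map_smul, map_one]
  have h2 : right K m (B m s) * right K m (B m s)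
      = 1 + dl s • right K m (B m s) - (dl s * lm m s) • right K m (E m s) := by
    rw [← map_mul, B_sq s hs]; simp only [map_add, map_sub, map_smul, map_one]
  have h3 : left K m (E m s) * right K m (B m s) * left K m (B m s) * right K m (B m s)
      = left K m (B m s) * right K m (B m s) * left K m (B m s) * right K m (E m s) := by
    rw [EBB s hs, mul_assoc, ← map_mul, E_mul_B s hs, map_smul, mul_assoc (left K m (B m s)),
      mul_assoc (left K m (B m s)), BBE' s hs, ← mul_assoc, ← map_mul, B_mul_E s hs, map_smul,
      mul_smul_comm, smul_mul_assoc]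
  calc left K m (B m s) * braidDefect m s * right K m (B m s)
      = (left K m (B m s) * left K m (B m s)) * right K m (B m s) * left K m (B m s)
          * right K m (B m s)
        - left K m (B m s) * right K m (B m s) * left K m (B m s)
          * (right K m (B m s) * right K m (B m s)) := by
        rw [braidDefect, mul_sub, sub_mul]; simp only [mul_assoc]
    _ = -braidDefect m s := by
        rw [h1, h2, braidDefect]
        simp only [add_mul, sub_mul, mul_add, mul_sub, one_mul, mul_one, smul_mul_assoc,
          mul_smul_comm, h3]
        abel

theorem right_mul_braidDefect_mul_left (s : K) (hs : s ≠ 0) :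
    right K m (B m s) * braidDefect m s * left K m (B m s) = -braidDefect m s := by
  have := congrArg Matrix.transpose (left_mul_braidDefect_mul_right (m := m) s hs)
  simp only [Matrix.transpose_mul, Matrix.transpose_neg, left_transpose, right_transpose,
    B_transpose, braidDefect_transpose] at this
  rw [mul_assoc]; exact this

/-- The kernel of the braid defect. -/
def braidKer (m : ℕ) (s : K) : Submodule K (Idx m × Idx m × Idx m → K) :=
  LinearMap.ker (braidDefect m s).mulVecLin

theorem mem_braidKer {s : K} {w : Idx m × Idx m × Idx m → K} :
    w ∈ braidKer m s ↔ (braidDefect m s).mulVec w = 0 := Iff.rfl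

theorem right_mem_braidKer {s : K} (hs : s ≠ 0) {w : Idx m × Idx m × Idx m → K}
    (hw : w ∈ braidKer m s) : (right K m (B m s)).mulVec w ∈ braidKer m s := by
  rw [mem_braidKer] at *
  have h1 : (left K m (B m s) * braidDefect m s * right K m (B m s)).mulVec w = 0 := by
    rw [left_mul_braidDefect_mul_right s hs, Matrix.neg_mulVec, hw, neg_zero]
  have h2 := congrArg (left K m (Binv m s)).mulVec h1
  rwa [Matrix.mulVec_zero, Matrix.mulVec_mulVec, mul_assoc (left K m (B m s)), ← mul_assoc,
    ← map_mul, Binv_mul_B s hs, map_one, one_mul, ← Matrix.mulVec_mulVec] at h2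

theorem left_mem_braidKer {s : K} (hs : s ≠ 0) {w : Idx m × Idx m × Idx m → K}
    (hw : w ∈ braidKer m s) : (left K m (B m s)).mulVec w ∈ braidKer m s := by
  rw [mem_braidKer] at *
  have h1 : (right K m (B m s) * braidDefect m s * left K m (B m s)).mulVec w = 0 := by
    rw [right_mul_braidDefect_mul_left s hs, Matrix.neg_mulVec, hw, neg_zero]
  have h2 := congrArg (right K m (Binv m s)).mulVec h1
  rwa [Matrix.mulVec_zero, Matrix.mulVec_mulVec, mul_assoc (right K m (B m s)), ← mul_assoc,
    ← map_mul, Binv_mul_B s hs, map_one, one_mul, ← Matrix.mulVec_mulVec] at h2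

/-! #### The braiding on basis vectors of three factors -/

theorem left_B_vec (s : K) (a b c : Idx m) :
    (left K m (B m s)).mulVec (vec K a b c) = ka s a b • vec K b a c + th s a b • vec K a b c
      - if b = -a then dl s • ∑ j, (if j < -a then s ^ (j.1 + a.1) else 0) • vec K j (-j) c
        else 0 := by
  rw [left_mulVec, sum_B_smul s (fun p => vec K p.1 p.2 c)]

theorem right_B_vec (s : K) (a b c : Idx m) :
    (right K m (B m s)).mulVec (vec K a b c) = ka s b c • vec K a c b + th s b c • vec K a b c
      - if c = -b then dl s • ∑ j, (if j < -b then s ^ (j.1 + b.1) else 0) • vec K a j (-j)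
        else 0 := by
  rw [right_mulVec, sum_B_smul s (fun p => vec K a p.1 p.2)]

theorem left_B_vec_ne (s : K) {a b : Idx m} (c : Idx m) (h : b ≠ -a) :
    (left K m (B m s)).mulVec (vec K a b c)
      = ka s a b • vec K b a c + th s a b • vec K a b c := by
  rw [left_B_vec, if_neg h, sub_zero]

theorem right_B_vec_ne (s : K) (a : Idx m) {b c : Idx m} (h : c ≠ -b) :
    (right K m (B m s)).mulVec (vec K a b c)
      = ka s b c • vec K a c b + th s b c • vec K a b c := by
  rw [right_B_vec, if_neg h, sub_zero]

theorem left_B_vec_neg (s : K) (a c : Idx m) :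
    (left K m (B m s)).mulVec (vec K a (-a) c) = ∑ i, M s i a • vec K i (-i) c := by
  rw [left_mulVec, sum_B_smul_neg s (fun p => vec K p.1 p.2 c)]

theorem right_B_vec_neg (s : K) (a c : Idx m) :
    (right K m (B m s)).mulVec (vec K c a (-a)) = ∑ i, M s i a • vec K c i (-i) := by
  rw [right_mulVec, sum_B_smul_neg s (fun p => vec K c p.1 p.2)]

theorem vec_swap_left {s : K} (hs : s ≠ 0) {a b c : Idx m} (h : b ≠ -a)
    (hw : vec K a b c ∈ braidKer m s) : vec K b a c ∈ braidKer m s := by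
  by_cases hab : a = b
  · subst hab; exact hw
  · have h1 := left_mem_braidKer hs hw
    rw [left_B_vec_ne s c h, ka_of_ne s hab h, one_smul] at h1
    simpa using sub_mem h1 (Submodule.smul_mem _ (th s a b) hw)

theorem vec_swap_right {s : K} (hs : s ≠ 0) {a b c : Idx m} (h : c ≠ -b)
    (hw : vec K a b c ∈ braidKer m s) : vec K a c b ∈ braidKer m s := by
  by_cases hab : b = c
  · subst hab; exact hw
  · have h1 := right_mem_braidKer hs hw
    rw [right_B_vec_ne s a h, ka_of_ne s hab h, one_smul] at h1
    simpa using sub_mem h1 (Submodule.smul_mem _ (th s b c) hw)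

theorem mem_braidKer_iff {s : K} {w : Idx m × Idx m × Idx m → K} : w ∈ braidKer m s ↔
    (left K m (B m s)).mulVec ((right K m (B m s)).mulVec ((left K m (B m s)).mulVec w))
      = (right K m (B m s)).mulVec ((left K m (B m s)).mulVec ((right K m (B m s)).mulVec w)) := by
  rw [mem_braidKer, braidDefect, Matrix.sub_mulVec, sub_eq_zero]
  simp only [Matrix.mulVec_mulVec, mul_assoc]

theorem th_of_le (s : K) {a b : Idx m} (h : b ≤ a) : th s a b = 0 := by
  rw [th, if_neg (not_lt.2 h)]

theorem vec_mem_of_antitone {s : K} {a b c : Idx m} (hab : b ≤ a) (hbc : c ≤ b)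
    (h1 : b ≠ -a) (h2 : c ≠ -b) (h3 : c ≠ -a) : vec K a b c ∈ braidKer m s := by
  have hac : c ≤ a := hbc.trans hab
  rw [mem_braidKer_iff]
  simp only [left_B_vec_ne s _ h1, left_B_vec_ne s _ h2, left_B_vec_ne s _ h3,
    right_B_vec_ne s _ h1, right_B_vec_ne s _ h2, right_B_vec_ne s _ h3, th_of_le s hab,
    th_of_le s hbc, th_of_le s hac, zero_smul, add_zero, Matrix.mulVec_smul, smul_smul]
  congr 1
  ring

theorem vec_mem_of_no_cancel {s : K} (hs : s ≠ 0) {a b c : Idx m}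
    (h1 : b ≠ -a) (h2 : c ≠ -b) (h3 : c ≠ -a) : vec K a b c ∈ braidKer m s := by
  have h1' : a ≠ -b := fun h => h1 (idx_eq_neg_iff.1 h)
  have h2' : b ≠ -c := fun h => h2 (idx_eq_neg_iff.1 h)
  have h3' : a ≠ -c := fun h => h3 (idx_eq_neg_iff.1 h)
  rcases le_total a b with hab | hab <;> rcases le_total b c with hbc | hbc <;>
    rcases le_total a c with hac | hac
  · exact vec_swap_left hs h1' (vec_swap_right hs h3' (vec_swap_left hs h2'
      (vec_mem_of_antitone hbc hab h2' h1' h3')))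
  · exact vec_swap_left hs h1' (vec_swap_right hs h3' (vec_swap_left hs h2'
      (vec_mem_of_antitone hbc hab h2' h1' h3')))
  · exact vec_swap_left hs h1' (vec_swap_right hs h3'
      (vec_mem_of_antitone hbc hac h2 h3' h1'))
  · exact vec_swap_left hs h1' (vec_mem_of_antitone hab hac h1' h3 h2)
  · exact vec_swap_right hs h2' (vec_swap_left hs h3'
      (vec_mem_of_antitone hac hab h3' h1 h2'))
  · exact vec_swap_right hs h2' (vec_mem_of_antitone hac hbc h3 h2' h1)
  · exact vec_mem_of_antitone hab hbc h1 h2 h3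
  · exact vec_mem_of_antitone hab hbc h1 h2 h3

end TensorRep

end

noncomputable section

namespace TensorRep

variable {K : Type*} [Field K] {m : ℕ}

/-! #### Words containing a cancelling pair -/

theorem M_int (s : K) (i a : Idx m) :
    M s i a = (if i.1 = -a.1 then (if a.1 = 0 then 1 else (s ^ 2)⁻¹) else 0)
      + (if i.1 = a.1 then (if a.1 < 0 then dl s else 0) else 0)
      - (if i.1 < -a.1 then dl s * s ^ (i.1 + a.1) else 0) := by
  rw [M, ka_neg, th_neg]
  simp only [idx_eq_iff, idx_lt_iff, idx_neg_val, idx_zero_val]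

theorem cancel_coeff_left (s : K) (hs : s ≠ 0) {x y : Idx m} (h : y ≠ x) (h' : y ≠ -x)
    (i : Idx m) :
    M s i x * (th s (-i) y - th s x y)
      + M s (-y) x * (dl s * (if i < -y then s ^ (i.1 + y.1) else 0))
      + (if i = x then th s y (-x) * th s x y else 0)
      + (if i = -y then dl s * M s (-y) x else 0) = 0 := by
  rw [M_int, M_int]
  obtain ⟨x, _⟩ := x
  obtain ⟨y, _⟩ := y
  obtain ⟨i, _⟩ := i
  simp only [th, idx_eq_iff, idx_lt_iff, idx_neg_val, ne_eq] at *
  rcases lt_or_gt_of_ne h with hxy | hxy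
  · simp only [show ¬ -y = -x by omega, show ¬ -y = x by omega, show ¬ -y < -x by omega,
      show ¬ x < y by omega, if_false]
    by_cases hi : -i < y
    · simp only [show ¬ i = -x by omega, show ¬ i < -x by omega, if_false]
      split_ifs <;> first | (exfalso; omega) | ring
    · simp only [hi, if_false]
      split_ifs <;> ring
  · simp only [show ¬ -y = -x by omega, show ¬ -y = x by omega, show -y < -x by omega,
      show x < y by omega, if_false, if_true]
    rcases lt_trichotomy i (-y) with hi | hi | hi
    · simp only [show ¬ i = -x by omega, show i < -x by omega, show ¬ -i < y by omega, hi,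
        show ¬ i = -y by omega, if_false, if_true]
      have e1 : s ^ (-y + x) * s ^ (i + y) = s ^ (i + x) := by
        rw [← zpow_add₀ hs]; congr 1; ring
      by_cases hix : i = x
      · simp only [hix, show x < 0 by omega, show y < -x by omega, if_true]
        rw [hix] at e1
        linear_combination (-dl s * dl s) * e1
      · simp only [hix, if_false]
        linear_combination (-dl s * dl s) * e1
    · simp only [hi, show ¬ -y = -x by omega, show ¬ -y = x by omega, show -y < -x by omega,
        show ¬ -y < -y by omega, show ¬ - -y < y by omega, if_false, if_true]
      ring
    · simp only [show -i < y by omega, show ¬ i < -y by omega, show ¬ i = -y by omega,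
        if_true, if_false]
      split_ifs <;> first | (exfalso; omega) | ring

theorem cancel_coeff_right (s : K) (hs : s ≠ 0) {x y : Idx m} (h : y ≠ x) (h' : y ≠ -x)
    (i : Idx m) :
    M s i x * (th s y (-x) - th s y i)
      - M s y x * (dl s * (if i < y then s ^ (i.1 - y.1) else 0))
      - (if i = x then th s y (-x) * th s x y else 0)
      - (if i = y then dl s * M s y x else 0) = 0 := by
  rw [M_int, M_int]
  obtain ⟨x, _⟩ := x
  obtain ⟨y, _⟩ := y
  obtain ⟨i, _⟩ := i
  simp only [th, idx_eq_iff, idx_lt_iff, idx_neg_val, ne_eq] at *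
  rcases lt_or_gt_of_ne h' with hxy | hxy
  · simp only [show ¬ y = -x by omega, show ¬ y = x by omega, show y < -x by omega,
      if_false, if_true]
    rcases lt_trichotomy i y with hi | hi | hi
    · simp only [show ¬ i = -x by omega, show i < -x by omega, show ¬ y < i by omega, hi,
        show ¬ i = y by omega, if_false, if_true]
      have e1 : s ^ (y + x) * s ^ (i - y) = s ^ (i + x) := by
        rw [← zpow_add₀ hs]; congr 1; ring
      by_cases hix : i = x
      · simp only [hix, show x < 0 by omega, show x < y by omega, if_true]
        rw [hix] at e1
        linear_combination (dl s * dl s) * e1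
      · simp only [hix, if_false]
        linear_combination (dl s * dl s) * e1
    · simp only [hi, show ¬ y = -x by omega, show ¬ y = x by omega, show y < -x by omega,
        show ¬ y < y by omega, if_false, if_true]
      ring
    · simp only [show y < i by omega, show ¬ i < y by omega, show ¬ i = y by omega,
        if_true, if_false]
      split_ifs <;> first | (exfalso; omega) | ring
  · simp only [show ¬ y = -x by omega, show ¬ y = x by omega, show ¬ y < -x by omega, if_false]
    by_cases hi : y < i
    · simp only [show ¬ i = -x by omega, show ¬ i < -x by omega, if_false]
      split_ifs <;> first | (exfalso; omega) | ring
    · simp only [hi, if_false]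
      split_ifs <;> ring

theorem vec_mem_of_cancel_middle {s : K} (hs : s ≠ 0) {x y : Idx m} (h : y ≠ x) (h' : y ≠ -x) :
    vec K x y (-x) ∈ braidKer m s := by
  have h1 : -x ≠ -y := fun e => h (idx_neg_inj.1 e).symm
  have hxy : ka s x y = 1 := ka_of_ne s (Ne.symm h) h'
  have hyx : ka s y (-x) = 1 := ka_of_ne s h' h1
  have eL : ∀ i, (left K m (B m s)).mulVec (vec K y i (-i)) = ka s y i • vec K i y (-i)
      + th s y i • vec K y i (-i) - if i = -y then
        dl s • ∑ j : Idx m, (if j < -y then s ^ (j.1 + y.1) else 0) • vec K j (-j) y else 0 := by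
    intro i
    rw [left_B_vec]
    by_cases hi : i = -y
    · subst hi; simp
    · simp only [hi, if_false]
  have eR : ∀ i, (right K m (B m s)).mulVec (vec K i (-i) y) = ka s (-i) y • vec K i y (-i)
      + th s (-i) y • vec K i (-i) y - if i = y then
        dl s • ∑ j : Idx m, (if j < y then s ^ (j.1 - y.1) else 0) • vec K y j (-j) else 0 := by
    intro i
    rw [right_B_vec]
    by_cases hi : i = y
    · subst hi; simp [sub_eq_add_neg]
    · have : ¬ y = i := fun e => hi e.symm
      simp only [idx_neg_neg, hi, this, if_false]
  rw [mem_braidKer_iff, left_B_vec_ne s _ h', right_B_vec_ne s _ h1, hxy, hyx]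
  simp only [one_smul, Matrix.mulVec_add, Matrix.mulVec_smul, right_B_vec_neg, left_B_vec_neg,
    left_B_vec_ne s _ h', right_B_vec_ne s _ h1, hxy, hyx, Matrix.mulVec_sum, eL, eR, smul_sub,
    smul_add, Finset.sum_sub_distrib, Finset.sum_add_distrib]
  have e1 : ∑ i, M s i x • (if i = -y then
      dl s • ∑ j : Idx m, (if j < -y then s ^ (j.1 + y.1) else 0) • vec K j (-j) y else 0)
      = ∑ i : Idx m, (M s (-y) x * (dl s * (if i < -y then s ^ (i.1 + y.1) else 0)))
        • vec K i (-i) y := by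
    simp only [smul_ite, smul_zero, Finset.sum_ite_eq', Finset.mem_univ, if_true,
      Finset.smul_sum, smul_smul]
  have e2 : ∑ i, M s i x • (if i = y then
      dl s • ∑ j : Idx m, (if j < y then s ^ (j.1 - y.1) else 0) • vec K y j (-j) else 0)
      = ∑ i : Idx m, (M s y x * (dl s * (if i < y then s ^ (i.1 - y.1) else 0)))
        • vec K y i (-i) := by
    simp only [smul_ite, smul_zero, Finset.sum_ite_eq', Finset.mem_univ, if_true,
      Finset.smul_sum, smul_smul]
  have e3 : ∑ i, M s i x • ka s (-i) y • vec K i y (-i) - ∑ i, M s i x • ka s y i • vec K i y (-i)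
      = (dl s * M s (-y) x) • vec K (-y) y y - (dl s * M s y x) • vec K y y (-y) := by
    by_cases hy : y = 0
    · subst hy
      have : ∀ i : Idx m, ka s (-i) 0 = ka s 0 i := by
        intro i
        rw [ka_symm, ka, ka]
        by_cases hi : 0 = i
        · subst hi; simp
        · have hi' : ¬ 0 = -i := fun e => hi (by rw [← idx_neg_neg i, ← e, idx_neg_zero])
          simp [hi, hi']
      simp [this]
    · have hy' := ne_neg_self hy
      rw [← Finset.sum_sub_distrib, Fintype.sum_eq_add y (-y) hy']
      · have k1 : ka s (-y) y = (s ^ 2)⁻¹ := by rw [ka_symm, ka_neg, if_neg hy]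
        have k2 : ka s y y = s ^ 2 := by simp [ka, hy]
        have k3 : ka s y (-y) = (s ^ 2)⁻¹ := by rw [ka_neg, if_neg hy]
        rw [idx_neg_neg, k1, k2, k3]
        unfold dl
        module
      · rintro i ⟨hi1, hi2⟩
        have k1 : ka s y i = 1 := ka_of_ne s (Ne.symm hi1) hi2
        have k2 : ka s (-i) y = 1 := by
          refine ka_of_ne s (fun e => hi2 ?_) (by simpa using Ne.symm hi1)
          rw [← e, idx_neg_neg]
        rw [k1, k2, sub_self]
  have e4 : ∑ i, (M s i x * (th s (-i) y - th s x y)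
      + M s (-y) x * (dl s * (if i < -y then s ^ (i.1 + y.1) else 0))
      + (if i = x then th s y (-x) * th s x y else 0)
      + (if i = -y then dl s * M s (-y) x else 0)) • vec K i (-i) y = 0 :=
    Finset.sum_eq_zero fun i _ => by rw [cancel_coeff_left s hs h h', zero_smul]
  have e5 : ∑ i, (M s i x * (th s y (-x) - th s y i)
      - M s y x * (dl s * (if i < y then s ^ (i.1 - y.1) else 0))
      - (if i = x then th s y (-x) * th s x y else 0)
      - (if i = y then dl s * M s y x else 0)) • vec K y i (-i) = 0 :=
    Finset.sum_eq_zero fun i _ => by rw [cancel_coeff_right s hs h h', zero_smul]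
  have e6 : th s x y * th s y (-x) * (th s y (-x) - th s x y) = 0 := by
    unfold th; split_ifs <;> simp
  rw [e1, e2]
  have e7 : ∀ (c : K) (w : Idx m → Idx m × Idx m × Idx m → K),
      ∑ i, (M s i x * c) • w i = c • ∑ i, M s i x • w i := fun c w => by
    simp only [Finset.smul_sum, smul_smul, mul_comm c]
  simp only [add_smul, sub_smul, ite_smul, zero_smul, Finset.sum_add_distrib,
    Finset.sum_sub_distrib, Finset.sum_ite_eq', Finset.mem_univ, if_true, mul_sub,
    idx_neg_neg, e7] at e4 e5
  simp only [smul_smul] at e3 ⊢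
  linear_combination (norm := module) -e3 - e4 - e5 - e6 • vec K x y (-x)

end TensorRep

end

noncomputable section

namespace TensorRep

variable {K : Type*} [Field K] {m : ℕ}

theorem vec_mem_of_cancel_left {s : K} (hs : s ≠ 0) {x y : Idx m} (h : y ≠ x) (h' : y ≠ -x) :
    vec K x (-x) y ∈ braidKer m s :=
  vec_swap_right hs (fun e => h (idx_neg_inj.1 e).symm) (vec_mem_of_cancel_middle hs h h')

theorem vec_mem_of_cancel_right {s : K} (hs : s ≠ 0) {x y : Idx m} (h : y ≠ x) (h' : y ≠ -x) :
    vec K y x (-x) ∈ braidKer m s :=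
  vec_swap_left hs h' (vec_mem_of_cancel_middle hs h h')

theorem cupLeft_mem_braidKer {s : K} (hs : s ≠ 0) (c : Idx m) : cupLeft s c ∈ braidKer m s := by
  have h := congrArg (fun A => A.mulVec (vec K 0 0 c)) (braidDefect_mul_left_E (m := m) s hs)
  simp only [← Matrix.mulVec_mulVec, left_E_mulVec, Matrix.zero_mulVec] at h
  simpa [cup, mem_braidKer] using h

theorem cupRight_mem_braidKer {s : K} (hs : s ≠ 0) (c : Idx m) :
    cupRight s c ∈ braidKer m s := by
  have h := congrArg (fun A => A.mulVec (vec K c 0 0)) (braidDefect_mul_right_E (m := m) s hs)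
  simp only [← Matrix.mulVec_mulVec, right_E_mulVec, Matrix.zero_mulVec] at h
  simpa [cup, mem_braidKer] using h

theorem vec_zero_mem {s : K} (hs : s ≠ 0) : vec K (0 : Idx m) 0 0 ∈ braidKer m s := by
  have h := cupLeft_mem_braidKer hs (0 : Idx m)
  rw [cupLeft, Finset.sum_eq_add_sum_sdiff_singleton_of_mem (Finset.mem_univ 0)] at h
  have h2 : ∑ j ∈ Finset.univ \ {(0 : Idx m)}, s ^ j.1 • vec K j (-j) 0 ∈ braidKer m s := by
    refine Submodule.sum_mem _ fun j hj => Submodule.smul_mem _ _ ?_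
    have hj0 : j ≠ 0 := by simpa using hj
    refine vec_mem_of_cancel_left hs (Ne.symm hj0) fun e => hj0 ?_
    rw [← idx_neg_neg j, ← e, idx_neg_zero]
  simpa using (Submodule.add_mem_iff_left _ h2).1 h

theorem braidDefect_symm (s : K) (p r : Idx m × Idx m × Idx m) :
    braidDefect m s p r = braidDefect m s r p := by
  nth_rw 1 [← braidDefect_transpose]; rfl

theorem braidDefect_apply (s : K) (p : Idx m × Idx m × Idx m) (a b c : Idx m) :
    (braidDefect m s).mulVec (vec K a b c) p = braidDefect m s p (a, b, c) := by
  rw [vec, Matrix.mulVec_single_one, Matrix.col_apply]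

theorem sum_pair_mem {s : K} {y : Idx m} (hy : y ≠ 0) (w : Idx m → Idx m × Idx m × Idx m → K)
    (hw : ∀ j, y ≠ j → y ≠ -j → w j ∈ braidKer m s)
    (h : ∑ j : Idx m, s ^ j.1 • w j ∈ braidKer m s) :
    s ^ y.1 • w y + s ^ (-y).1 • w (-y) ∈ braidKer m s := by
  have hy' : y ≠ -y := ne_neg_self hy
  have h1 : ∑ j ∈ Finset.univ \ {y, -y}, s ^ j.1 • w j ∈ braidKer m s := by
    refine Submodule.sum_mem _ fun j hj => Submodule.smul_mem _ _ ?_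
    simp only [Finset.mem_sdiff, Finset.mem_univ, Finset.mem_insert, Finset.mem_singleton,
      true_and, not_or] at hj
    exact hw j (Ne.symm hj.1) fun e => hj.2 (idx_eq_neg_iff.1 e)
  rw [← Finset.sum_sdiff (Finset.subset_univ {y, -y}), Finset.sum_pair hy'] at h
  exact (Submodule.add_mem_iff_right _ h1).1 h

theorem double_left_rel {s : K} (hs : s ≠ 0) {y : Idx m} (hy : y ≠ 0)
    (p : Idx m × Idx m × Idx m) :
    s ^ y.1 * braidDefect m s p (y, -y, y) + s ^ (-y).1 * braidDefect m s p (-y, y, y) = 0 := by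
  have hL : s ^ y.1 • vec K y (-y) y + s ^ (-y).1 • vec K (-y) y y ∈ braidKer m s := by
    simpa using sum_pair_mem hy (fun j => vec K j (-j) y)
      (fun j h h' => vec_mem_of_cancel_left hs h h') (cupLeft_mem_braidKer hs y)
  have := congrFun (mem_braidKer.1 hL) p
  simpa [Matrix.mulVec_add, Matrix.mulVec_smul, braidDefect_apply] using this

theorem double_right_rel {s : K} (hs : s ≠ 0) {y : Idx m} (hy : y ≠ 0)
    (p : Idx m × Idx m × Idx m) :
    s ^ y.1 * braidDefect m s p (y, y, -y) + s ^ (-y).1 * braidDefect m s p (y, -y, y) = 0 := by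
  have hR : s ^ y.1 • vec K y y (-y) + s ^ (-y).1 • vec K y (-y) y ∈ braidKer m s := by
    simpa using sum_pair_mem hy (fun j => vec K y j (-j))
      (fun j h h' => vec_mem_of_cancel_right hs h h') (cupRight_mem_braidKer hs y)
  have := congrFun (mem_braidKer.1 hR) p
  simpa [Matrix.mulVec_add, Matrix.mulVec_smul, braidDefect_apply] using this

theorem double_entry (s : K) {y z : Idx m} (hy : y ≠ 0) (hz : z ≠ 0) :
    braidDefect m s (-z, z, z) (y, y, -y) = 0 := by
  have h1 : ∀ p, left K m (B m s) p (y, y, -y) = if p = (y, y, -y) then s ^ 2 else 0 := by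
    rintro ⟨a, b, c⟩
    rw [left_apply, B_apply_of_ne s (ne_neg_self hy)]
    have : ka s y y = s ^ 2 := by simp [ka, hy]
    simp only [this, th, lt_irrefl, if_false, ite_self, add_zero, Prod.mk.injEq]
    by_cases h : a = y <;> by_cases h' : b = y <;> by_cases h'' : c = -y <;> simp [h, h', h'']
  have h2 : ∀ p, right K m (B m s) (-z, z, z) p = if p = (-z, z, z) then s ^ 2 else 0 := by
    rintro ⟨a, b, c⟩
    rw [right_apply, B_symm, B_apply_of_ne s (ne_neg_self hz)]
    have : ka s z z = s ^ 2 := by simp [ka, hz]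
    simp only [this, th, lt_irrefl, if_false, ite_self, add_zero, Prod.mk.injEq]
    by_cases h : -z = a
    · subst h; by_cases h' : b = z <;> by_cases h'' : c = z <;> simp [h', h'']
    · have : ¬ a = -z := fun e => h e.symm
      simp [h, this]
  rw [braidDefect, Matrix.sub_apply, Matrix.mul_apply, mul_assoc, Matrix.mul_apply]
  simp only [h1, h2, mul_ite, ite_mul, mul_zero, zero_mul, Finset.sum_ite_eq', Finset.mem_univ,
    if_true]
  ring

theorem vec_mem_or_double {s : K} (hs : s ≠ 0) (a b c : Idx m) :
    vec K a b c ∈ braidKer m s ∨ ∃ z : Idx m, z ≠ 0 ∧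
      ((a, b, c) = (z, z, -z) ∨ (a, b, c) = (z, -z, z) ∨ (a, b, c) = (-z, z, z)) := by
  by_cases h0 : a = 0 ∧ b = 0 ∧ c = 0
  · obtain ⟨rfl, rfl, rfl⟩ := h0
    exact Or.inl (vec_zero_mem hs)
  by_cases h1 : b = -a
  · subst h1
    by_cases h2 : c = a
    · subst h2
      exact Or.inr ⟨c, fun e => h0 (by simp [e]), by simp⟩
    by_cases h3 : c = -a
    · subst h3
      exact Or.inr ⟨-a, fun e => h0 ⟨by rw [← idx_neg_neg a, e, idx_neg_zero], e, e⟩, by simp⟩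
    · exact Or.inl (vec_mem_of_cancel_left hs h2 h3)
  by_cases h2 : c = -b
  · subst h2
    by_cases h2 : a = b
    · subst h2
      exact Or.inr ⟨a, fun e => h0 (by simp [e]), by simp⟩
    · exact Or.inl (vec_mem_of_cancel_right hs h2 fun e => h1 (idx_eq_neg_iff.1 e))
  by_cases h3 : c = -a
  · subst h3
    exact Or.inl (vec_mem_of_cancel_middle hs (fun e => h2 (by rw [e])) h1)
  · exact Or.inl (vec_mem_of_no_cancel hs h1 h2 h3)

theorem double_mem {s : K} (hs : s ≠ 0) {y : Idx m} (hy : y ≠ 0) :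
    vec K y y (-y) ∈ braidKer m s := by
  rw [mem_braidKer]
  ext ⟨a, b, c⟩
  rw [Pi.zero_apply, braidDefect_apply, braidDefect_symm]
  rcases vec_mem_or_double hs a b c with h | ⟨z, hz, h⟩
  · rw [← braidDefect_apply, mem_braidKer.1 h, Pi.zero_apply]
  · have hp : s ^ z.1 ≠ 0 := zpow_ne_zero _ hs
    have k0 : braidDefect m s (y, y, -y) (-z, z, z) = 0 := by
      rw [braidDefect_symm]; exact double_entry s hy hz
    have k1 : braidDefect m s (y, y, -y) (z, -z, z) = 0 := by
      have := double_left_rel hs hz (y, y, -y)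
      rw [k0, mul_zero, add_zero] at this
      exact (mul_eq_zero.1 this).resolve_left hp
    rcases h with h | h | h <;> rw [h]
    · have := double_right_rel hs hz (y, y, -y)
      rw [k1, mul_zero, add_zero] at this
      exact (mul_eq_zero.1 this).resolve_left hp
    · exact k1
    · exact k0

/-- `B` satisfies the braid relation. -/
theorem braid_B (s : K) (hs : s ≠ 0) :
    left K m (B m s) * right K m (B m s) * left K m (B m s)
      = right K m (B m s) * left K m (B m s) * right K m (B m s) := by
  rw [← sub_eq_zero]
  change braidDefect m s = 0
  ext p ⟨a, b, c⟩
  rw [Matrix.zero_apply]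
  rcases vec_mem_or_double hs a b c with h | ⟨z, hz, h⟩
  · rw [← braidDefect_apply, mem_braidKer.1 h, Pi.zero_apply]
  · have hn : s ^ (-z).1 ≠ 0 := zpow_ne_zero _ hs
    have k0 : braidDefect m s p (z, z, -z) = 0 := by
      rw [← braidDefect_apply, mem_braidKer.1 (double_mem hs hz), Pi.zero_apply]
    have k1 : braidDefect m s p (z, -z, z) = 0 := by
      have := double_right_rel hs hz p
      rw [k0, mul_zero, zero_add] at this
      exact (mul_eq_zero.1 this).resolve_left hn
    rcases h with h | h | h <;> rw [h]
    · exact k0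
    · exact k1
    · have := double_left_rel hs hz p
      rw [k1, mul_zero, zero_add] at this
      exact (mul_eq_zero.1 this).resolve_left hn

end TensorRep

end

noncomputable section

namespace TensorRep

variable {K : Type*} [Field K] {m : ℕ}

/-! ### The matrix of `Y` -/

theorem F_apply (s : K) (a b : Idx m) :
    F m s a b = (if a = -b then (if b = 0 then -1 else s⁻¹) else 0)
      + (if a = b ∧ 0 < b.1 then (s ^ 2)⁻¹ - 1 else 0) := by
  have h1 : (∑ i : Idx m with i ≠ 0, f K (-i) i) a b = if b ≠ 0 ∧ a = -b then 1 else 0 := by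
    rw [Matrix.sum_apply, Finset.sum_filter, Fintype.sum_eq_single b]
    · by_cases hb : b = 0 <;> by_cases ha : a = -b
      · simp [hb]
      · simp [hb]
      · simp [hb, ha, f]
      · have : ¬ -b = a := fun e => ha e.symm
        simp [ha, f, this]
    · intro i hi; simp [f, hi]
  have h2 : (∑ i : Idx m with 0 < i.1, f K i i) a b = if a = b ∧ 0 < b.1 then 1 else 0 := by
    rw [Matrix.sum_apply, Finset.sum_filter, Fintype.sum_eq_single b]
    · by_cases hb : 0 < b.1 <;> by_cases ha : a = b
      · simp [hb, ha, f]
      · have : ¬ b = a := fun e => ha e.symm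
        simp [ha, f, this]
      · simp [hb]
      · simp [hb]
    · intro i hi; simp [f, hi]
  have h3 : f K (0 : Idx m) 0 a b = if b = 0 ∧ a = -b then 1 else 0 := by
    by_cases hb : b = 0
    · subst hb
      simp [f, Matrix.single_apply, eq_comm]
    · have : ¬ 0 = b := fun e => hb e.symm
      simp [f, hb, this]
  rw [F, Matrix.add_apply, Matrix.add_apply, Matrix.neg_apply, Matrix.smul_apply,
    Matrix.smul_apply, h1, h2, h3]
  congr 1
  · by_cases hb : b = 0
    · subst hb
      by_cases ha : a = 0 <;> simp [ha]
    · by_cases ha : a = -b <;> simp [hb, ha]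
  · simp

theorem F_symm (s : K) (a b : Idx m) : F m s a b = F m s b a := by
  rw [F_apply, F_apply]
  congr 1
  · by_cases h : a = -b
    · have h' := idx_eq_neg_iff.1 h
      rw [if_pos h, if_pos h', h]
      have : -b = 0 ↔ b = 0 := by simp only [idx_eq_iff, idx_neg_val, idx_zero_val]; omega
      simp only [this]
    · rw [if_neg h, if_neg fun h' => h (idx_eq_neg_iff.1 h')]
  · by_cases h : a = b
    · subst h; rfl
    · rw [if_neg fun h' => h h'.1, if_neg fun h' => h h'.1.symm]

theorem sum_F_smul {W : Type*} [AddCommGroup W] [Module K W] (s : K) (w : Idx m → W) (a : Idx m) :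
    ∑ i, F m s i a • w i = (if a = 0 then -1 else s⁻¹) • w (-a)
      + (if 0 < a.1 then (s ^ 2)⁻¹ - 1 else 0) • w a := by
  simp only [F_apply, add_smul, Finset.sum_add_distrib]
  congr 1
  · simp only [ite_smul, zero_smul, Finset.sum_ite_eq', Finset.mem_univ, if_true]
  · rw [Fintype.sum_eq_single a]
    · simp
    · intro i hi; simp [hi]

theorem F_sq (s : K) (hs : s ≠ 0) :
    F m s * F m s = ((s ^ 2)⁻¹ - 1) • F m s + (s ^ 2)⁻¹ • 1 := by
  ext b a
  have h1 : (F m s * F m s) b a = ∑ i, F m s i a • F m s b i := by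
    rw [Matrix.mul_apply]
    exact Finset.sum_congr rfl fun _ _ => mul_comm _ _
  rw [h1, sum_F_smul s (fun i => F m s b i)]
  simp only [F_apply, Matrix.add_apply, Matrix.smul_apply, smul_eq_mul, Matrix.one_apply]
  by_cases ha : a = 0
  · subst ha
    by_cases hb : b = 0
    · subst hb; simp
    · simp [hb]
  · have ha1 := ne_neg_self ha
    have ha2 : ¬ -a = a := fun e => ha1 e.symm
    have ha3 : ¬ -a = 0 := fun e => ha (by rw [← idx_neg_neg a, e, idx_neg_zero])
    have ha4 : a.1 ≠ 0 := fun e => ha (idx_eq_iff.2 e)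
    by_cases hb1 : b = a
    · subst hb1
      rcases lt_or_gt_of_ne ha4 with h | h
      · simp [ha, ha1, ha3, h.not_gt, sq]
      · simp [ha, ha1, ha3, h, h.not_gt, idx_neg_neg]
        field_simp
        ring
    · by_cases hb2 : b = -a
      · subst hb2
        rcases lt_or_gt_of_ne ha4 with h | h
        · simp [ha, ha2, h, h.not_gt]
          ring
        · simp [ha, ha2, h, h.not_gt]
      · simp [hb1, hb2]

/-- The inverse of `F`. -/
def Finv (m : ℕ) (s : K) : Matrix (Idx m) (Idx m) K := s ^ 2 • F m s + (s ^ 2 - 1) • 1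

theorem F_mul_Finv (s : K) (hs : s ≠ 0) : F m s * Finv m s = 1 := by
  have hq : s ^ 2 ≠ 0 := pow_ne_zero _ hs
  rw [Finv, mul_add, Matrix.mul_smul, F_sq s hs, Matrix.mul_smul, mul_one, smul_add, smul_smul,
    smul_smul, mul_sub, mul_inv_cancel₀ hq]
  module

theorem Finv_mul_F (s : K) (hs : s ≠ 0) : Finv m s * F m s = 1 := by
  have hq : s ^ 2 ≠ 0 := pow_ne_zero _ hs
  rw [Finv, add_mul, Matrix.smul_mul, F_sq s hs, Matrix.smul_mul, one_mul, smul_add, smul_smul,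
    smul_smul, mul_sub, mul_inv_cancel₀ hq]
  module

/-- Acting on the first of two factors. -/
def fst (K : Type*) [Field K] (m : ℕ) : Matrix (Idx m) (Idx m) K →ₐ[K]
    Matrix (Idx m × Idx m) (Idx m × Idx m) K :=
  kroneckerOne K (Idx m) (Idx m)

theorem fst_apply (A : Matrix (Idx m) (Idx m) K) (a b c d : Idx m) :
    fst K m A (a, b) (c, d) = if b = d then A a c else 0 := by
  change A a c * (1 : Matrix (Idx m) (Idx m) K) b d = _
  rw [Matrix.one_apply]; split_ifs <;> simp

theorem fst_transpose (A : Matrix (Idx m) (Idx m) K) :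
    (fst K m A).transpose = fst K m A.transpose := by
  ext ⟨a, b⟩ ⟨a', b'⟩
  simp only [Matrix.transpose_apply, fst_apply, eq_comm]

theorem F_transpose (s : K) : (F m s).transpose = F m s := by
  ext a b; exact F_symm s b a

theorem fst_mulVec_cup (s : K) (A : Matrix (Idx m) (Idx m) K) (c d : Idx m) :
    (fst K m A).mulVec (cup s) (c, d) = A c (-d) * s ^ (-d).1 := by
  have h1 : (fst K m A).mulVec (cup s) (c, d) = ∑ p, cup s p • fst K m A (c, d) p := by
    simp only [Matrix.mulVec, dotProduct, smul_eq_mul]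
    exact Finset.sum_congr rfl fun _ _ => mul_comm _ _
  rw [h1, sum_cup_smul, Fintype.sum_eq_single (-d)]
  · rw [fst_apply, idx_neg_neg, if_pos rfl, smul_eq_mul, mul_comm]
  · intro j hj
    rw [fst_apply, if_neg fun e => hj (idx_eq_neg_iff.1 e), smul_zero]

theorem F_diag (s : K) (a : Idx m) :
    F m s a a = (if 0 < a.1 then (s ^ 2)⁻¹ - 1 else 0) - (if a = 0 then 1 else 0) := by
  rw [F_apply]
  by_cases ha : a = 0
  · subst ha; simp
  · simp [ha, ne_neg_self ha]

theorem Finv_apply (s : K) (a b : Idx m) :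
    Finv m s a b = s ^ 2 * F m s a b + (if a = b then s ^ 2 - 1 else 0) := by
  simp [Finv, Matrix.one_apply]

theorem B_fst_F_cup (s : K) (hs : s ≠ 0) :
    (B m s).mulVec ((fst K m (F m s)).mulVec (cup s)) = (fst K m (Finv m s)).mulVec (cup s) := by
  have hq : s ^ 2 ≠ 0 := pow_ne_zero _ hs
  ext ⟨c, d⟩
  rw [fst_mulVec_cup]
  have h1 : (B m s).mulVec ((fst K m (F m s)).mulVec (cup s)) (c, d)
      = ∑ p, B m s p (c, d) • (fst K m (F m s)).mulVec (cup s) p := by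
    simp only [Matrix.mulVec, dotProduct, smul_eq_mul]
    exact Finset.sum_congr rfl fun p _ => by rw [B_symm s p]
  rw [h1]
  by_cases hd : d = -c
  · subst hd
    rw [sum_B_smul_neg]
    simp only [fst_mulVec_cup, idx_neg_neg, smul_eq_mul, M_symm s _ c]
    rw [sum_M_mul s hs c (fun i => F m s i i * s ^ i.1), F_diag, F_diag, Finv_apply, F_diag,
      if_pos rfl]
    have hz : ∀ i : Idx m, i = 0 ↔ i.1 = 0 := fun i => idx_eq_iff
    rcases lt_trichotomy c.1 0 with hc | hc | hc
    · have h2 : ∑ a : Idx m, (if a < -c then s ^ a.1 * (F m s a a * s ^ a.1) else 0)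
          = ((s ^ 2)⁻¹ - 1) * (∑ a : Idx m, (if a < -c then s ^ (2 * a.1) else 0)
            - ∑ a : Idx m, (if a < 0 then s ^ (2 * a.1) else 0) - 1) - 1 := by
        have h3 : (1 : K) = ∑ a : Idx m, (if a = 0 then 1 else 0) := by simp
        have hF := F_diag (m := m) s
        generalize (s ^ 2)⁻¹ - 1 = r at hF ⊢
        rw [h3, ← Finset.sum_sub_distrib, ← Finset.sum_sub_distrib, Finset.mul_sum,
          ← Finset.sum_sub_distrib]
        refine Finset.sum_congr rfl fun a _ => ?_
        rw [hF, two_mul, zpow_add₀ hs]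
        simp only [idx_lt_iff, idx_neg_val, idx_zero_val, hz]
        rcases lt_trichotomy a.1 0 with ha | ha | ha
        · simp [ha, ha.ne, ha.not_gt, show a.1 < -c.1 by omega]
        · simp [ha, hc]
        · by_cases h : a.1 < -c.1
          · simp [ha, ha.ne', ha.not_gt, h]; ring
          · simp [ha.ne', ha.not_gt, h]
      have h4 := sum_pow_lt s hs (-c)
      have h5 := sum_pow_lt s hs (0 : Idx m)
      have h6 : dl s * s ^ c.1 * ∑ a : Idx m, (if a < -c then s ^ a.1 * (F m s a a * s ^ a.1) else 0)
          = s ^ c.1 * (((s ^ 2)⁻¹ - 1) * ((partialSum s (-c).1 - lm m s)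
            - (partialSum s (0 : Idx m).1 - lm m s) - dl s) - dl s) := by
        rw [h2, ← h4, ← h5]; ring
      rw [h6]
      have hu : s ^ c.1 ≠ 0 := zpow_ne_zero _ hs
      have hp : s ^ (2 * -c.1) = ((s ^ c.1) ^ 2)⁻¹ := by
        rw [mul_neg, zpow_neg, two_mul, zpow_add₀ hs, sq]
      simp only [partialSum, idx_neg_val, idx_zero_val, hz, hc, hc.ne, hc.not_gt,
        show ¬ -c.1 < 0 by omega, show ¬ -c.1 = 0 by omega, show 0 < -c.1 by omega, if_true,
        if_false, lt_irrefl, hp, zpow_neg]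
      unfold dl
      field_simp
      ring
    · have h2 : ∑ a : Idx m, (if a < -c then s ^ a.1 * (F m s a a * s ^ a.1) else 0) = 0 := by
        refine Finset.sum_eq_zero fun a _ => ?_
        rw [F_diag]
        simp only [idx_lt_iff, idx_neg_val, hz]
        split_ifs <;> first | (exfalso; omega) | simp
      rw [h2]
      simp [hz, hc]
      ring
    · have h2 : ∑ a : Idx m, (if a < -c then s ^ a.1 * (F m s a a * s ^ a.1) else 0) = 0 := by
        refine Finset.sum_eq_zero fun a _ => ?_
        rw [F_diag]
        simp only [idx_lt_iff, idx_neg_val, hz]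
        split_ifs <;> first | (exfalso; omega) | simp
      rw [h2]
      simp [hz, hc, hc.ne', hc.not_gt]
      left
      field_simp
      ring
  · rw [sum_B_smul, if_neg hd]
    simp only [fst_mulVec_cup, smul_eq_mul]
    rw [Finv_apply, F_apply, F_apply, idx_neg_neg, idx_neg_neg]
    have hd' : ¬ c = -d := fun e => hd (idx_eq_neg_iff.1 e)
    by_cases h : c = d
    · subst h
      have hc : c ≠ 0 := by rintro rfl; simp at hd
      have hc' : -c ≠ 0 := fun e => hc (by rw [← idx_neg_neg c, e, idx_neg_zero])
      simp [ka, hc, hc', hd, th]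
      field_simp
    · have h' : ¬ d = c := fun e => h e.symm
      simp [h, h', hd, hd']

theorem FBF_cup (s : K) (hs : s ≠ 0) :
    (fst K m (F m s) * B m s * fst K m (F m s)).mulVec (cup s) = cup s := by
  rw [← Matrix.mulVec_mulVec, ← Matrix.mulVec_mulVec, B_fst_F_cup s hs, Matrix.mulVec_mulVec,
    ← map_mul, F_mul_Finv s hs, map_one, Matrix.one_mulVec]

theorem FBFE (s : K) (hs : s ≠ 0) :
    fst K m (F m s) * B m s * fst K m (F m s) * E m s = E m s := by
  nth_rw 1 [E]
  rw [Matrix.mul_vecMulVec, FBF_cup s hs, E]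

theorem EFBF (s : K) (hs : s ≠ 0) :
    E m s * (fst K m (F m s) * B m s * fst K m (F m s)) = E m s := by
  have := congrArg Matrix.transpose (FBFE (m := m) s hs)
  simp only [Matrix.transpose_mul, fst_transpose, F_transpose, B_transpose, E_transpose] at this
  rw [mul_assoc (fst K m (F m s))]
  exact this

theorem cup_fst_F_cup (s : K) (hs : s ≠ 0) :
    cup s ⬝ᵥ (fst K m (F m s)).mulVec (cup s)
      = ((s ^ 2)⁻¹ - 1) * (∑ a : Idx m, s ^ (2 * a.1)
            - ∑ a : Idx m, (if a < 0 then s ^ (2 * a.1) else 0) - 1) - 1 := by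
  have h3 : (1 : K) = ∑ a : Idx m, (if a = 0 then 1 else 0) := by simp
  have hz : ∀ i : Idx m, i = 0 ↔ i.1 = 0 := fun i => idx_eq_iff
  have hF := F_diag (m := m) s
  have h4 := sum_cup_smul s (fst K m (F m s) |>.mulVec (cup s))
  simp only [smul_eq_mul, fst_mulVec_cup, idx_neg_neg] at h4
  rw [dotProduct, h4]
  generalize (s ^ 2)⁻¹ - 1 = r at hF ⊢
  rw [h3, ← Finset.sum_sub_distrib, ← Finset.sum_sub_distrib, Finset.mul_sum,
    ← Finset.sum_sub_distrib]
  refine Finset.sum_congr rfl fun a _ => ?_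
  rw [hF, two_mul, zpow_add₀ hs]
  simp only [idx_lt_iff, idx_zero_val, hz]
  rcases lt_trichotomy a.1 0 with ha | ha | ha
  · simp [ha, ha.ne, ha.not_gt]
  · simp [ha]
  · simp [ha, ha.ne', ha.not_gt]; ring

theorem delta_params (s : K) : (params m s).delta = dl s := rfl

theorem lam_params (s : K) : (params m s).lam = lm m s := by
  change (s ^ 2) ^ (-(2 * (m : ℤ))) = _
  rw [lm, ← zpow_natCast s 2, ← zpow_mul, ← zpow_neg]
  congr 1
  push_cast
  ring

theorem sum_pow_univ (s : K) (hs : s ≠ 0) :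
    dl s * ∑ a : Idx m, s ^ (2 * a.1) = (lm m s)⁻¹ - lm m s + dl s := by
  rw [lm, inv_inv, ← sum_pow_idxSet s hs m, Finset.sum_coe_sort (idxSet m) (fun j => s ^ (2 * j))]

theorem sum_q_pow (s : K) : ∑ a : Idx m, (s ^ 2) ^ a.1 = ∑ a : Idx m, s ^ (2 * a.1) :=
  Finset.sum_congr rfl fun a _ => by rw [zpow_mul, zpow_ofNat]

theorem x_params (s : K) (hs : s ≠ 0) (hd : dl s ≠ 0) :
    (params m s).x = ∑ a : Idx m, s ^ (2 * a.1) := by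
  rw [BBParams.x, delta_params, lam_params, div_eq_iff hd, mul_comm _ (dl s), sum_pow_univ s hs]
  ring

theorem one_sub_ne_zero (s : K) (hs : s ≠ 0) (hd : dl s ≠ 0) (hx : (params m s).x ≠ 0) :
    1 - (s ^ 2)⁻¹ * lm m s ≠ 0 := by
  intro h
  apply hx
  have hl := lm_ne (m := m) s hs
  have h1 : lm m s = s ^ 2 := by
    have h2 : s ^ 2 ≠ 0 := pow_ne_zero _ hs
    field_simp at h
    linear_combination -h
  rw [x_params s hs hd]
  have h3 := sum_pow_univ (m := m) s hs
  rw [h1, show (s ^ 2)⁻¹ - s ^ 2 + dl s = 0 by unfold dl; ring] at h3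
  exact (mul_eq_zero.1 h3).resolve_left hd

theorem EFE (s : K) (hs : s ≠ 0) (hd : dl s ≠ 0) (hx : (params m s).x ≠ 0) :
    E m s * fst K m (F m s) * E m s = (params m s).A • E m s := by
  have h1 : E m s * fst K m (F m s) * E m s
      = (cup s ⬝ᵥ (fst K m (F m s)).mulVec (cup s)) • E m s := by
    rw [mul_assoc, E, Matrix.mul_vecMulVec, Matrix.vecMulVec_mul_vecMulVec,
      Matrix.vecMulVec_smul]
  rw [h1]
  congr 1
  have h0 := one_sub_ne_zero (m := m) s hs hd hx
  have hA : (params m s).A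
      = ((s ^ 2)⁻¹ - 1) * (∑ a : Idx m, s ^ (2 * a.1)) / (1 - (s ^ 2)⁻¹ * lm m s) := by
    rw [← lam_params, ← sum_q_pow]; rfl
  rw [hA, eq_div_iff h0, cup_fst_F_cup s hs]
  have h2 := sum_pow_univ (m := m) s hs
  have h3 := sum_pow_lt s hs (0 : Idx m)
  have h4 : partialSum s (0 : Idx m).1 = 1 := by simp [partialSum]
  rw [h4] at h3
  refine mul_left_cancel₀ hd ?_
  have hl := lm_ne (m := m) s hs
  generalize ∑ a : Idx m, s ^ (2 * a.1) = T at *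
  generalize (∑ a : Idx m, if a < 0 then s ^ (2 * a.1) else 0) = U at *
  have h5 : dl s * ((((s ^ 2)⁻¹ - 1) * (T - U - 1) - 1) * (1 - (s ^ 2)⁻¹ * lm m s))
      = (((s ^ 2)⁻¹ - 1) * (dl s * T - dl s * U - dl s) - dl s) * (1 - (s ^ 2)⁻¹ * lm m s) := by
    ring
  have h6 : dl s * (((s ^ 2)⁻¹ - 1) * T) = ((s ^ 2)⁻¹ - 1) * (dl s * T) := by ring
  rw [h5, h6, h2, h3]
  unfold dl
  field_simp
  ring

end TensorRep

end

noncomputable section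

namespace TensorRep

variable {K : Type*} [Field K] {m : ℕ}

/-! ### The reflection equation -/

/-- The basis vector `v_a ⊗ v_b`. -/
def vecTwo (K : Type*) [Field K] {m : ℕ} (a b : Idx m) : Idx m × Idx m → K :=
  Pi.single (a, b) 1

theorem mulVec_vecTwo (A : Matrix (Idx m × Idx m) (Idx m × Idx m) K) (a b : Idx m) :
    A.mulVec (vecTwo K a b) = ∑ p : Idx m × Idx m, A p (a, b) • vecTwo K p.1 p.2 := by
  ext r
  rw [vecTwo, Matrix.mulVec_single_one, Matrix.col_apply, Finset.sum_apply,
    Fintype.sum_eq_single r]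
  · simp [vecTwo]
  · intro p hp
    simp [vecTwo, hp.symm]

theorem B_vecTwo_of_ne (s : K) {a b : Idx m} (h : b ≠ -a) :
    (B m s).mulVec (vecTwo K a b) = ka s a b • vecTwo K b a + th s a b • vecTwo K a b := by
  rw [mulVec_vecTwo, sum_B_smul s (fun p => vecTwo K p.1 p.2), if_neg h, sub_zero]

theorem B_vecTwo_neg (s : K) (a : Idx m) :
    (B m s).mulVec (vecTwo K a (-a)) = ∑ i, M s i a • vecTwo K i (-i) := by
  rw [mulVec_vecTwo, sum_B_smul_neg s (fun p => vecTwo K p.1 p.2)]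

theorem B_vecTwo_self (s : K) {a : Idx m} (h : a ≠ 0) :
    (B m s).mulVec (vecTwo K a a) = s ^ 2 • vecTwo K a a := by
  rw [B_vecTwo_of_ne s (ne_neg_self h), ka, if_pos rfl, if_neg h, th, if_neg (lt_irrefl _),
    zero_smul, add_zero]

theorem fst_vecTwo (A : Matrix (Idx m) (Idx m) K) (a b : Idx m) :
    (fst K m A).mulVec (vecTwo K a b) = ∑ i, A i a • vecTwo K i b := by
  rw [mulVec_vecTwo, Fintype.sum_prod_type]
  refine Finset.sum_congr rfl fun i _ => ?_
  rw [Fintype.sum_eq_single b]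
  · rw [fst_apply, if_pos rfl]
  · intro j hj
    rw [fst_apply, if_neg hj, zero_smul]

/-- The coefficient of `v_{-a}` in `F v_a`. -/
def flipCoeff (s : K) (a : Idx m) : K := if a = 0 then -1 else s⁻¹

theorem flipCoeff_ne (s : K) (hs : s ≠ 0) (a : Idx m) : flipCoeff s a ≠ 0 := by
  unfold flipCoeff; split_ifs
  · exact neg_ne_zero.2 one_ne_zero
  · exact inv_ne_zero hs

theorem F_vecTwo (s : K) (a b : Idx m) :
    (fst K m (F m s)).mulVec (vecTwo K a b) = flipCoeff s a • vecTwo K (-a) b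
      + (if 0 < a.1 then (s ^ 2)⁻¹ - 1 else 0) • vecTwo K a b := by
  rw [fst_vecTwo, sum_F_smul s (fun i => vecTwo K i b)]; rfl

theorem F_vecTwo_of_nonpos (s : K) {a : Idx m} (h : a.1 ≤ 0) (b : Idx m) :
    (fst K m (F m s)).mulVec (vecTwo K a b) = flipCoeff s a • vecTwo K (-a) b := by
  rw [F_vecTwo, if_neg h.not_gt, zero_smul, add_zero]

/-- `F B F` on two factors. -/
def G (m : ℕ) (s : K) : Matrix (Idx m × Idx m) (Idx m × Idx m) K :=
  fst K m (F m s) * B m s * fst K m (F m s)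

/-- The defect of the reflection equation. -/
def reflDefect (m : ℕ) (s : K) : Matrix (Idx m × Idx m) (Idx m × Idx m) K :=
  B m s * G m s - G m s * B m s

theorem G_transpose (s : K) : (G m s).transpose = G m s := by
  simp only [G, Matrix.transpose_mul, fst_transpose, F_transpose, B_transpose, mul_assoc]

theorem reflDefect_transpose (s : K) : (reflDefect m s).transpose = -reflDefect m s := by
  simp only [reflDefect, Matrix.transpose_sub, Matrix.transpose_mul, B_transpose, G_transpose,
    neg_sub]

theorem reflDefect_antisymm (s : K) (p r : Idx m × Idx m) :
    reflDefect m s p r = -reflDefect m s r p := by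
  have := congrFun (congrFun (reflDefect_transpose (m := m) s) r) p
  rwa [Matrix.transpose_apply] at this

theorem B_reflDefect_B (s : K) (hs : s ≠ 0) :
    B m s * reflDefect m s * B m s = -reflDefect m s := by
  have h1 : E m s * G m s = E m s := EFBF s hs
  have h2 : G m s * E m s = E m s := FBFE s hs
  have h3 : B m s * reflDefect m s * B m s
      = (B m s * B m s) * G m s * B m s - B m s * G m s * (B m s * B m s) := by
    rw [reflDefect]; noncomm_ring
  rw [h3, B_sq s hs]
  have h4 : (1 + dl s • B m s - (dl s * lm m s) • E m s) * G m s * B m s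
      = G m s * B m s + dl s • (B m s * G m s * B m s)
        - (dl s * lm m s) • (E m s * G m s * B m s) := by
    simp only [add_mul, sub_mul, one_mul, Matrix.smul_mul]
  have h5 : B m s * G m s * (1 + dl s • B m s - (dl s * lm m s) • E m s)
      = B m s * G m s + dl s • (B m s * G m s * B m s)
        - (dl s * lm m s) • (B m s * (G m s * E m s)) := by
    simp only [mul_add, mul_sub, mul_one, Matrix.mul_smul, mul_assoc]
  rw [h4, h5, h1, h2, B_mul_E s hs, E_mul_B s hs, reflDefect]
  abel

theorem F_reflDefect_F (s : K) (hs : s ≠ 0) :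
    fst K m (F m s) * reflDefect m s * fst K m (F m s) = -((s ^ 2)⁻¹ • reflDefect m s) := by
  have h0 : fst K m (F m s) * fst K m (F m s)
      = ((s ^ 2)⁻¹ - 1) • fst K m (F m s) + (s ^ 2)⁻¹ • 1 := by
    rw [← map_mul, F_sq s hs, map_add, map_smul, map_smul, map_one]
  rw [reflDefect, G]
  generalize fst K m (F m s) = Φ at *
  generalize B m s = b at *
  have h3 : Φ * (b * (Φ * b * Φ) - Φ * b * Φ * b) * Φ
      = Φ * b * Φ * b * (Φ * Φ) - (Φ * Φ) * b * Φ * b * Φ := by noncomm_ring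
  rw [h3, h0]
  simp only [mul_add, add_mul, Matrix.mul_smul, Matrix.smul_mul, mul_one, one_mul, smul_sub,
    mul_assoc]
  abel

/-- The kernel of the defect of the reflection equation. -/
def reflKer (m : ℕ) (s : K) : Submodule K (Idx m × Idx m → K) :=
  LinearMap.ker (reflDefect m s).mulVecLin

theorem mem_reflKer {s : K} {w : Idx m × Idx m → K} :
    w ∈ reflKer m s ↔ (reflDefect m s).mulVec w = 0 := by
  rw [reflKer, LinearMap.mem_ker, Matrix.mulVecLin_apply]

theorem mem_reflKer_iff {s : K} {w : Idx m × Idx m → K} :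
    w ∈ reflKer m s ↔ (B m s).mulVec ((G m s).mulVec w) = (G m s).mulVec ((B m s).mulVec w) := by
  rw [mem_reflKer, reflDefect, Matrix.sub_mulVec, sub_eq_zero, Matrix.mulVec_mulVec,
    Matrix.mulVec_mulVec]

theorem B_mem_reflKer {s : K} (hs : s ≠ 0) {w : Idx m × Idx m → K} (hw : w ∈ reflKer m s) :
    (B m s).mulVec w ∈ reflKer m s := by
  rw [mem_reflKer] at *
  have h := congrArg (fun A => A.mulVec w) (B_reflDefect_B (m := m) s hs)
  simp only [← Matrix.mulVec_mulVec, Matrix.neg_mulVec, hw, neg_zero] at h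
  have h2 := congrArg (Binv m s).mulVec h
  rwa [Matrix.mulVec_mulVec, Binv_mul_B s hs, Matrix.one_mulVec, Matrix.mulVec_zero] at h2

theorem F_mem_reflKer {s : K} (hs : s ≠ 0) {w : Idx m × Idx m → K} (hw : w ∈ reflKer m s) :
    (fst K m (F m s)).mulVec w ∈ reflKer m s := by
  rw [mem_reflKer] at *
  have h := congrArg (fun A => A.mulVec w) (F_reflDefect_F (m := m) s hs)
  simp only [← Matrix.mulVec_mulVec, Matrix.neg_mulVec, Matrix.smul_mulVec, hw, smul_zero,
    neg_zero] at h
  have h2 := congrArg (fst K m (Finv m s)).mulVec h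
  rwa [Matrix.mulVec_mulVec, ← map_mul, Finv_mul_F s hs, map_one, Matrix.one_mulVec,
    Matrix.mulVec_zero] at h2

theorem ka_ne_zero (s : K) (hs : s ≠ 0) (a b : Idx m) : ka s a b ≠ 0 := by
  unfold ka; split_ifs <;> simp [hs]

theorem swap_mem_reflKer {s : K} (hs : s ≠ 0) {a b : Idx m} (h : b ≠ -a)
    (hw : vecTwo K a b ∈ reflKer m s) : vecTwo K b a ∈ reflKer m s := by
  have h1 := B_mem_reflKer hs hw
  rw [B_vecTwo_of_ne s h] at h1
  have h2 := (Submodule.add_mem_iff_left _ (Submodule.smul_mem _ (th s a b) hw)).1 h1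
  exact (Submodule.smul_mem_iff _ (ka_ne_zero s hs a b)).1 h2

theorem flip_mem_reflKer {s : K} (hs : s ≠ 0) {a b : Idx m}
    (hw : vecTwo K a b ∈ reflKer m s) : vecTwo K (-a) b ∈ reflKer m s := by
  have h1 := F_mem_reflKer hs hw
  rw [F_vecTwo s] at h1
  have h2 := (Submodule.add_mem_iff_left _ (Submodule.smul_mem _ _ hw)).1 h1
  exact (Submodule.smul_mem_iff _ (flipCoeff_ne s hs a)).1 h2

theorem G_mulVec (s : K) (w : Idx m × Idx m → K) :
    (G m s).mulVec w
      = (fst K m (F m s)).mulVec ((B m s).mulVec ((fst K m (F m s)).mulVec w)) := by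
  rw [G, ← Matrix.mulVec_mulVec, ← Matrix.mulVec_mulVec]

theorem B_vecTwo_swap (s : K) {a b : Idx m} (h : b ≠ -a) (h' : b < a) :
    (B m s).mulVec (vecTwo K a b) = vecTwo K b a := by
  rw [B_vecTwo_of_ne s h, ka_of_ne s h'.ne' h, th, if_neg h'.not_gt, one_smul, zero_smul, add_zero]

theorem mem_reflKer_of_lt {s : K} {a b : Idx m} (ha : a.1 ≤ 0) (hb : b < a) :
    vecTwo K a b ∈ reflKer m s := by
  have hb' : b.1 < a.1 := hb
  have e1 : (G m s).mulVec (vecTwo K a b)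
      = (flipCoeff s a * flipCoeff s b) • vecTwo K (-b) (-a) := by
    rw [G_mulVec, F_vecTwo_of_nonpos s ha, Matrix.mulVec_smul, B_vecTwo_swap s, Matrix.mulVec_smul,
      F_vecTwo_of_nonpos s (by omega), smul_smul]
    · rw [idx_neg_neg]; exact hb.ne
    · rw [idx_lt_iff, idx_neg_val]; omega
  rw [mem_reflKer_iff, e1, Matrix.mulVec_smul, B_vecTwo_swap s, B_vecTwo_swap s _ hb, G_mulVec,
    F_vecTwo_of_nonpos s (by omega), Matrix.mulVec_smul, B_vecTwo_swap s, Matrix.mulVec_smul,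
    F_vecTwo_of_nonpos s ha, smul_smul, mul_comm]
  · rw [idx_neg_neg]; exact hb.ne'
  · rw [idx_lt_iff, idx_neg_val]; omega
  · rw [Ne, idx_eq_iff, idx_neg_val]; omega
  · rw [idx_neg_neg, Ne, idx_eq_iff, idx_neg_val]; omega
  · rw [idx_lt_iff, idx_neg_val, idx_neg_val]; omega

theorem mem_reflKer_of_abs_lt {s : K} (hs : s ≠ 0) {a b : Idx m} (h : |a.1| < |b.1|) :
    vecTwo K a b ∈ reflKer m s ∧ vecTwo K b a ∈ reflKer m s := by
  have hne : ∀ a b : Idx m, |a.1| ≠ |b.1| → b ≠ -a := by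
    rintro a b h rfl
    exact h (by rw [idx_neg_val, abs_neg])
  have key : ∀ a b : Idx m, |a.1| < |b.1| → b.1 ≤ 0 → vecTwo K a b ∈ reflKer m s := by
    intro a b h hb
    rw [abs_of_nonpos hb] at h
    rcases le_total a.1 0 with ha | ha
    · rw [abs_of_nonpos ha] at h
      exact mem_reflKer_of_lt ha (by rw [idx_lt_iff]; omega)
    · rw [abs_of_nonneg ha] at h
      have := flip_mem_reflKer hs (mem_reflKer_of_lt (s := s) (a := -a) (b := b)
        (by rw [idx_neg_val]; omega) (by rw [idx_lt_iff, idx_neg_val]; omega))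
      rwa [idx_neg_neg] at this
  have h1 : vecTwo K b a ∈ reflKer m s := by
    rcases le_total b.1 0 with hb | hb
    · exact swap_mem_reflKer hs (hne _ _ h.ne) (key a b h hb)
    · have h2 : |a.1| < |(-b).1| := by rwa [idx_neg_val, abs_neg]
      have := flip_mem_reflKer hs (swap_mem_reflKer hs (hne _ _ h2.ne)
        (key a (-b) h2 (by rw [idx_neg_val]; omega)))
      rwa [idx_neg_neg] at this
  exact ⟨swap_mem_reflKer hs (hne _ _ h.ne') h1, h1⟩

theorem M_eq_of_neg (s : K) {i a : Idx m} (ha : a.1 < 0) (hi : a.1 < i.1) : M s i (-a) = 0 := by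
  have h : ¬ (-a).1 < 0 := by rw [idx_neg_val]; omega
  rw [M, th_neg, if_neg h, idx_neg_neg, ite_self, if_neg, if_neg, add_zero, sub_zero]
  · exact fun h' => hi.not_gt h'
  · rw [idx_eq_iff]; omega

theorem mem_reflKer_self_of_neg {s : K} {a : Idx m} (ha : a.1 < 0) :
    vecTwo K a a ∈ reflKer m s := by
  have ha0 : a ≠ 0 := by rw [Ne, idx_eq_iff]; exact ha.ne
  rw [mem_reflKer_iff, B_vecTwo_self s ha0, Matrix.mulVec_smul, G_mulVec,
    F_vecTwo_of_nonpos s ha.le, Matrix.mulVec_smul]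
  have h1 := B_vecTwo_neg s (-a)
  rw [idx_neg_neg] at h1
  rw [h1, Matrix.mulVec_smul, Matrix.mulVec_smul, smul_comm]
  congr 1
  rw [Matrix.mulVec_sum, Matrix.mulVec_sum, Finset.smul_sum]
  refine Finset.sum_congr rfl fun i _ => ?_
  rcases le_or_gt i.1 a.1 with hi | hi
  · rw [Matrix.mulVec_smul, F_vecTwo_of_nonpos s (by omega), Matrix.mulVec_smul,
      Matrix.mulVec_smul, B_vecTwo_self s, smul_comm (s ^ 2), smul_comm (s ^ 2)]
    rw [Ne, idx_eq_iff, idx_neg_val, idx_zero_val]; omega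
  · rw [M_eq_of_neg s ha hi]; simp

theorem mem_reflKer_neg_of_pos {s : K} (hs : s ≠ 0) {a : Idx m} (ha : 0 < a.1) :
    vecTwo K a (-a) ∈ reflKer m s := by
  have := flip_mem_reflKer hs (mem_reflKer_self_of_neg (a := -a) (by rw [idx_neg_val]; omega))
  rwa [idx_neg_neg] at this

theorem mem_reflKer_zero {s : K} (hs : s ≠ 0) : vecTwo K (0 : Idx m) 0 ∈ reflKer m s := by
  set z : Idx m × Idx m → K := ∑ i : Idx m, (if i < 0 then s ^ i.1 else 0) • vecTwo K i (-i)
    with hz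
  set y : Idx m × Idx m → K := ∑ i : Idx m, (if i < 0 then s ^ i.1 else 0) • vecTwo K (-i) (-i)
    with hy
  have hi0 : ∀ i : Idx m, i < 0 → -i ≠ 0 := by
    intro i hi
    rw [idx_lt_iff, idx_zero_val] at hi
    rw [Ne, idx_eq_iff, idx_neg_val, idx_zero_val]; omega
  have e1 : (B m s).mulVec (vecTwo K 0 0) = vecTwo K 0 0 - dl s • z := by
    rw [mulVec_vecTwo, sum_B_smul s (fun p => vecTwo K p.1 p.2), if_pos (by simp), hz]
    simp [ka, th]
  have e2 : (fst K m (F m s)).mulVec (vecTwo K 0 0) = -vecTwo K 0 0 := by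
    rw [F_vecTwo]; simp [flipCoeff]
  have e3 : (fst K m (F m s)).mulVec z = s⁻¹ • y := by
    rw [hz, hy, Matrix.mulVec_sum, Finset.smul_sum]
    refine Finset.sum_congr rfl fun i _ => ?_
    rw [Matrix.mulVec_smul]
    by_cases hi : i < 0
    · rw [F_vecTwo_of_nonpos s (a := i) (le_of_lt hi), flipCoeff, if_neg hi.ne, smul_comm]
    · simp [hi]
  have e4 : (B m s).mulVec y = s ^ 2 • y := by
    rw [hy, Matrix.mulVec_sum, Finset.smul_sum]
    refine Finset.sum_congr rfl fun i _ => ?_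
    rw [Matrix.mulVec_smul]
    by_cases hi : i < 0
    · rw [B_vecTwo_self s (hi0 i hi), smul_comm]
    · simp [hi]
  have e5 : (fst K m (F m s)).mulVec y = s⁻¹ • z + ((s ^ 2)⁻¹ - 1) • y := by
    rw [hz, hy, Matrix.mulVec_sum, Finset.smul_sum, Finset.smul_sum, ← Finset.sum_add_distrib]
    refine Finset.sum_congr rfl fun i _ => ?_
    rw [Matrix.mulVec_smul]
    by_cases hi : i < 0
    · rw [F_vecTwo, flipCoeff, if_neg (hi0 i hi), idx_neg_neg, if_pos hi, if_pos]
      · module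
      · rw [idx_lt_iff, idx_zero_val] at hi
        rw [idx_neg_val]; omega
    · simp [hi]
  have e6 : (G m s).mulVec (vecTwo K 0 0) = vecTwo K 0 0 + (dl s * s⁻¹) • y := by
    rw [G_mulVec, e2, Matrix.mulVec_neg, e1, Matrix.mulVec_neg, Matrix.mulVec_sub, e2,
      Matrix.mulVec_smul, e3]
    module
  have e7 : (G m s).mulVec z = z + (s⁻¹ - s) • y := by
    rw [G_mulVec, e3, Matrix.mulVec_smul, e4, Matrix.mulVec_smul, Matrix.mulVec_smul, e5]
    simp only [smul_add, smul_smul]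
    congr 2
    · have : s⁻¹ * (s ^ 2 * s⁻¹) = 1 := by field_simp
      rw [this, one_smul]
    · field_simp
  rw [mem_reflKer_iff, e6, Matrix.mulVec_add, e1, Matrix.mulVec_smul, e4, Matrix.mulVec_sub, e6,
    Matrix.mulVec_smul, e7]
  have : dl s * s⁻¹ * s ^ 2 = dl s * s := by field_simp
  rw [smul_smul, this]
  module

theorem reflDefect_self_self (s : K) {a b : Idx m} (ha : a ≠ 0) (hb : b ≠ 0) :
    reflDefect m s (b, b) (a, a) = 0 := by
  have h1 : ∀ A : Matrix (Idx m × Idx m) (Idx m × Idx m) K,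
      (A * B m s) (b, b) (a, a) = s ^ 2 * A (b, b) (a, a) := by
    intro A
    have h := congrFun (congrArg A.mulVec (B_vecTwo_self s ha)) (b, b)
    rw [Matrix.mulVec_mulVec, Matrix.mulVec_smul, vecTwo, Matrix.mulVec_single_one,
      Matrix.mulVec_single_one] at h
    exact h
  have h2 : (B m s * G m s) (b, b) (a, a) = s ^ 2 * G m s (b, b) (a, a) := by
    have h := congrFun (congrArg (G m s).mulVec (B_vecTwo_self s hb)) (a, a)
    rw [Matrix.mulVec_mulVec, Matrix.mulVec_smul, vecTwo, Matrix.mulVec_single_one,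
      Matrix.mulVec_single_one] at h
    have h' : (G m s * B m s) (a, a) (b, b) = s ^ 2 * G m s (a, a) (b, b) := h
    rw [← Matrix.transpose_apply (G m s * B m s), Matrix.transpose_mul, B_transpose,
      G_transpose] at h'
    rw [h', ← Matrix.transpose_apply (G m s), G_transpose]
  rw [reflDefect, Matrix.sub_apply, h1, h2, sub_self]

theorem reflDefect_row_eq_zero {s : K} {a b : Idx m} (h : vecTwo K a b ∈ reflKer m s)
    (p : Idx m × Idx m) : reflDefect m s (a, b) p = 0 := by
  rw [reflDefect_antisymm, neg_eq_zero]
  rw [mem_reflKer, vecTwo, Matrix.mulVec_single_one] at h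
  exact congrFun h p

theorem mem_reflKer_self_of_pos {s : K} (hs : s ≠ 0) {a : Idx m} (ha : 0 < a.1) :
    vecTwo K a a ∈ reflKer m s := by
  have ha0 : a ≠ 0 := by rw [Ne, idx_eq_iff]; exact ha.ne'
  have hq : s ^ 2 ≠ 0 := pow_ne_zero _ hs
  set P := (reflDefect m s).mulVec (vecTwo K a a) with hP
  have hPe : ∀ p, P p = reflDefect m s p (a, a) := by
    intro p; rw [hP, vecTwo, Matrix.mulVec_single_one]; rfl
  have h1 : (B m s).mulVec P = -((s ^ 2)⁻¹ • P) := by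
    have h := congrArg (fun A => A.mulVec (vecTwo K a a)) (B_reflDefect_B (m := m) s hs)
    simp only [← Matrix.mulVec_mulVec, Matrix.neg_mulVec, B_vecTwo_self s ha0, Matrix.mulVec_smul,
      ← hP] at h
    rw [← smul_neg, ← h, smul_smul, inv_mul_cancel₀ hq, one_smul]
  have hdiag : ∀ b : Idx m, 0 ≤ b.1 → P (b, -b) = 0 := by
    intro b hb
    rw [hPe]
    rcases hb.eq_or_lt with hb | hb
    · have : b = 0 := idx_eq_iff.2 hb.symm
      subst this
      rw [idx_neg_zero]
      exact reflDefect_row_eq_zero (mem_reflKer_zero hs) _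
    · exact reflDefect_row_eq_zero (mem_reflKer_neg_of_pos hs hb) _
  have hneg : ∀ c : Idx m, P (c, -c) = 0 := by
    intro c
    induction c using WellFoundedLT.induction with
    | ind c ih =>
    rcases le_or_gt 0 c.1 with hc | hc
    · exact hdiag c hc
    have h2 := congrFun h1 (-c, c)
    have h3 : (B m s).mulVec P (-c, c) = ∑ p, B m s p (-c, - -c) • P p := by
      simp only [Matrix.mulVec, dotProduct, smul_eq_mul, idx_neg_neg]
      exact Finset.sum_congr rfl fun p _ => by rw [B_symm s p]
    rw [h3, sum_B_smul_neg s P, Pi.neg_apply, Pi.smul_apply] at h2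
    have h4 := hdiag (-c) (by rw [idx_neg_val]; omega)
    rw [idx_neg_neg] at h4
    rw [h4, smul_zero, neg_zero, Fintype.sum_eq_single c] at h2
    · have h5 : M s c (-c) = (s ^ 2)⁻¹ := by
        have h6 : ¬ (-c).1 < 0 := by rw [idx_neg_val]; omega
        have h7 : -c ≠ 0 := by rw [Ne, idx_eq_iff, idx_neg_val, idx_zero_val]; omega
        rw [M, th_neg, if_neg h6, ka_neg, if_neg h7, idx_neg_neg, if_pos rfl, ite_self,
          if_neg (lt_irrefl _), add_zero, sub_zero]
      rw [h5] at h2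
      exact (smul_eq_zero.1 h2).resolve_left (inv_ne_zero hq)
    · intro i hi
      rcases lt_or_gt_of_ne hi with hi | hi
      · rw [ih i hi, smul_zero]
      · rw [M_eq_of_neg s hc hi, zero_smul]
  rw [mem_reflKer, ← hP]
  ext ⟨b, c⟩
  rw [Pi.zero_apply]
  by_cases h : |b.1| = |c.1|
  · rcases abs_eq_abs.1 h with h | h
    · have h := idx_eq_iff.2 h
      subst h
      by_cases hb : b = 0
      · subst hb
        have := hneg 0
        rwa [idx_neg_zero] at this
      · rw [hPe, reflDefect_self_self s ha0 hb]
    · have h : c = -b := by rw [idx_eq_iff, idx_neg_val]; omega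
      subst h
      exact hneg b
  · rw [hPe]
    rcases lt_or_gt_of_ne h with h | h
    · exact reflDefect_row_eq_zero (mem_reflKer_of_abs_lt hs h).1 _
    · exact reflDefect_row_eq_zero (mem_reflKer_of_abs_lt hs h).2 _

theorem reflDefect_eq_zero {s : K} (hs : s ≠ 0) : reflDefect m s = 0 := by
  ext p ⟨a, b⟩
  have key : vecTwo K a b ∈ reflKer m s := by
    rcases lt_trichotomy |a.1| |b.1| with h | h | h
    · exact (mem_reflKer_of_abs_lt hs h).1
    · rcases abs_eq_abs.1 h with h | h
      · have h := idx_eq_iff.2 h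
        subst h
        rcases lt_trichotomy a.1 0 with ha | ha | ha
        · exact mem_reflKer_self_of_neg ha
        · have : a = 0 := idx_eq_iff.2 ha
          subst this
          exact mem_reflKer_zero hs
        · exact mem_reflKer_self_of_pos hs ha
      · have h : a = -b := by rw [idx_eq_iff, idx_neg_val]; omega
        subst h
        refine flip_mem_reflKer hs ?_
        rcases lt_trichotomy b.1 0 with ha | ha | ha
        · exact mem_reflKer_self_of_neg ha
        · have : b = 0 := idx_eq_iff.2 ha
          subst this
          exact mem_reflKer_zero hs
        · exact mem_reflKer_self_of_pos hs ha
    · exact (mem_reflKer_of_abs_lt hs h).2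
  rw [mem_reflKer, vecTwo, Matrix.mulVec_single_one] at key
  exact congrFun key p

theorem reflection (s : K) (hs : s ≠ 0) :
    B m s * fst K m (F m s) * B m s * fst K m (F m s)
      = fst K m (F m s) * B m s * fst K m (F m s) * B m s := by
  have h := sub_eq_zero.1 (reflDefect_eq_zero (m := m) hs)
  rw [G] at h
  simpa only [mul_assoc] using h

end TensorRep

end

noncomputable section

namespace TensorRep

variable {K : Type*} [Field K] {m n : ℕ}

/-! ### Operators on some of the tensor factors -/

/-- Splitting off the first factor. -/
def firstEquiv (m : ℕ) (h : 0 < n) :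
    (Fin n → Idx m) ≃ Idx m × ({k : Fin n // k ≠ ⟨0, h⟩} → Idx m) where
  toFun u := (u ⟨0, h⟩, fun k => u k)
  invFun p k := if hk : k = ⟨0, h⟩ then p.1 else p.2 ⟨k, hk⟩
  left_inv u := by
    funext k
    by_cases hk : k = ⟨0, h⟩ <;> simp [hk]
  right_inv p := by
    refine Prod.ext (by simp) (funext fun k => ?_)
    simp [k.2]

/-- Splitting off the factors `i` and `i + 1`. -/
def pairEquiv (m : ℕ) (i : ℕ) (h : i + 1 < n) :
    (Fin n → Idx m) ≃ (Idx m × Idx m) × ({k : Fin n // k.1 ≠ i ∧ k.1 ≠ i + 1} → Idx m) where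
  toFun u := ((u ⟨i, Nat.lt_of_succ_lt h⟩, u ⟨i + 1, h⟩), fun k => u k)
  invFun p k := if h0 : k.1 = i then p.1.1 else if h1 : k.1 = i + 1 then p.1.2
    else p.2 ⟨k, h0, h1⟩
  left_inv u := by
    funext k
    by_cases h0 : k.1 = i
    · subst h0; simp
    · by_cases h1 : k.1 = i + 1
      · have : k = ⟨i + 1, h⟩ := Fin.ext h1
        subst this; simp
      · simp [h0, h1]
  right_inv p := by
    refine Prod.ext (Prod.ext (by simp) (by simp)) (funext fun k => ?_)
    simp [k.2.1, k.2.2]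

/-- Splitting off the factors `i`, `i + 1` and `i + 2`. -/
def tripleEquiv (m : ℕ) (i : ℕ) (h : (i + 1) + 1 < n) :
    (Fin n → Idx m) ≃ (Idx m × Idx m × Idx m) ×
      ({k : Fin n // k.1 ≠ i ∧ k.1 ≠ i + 1 ∧ k.1 ≠ (i + 1) + 1} → Idx m) where
  toFun u := ((u ⟨i, by omega⟩, u ⟨i + 1, by omega⟩, u ⟨(i + 1) + 1, h⟩), fun k => u k)
  invFun p k := if h0 : k.1 = i then p.1.1 else if h1 : k.1 = i + 1 then p.1.2.1
    else if h2 : k.1 = (i + 1) + 1 then p.1.2.2 else p.2 ⟨k, h0, h1, h2⟩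
  left_inv u := by
    funext k
    by_cases h0 : k.1 = i
    · subst h0; simp
    · by_cases h1 : k.1 = i + 1
      · have : k = ⟨i + 1, Nat.lt_of_succ_lt h⟩ := Fin.ext h1
        subst this; simp
      · by_cases h2 : k.1 = (i + 1) + 1
        · have : k = ⟨(i + 1) + 1, h⟩ := Fin.ext h2
          subst this; simp [add_assoc]
        · simp [h0, h1, h2]
  right_inv p := by
    refine Prod.ext (Prod.ext (by simp) (Prod.ext (by simp) (by simp [add_assoc])))
      (funext fun k => ?_)
    simp [k.2.1, k.2.2.1, k.2.2.2]

theorem onFirst_eq_place (A : Matrix (Idx m) (Idx m) K) (h : 0 < n) :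
    onFirst A h = place (firstEquiv m h) A := by
  ext u v
  rw [place_apply, onFirst]
  refine if_congr ?_ rfl rfl
  simp only [firstEquiv, Equiv.coe_fn_mk, funext_iff, Subtype.forall]

theorem onPair_eq_place (A : Matrix (Idx m × Idx m) (Idx m × Idx m) K) (i : ℕ) (h : i + 1 < n) :
    onPair A i h = place (pairEquiv m i h) A := by
  ext u v
  rw [place_apply, onPair]
  refine if_congr ?_ rfl rfl
  simp only [pairEquiv, Equiv.coe_fn_mk, funext_iff, Subtype.forall, and_imp]

theorem onFirst_eq_place_fst (A : Matrix (Idx m) (Idx m) K) (h : 0 < n) (h' : 0 + 1 < n) :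
    onFirst A h = place (pairEquiv m 0 h') (fst K m A) := by
  ext u v
  rw [place_apply, onFirst]
  simp only [pairEquiv, Equiv.coe_fn_mk, funext_iff, Subtype.forall, and_imp]
  rw [fst_apply, ← ite_and]
  refine if_congr ⟨fun H => ⟨fun k h0 _ => H k fun e => h0 (by rw [e]), H _ (by simp)⟩, ?_⟩ rfl rfl
  rintro ⟨H1, H2⟩ k hk
  by_cases h1 : k.1 = 0 + 1
  · have : k = ⟨0 + 1, h'⟩ := Fin.ext h1
    subst this; exact H2
  · exact H1 k (fun e => hk (Fin.ext e)) h1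

theorem onPair_eq_place_left (A : Matrix (Idx m × Idx m) (Idx m × Idx m) K) (i : ℕ)
    (h : i + 1 < n) (h' : (i + 1) + 1 < n) :
    onPair A i h = place (tripleEquiv m i h') (left K m A) := by
  ext u v
  rw [place_apply, onPair]
  simp only [tripleEquiv, Equiv.coe_fn_mk, funext_iff, Subtype.forall, and_imp]
  rw [left_apply, ← ite_and]
  refine if_congr ⟨fun H => ⟨fun k h0 h1 _ => H k h0 h1, H _ (by simp; omega) (by simp)⟩, ?_⟩
    rfl rfl
  rintro ⟨H1, H2⟩ k h0 h1
  by_cases h2 : k.1 = (i + 1) + 1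
  · have : k = ⟨(i + 1) + 1, h'⟩ := Fin.ext h2
    subst this; exact H2
  · exact H1 k h0 h1 h2

theorem onPair_eq_place_right (A : Matrix (Idx m × Idx m) (Idx m × Idx m) K) (i : ℕ)
    (h' : (i + 1) + 1 < n) :
    onPair A (i + 1) h' = place (tripleEquiv m i h') (right K m A) := by
  ext u v
  rw [place_apply, onPair]
  simp only [tripleEquiv, Equiv.coe_fn_mk, funext_iff, Subtype.forall, and_imp]
  rw [right_apply, ← ite_and]
  refine if_congr ⟨fun H => ⟨fun k _ h1 h2 => H k h1 h2, H _ (by simp) (by simp; omega)⟩, ?_⟩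
    rfl rfl
  rintro ⟨H1, H2⟩ k h1 h2
  by_cases h0 : k.1 = i
  · have : k = ⟨i, Nat.lt_of_succ_lt (Nat.lt_of_succ_lt h')⟩ := Fin.ext h0
    subst this; exact H2
  · exact H1 k h0 h1 h2

/-- The operator `A` acts only on the factors in `S`. -/
def LocalOn (S : Set (Fin n)) (A : EndTensor K m n) : Prop :=
  (∀ u v, (∃ k ∉ S, u k ≠ v k) → A u v = 0) ∧
  ∀ u v u' v', (∀ k ∈ S, u k = u' k) → (∀ k ∈ S, v k = v' k) → (∀ k ∉ S, u k = v k) →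
    (∀ k ∉ S, u' k = v' k) → A u v = A u' v'

open Classical in
theorem LocalOn.mul_apply {S T : Set (Fin n)} {A A' : EndTensor K m n} (hA : LocalOn S A)
    (hA' : LocalOn T A') (hST : Disjoint S T) (u v : Fin n → Idx m) :
    (A * A') u v
      = A u (fun k => if k ∈ S then v k else u k) * A' (fun k => if k ∈ S then v k else u k) v := by
  rw [Matrix.mul_apply, Fintype.sum_eq_single]
  intro w hw
  obtain ⟨k, hk⟩ := Function.ne_iff.1 hw
  by_cases hkS : k ∈ S
  · rw [if_pos hkS] at hk
    rw [hA'.1 w v ⟨k, fun hT => hST.le_bot ⟨hkS, hT⟩, hk⟩, mul_zero]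
  · rw [if_neg hkS] at hk
    rw [hA.1 u w ⟨k, hkS, fun e => hk e.symm⟩, zero_mul]

theorem LocalOn.commute {S T : Set (Fin n)} {A A' : EndTensor K m n} (hA : LocalOn S A)
    (hA' : LocalOn T A') (hST : Disjoint S T) : A * A' = A' * A := by
  classical
  ext u v
  have hTS : ∀ {k}, k ∈ T → k ∉ S := fun hT hS => hST.le_bot ⟨hS, hT⟩
  rw [hA.mul_apply hA' hST, hA'.mul_apply hA hST.symm]
  by_cases h : ∀ k, k ∉ S → k ∉ T → u k = v k
  · rw [mul_comm]
    congr 1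
    · refine hA'.2 _ _ _ _ (fun k hk => ?_) (fun k hk => ?_) (fun k hk => ?_) (fun k hk => ?_)
      · rw [if_neg (hTS hk)]
      · rw [if_pos hk]
      · by_cases hS : k ∈ S
        · rw [if_pos hS]
        · rw [if_neg hS, h k hS hk]
      · rw [if_neg hk]
    · refine hA.2 _ _ _ _ (fun k hk => ?_) (fun k hk => ?_) (fun k hk => ?_) (fun k hk => ?_)
      · rw [if_neg fun hT => hTS hT hk]
      · rw [if_pos hk]
      · rw [if_neg hk]
      · by_cases hT : k ∈ T
        · rw [if_pos hT]
        · rw [if_neg hT, h k hk hT]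
  · push Not at h
    obtain ⟨k, hS, hT, hk⟩ := h
    rw [hA'.1 _ v ⟨k, hT, by rwa [if_neg hS]⟩, hA.1 _ v ⟨k, hS, by rwa [if_neg hT]⟩, mul_zero,
      mul_zero]

theorem localOn_onFirst (A : Matrix (Idx m) (Idx m) K) (h : 0 < n) :
    LocalOn {⟨0, h⟩} (onFirst A h) := by
  constructor
  · rintro u v ⟨k, hk, hne⟩
    exact if_neg fun H => hne (H k hk)
  · intro u v u' v' hu hv huv huv'
    have h1 : ∀ k : Fin n, k ≠ ⟨0, h⟩ → u k = v k := huv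
    have h2 : ∀ k : Fin n, k ≠ ⟨0, h⟩ → u' k = v' k := huv'
    rw [onFirst, onFirst, if_pos h1, if_pos h2, hu _ rfl, hv _ rfl]

theorem localOn_onPair (A : Matrix (Idx m × Idx m) (Idx m × Idx m) K) (i : ℕ) (h : i + 1 < n) :
    LocalOn {k : Fin n | k.1 = i ∨ k.1 = i + 1} (onPair A i h) := by
  constructor
  · rintro u v ⟨k, hk, hne⟩
    exact if_neg fun H => hne (H k (fun e => hk (Or.inl e)) (fun e => hk (Or.inr e)))
  · intro u v u' v' hu hv huv huv'
    have hk : ∀ k : Fin n, k.1 ≠ i → k.1 ≠ i + 1 → k ∉ {k : Fin n | k.1 = i ∨ k.1 = i + 1} :=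
      fun k h0 h1 h2 => h2.elim h0 h1
    rw [onPair, onPair, if_pos fun k h0 h1 => huv k (hk k h0 h1),
      if_pos fun k h0 h1 => huv' k (hk k h0 h1), hu _ (Or.inl rfl), hu _ (Or.inr rfl),
      hv _ (Or.inl rfl), hv _ (Or.inr rfl)]

theorem onPair_commute (A A' : Matrix (Idx m × Idx m) (Idx m × Idx m) K) {i j : ℕ}
    (hi : i + 1 < n) (hj : j + 1 < n) (hij : i + 1 < j) :
    onPair A i hi * onPair A' j hj = onPair A' j hj * onPair A i hi :=
  (localOn_onPair A i hi).commute (localOn_onPair A' j hj) <| by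
    rw [Set.disjoint_left]
    rintro k (h | h) (h' | h') <;> omega

theorem onFirst_commute (A : Matrix (Idx m) (Idx m) K)
    (A' : Matrix (Idx m × Idx m) (Idx m × Idx m) K) {i : ℕ} (h : 0 < n)
    (hi : i + 1 < n) (h0 : 0 < i) :
    onFirst A h * onPair A' i hi = onPair A' i hi * onFirst A h :=
  (localOn_onFirst A h).commute (localOn_onPair A' i hi) <| by
    rw [Set.disjoint_left]
    rintro k rfl h'
    rcases h' with h' | h'
    · exact h0.ne h'
    · exact (Nat.succ_ne_zero i) h'.symm

/-! ### The tensor representation -/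

/-- The images of the generators. -/
def repGen (m n : ℕ) (s : K) : BBGen n → EndTensor K m n
  | BBGen.Y h => onFirst (F m s) h
  | BBGen.Yinv h => onFirst (Finv m s) h
  | BBGen.X i h => onPair (B m s) i h
  | BBGen.Xinv i h => onPair (Binv m s) i h

/-- The tensor representation of the free algebra. -/
def freeRep (m n : ℕ) (s : K) : FreeAlgebra K (BBGen n) →ₐ[K] EndTensor K m n :=
  FreeAlgebra.lift K (repGen m n s)

theorem freeRep_Y (s : K) (h : 0 < n) : freeRep m n s (BBFree.Y K h) = onFirst (F m s) h := by
  rw [freeRep, BBFree.Y, FreeAlgebra.lift_ι_apply]; rfl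

theorem freeRep_Yinv (s : K) (h : 0 < n) :
    freeRep m n s (BBFree.Yinv K h) = onFirst (Finv m s) h := by
  rw [freeRep, BBFree.Yinv, FreeAlgebra.lift_ι_apply]; rfl

theorem freeRep_X (s : K) (i : ℕ) (h : i + 1 < n) :
    freeRep m n s (BBFree.X K i h) = onPair (B m s) i h := by
  rw [freeRep, BBFree.X, FreeAlgebra.lift_ι_apply]; rfl

theorem freeRep_Xinv (s : K) (i : ℕ) (h : i + 1 < n) :
    freeRep m n s (BBFree.Xinv K i h) = onPair (Binv m s) i h := by
  rw [freeRep, BBFree.Xinv, FreeAlgebra.lift_ι_apply]; rfl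

theorem E_eq (s : K) (hd : dl s ≠ 0) : 1 - (dl s)⁻¹ • (B m s - Binv m s) = E m s := by
  have h : B m s - Binv m s = dl s • (1 - E m s) := by
    rw [Binv]; module
  rw [h, smul_smul, inv_mul_cancel₀ hd, one_smul, sub_sub_cancel]

theorem onPair_E (s : K) (hd : dl s ≠ 0) (i : ℕ) (h : i + 1 < n) :
    1 - (dl s)⁻¹ • (onPair (B m s) i h - onPair (Binv m s) i h) = onPair (E m s) i h := by
  simp only [onPair_eq_place]
  rw [← E_eq s hd, map_sub, map_one, map_smul, map_sub]

theorem freeRep_e (s : K) (hd : dl s ≠ 0) (i : ℕ) (h : i + 1 < n) :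
    freeRep m n s (BBFree.e (params m s) i h) = onPair (E m s) i h := by
  rw [BBFree.e, map_sub, map_one, map_smul, map_sub, freeRep_X, freeRep_Xinv, delta_params,
    onPair_E s hd]

theorem freeRep_rel (s : K) (hs : s ≠ 0) (hd : dl s ≠ 0) (hx : (params m s).x ≠ 0)
    {a b : FreeAlgebra K (BBGen n)} (h : BBRel (params m s) n a b) :
    freeRep m n s a = freeRep m n s b := by
  induction h
  all_goals
    simp only [map_mul, map_add, map_smul, map_one, AlgHom.commutes, freeRep_Y, freeRep_Yinv,
      freeRep_X, freeRep_Xinv, freeRep_e s hd, lam_params]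
  case Y_inv h =>
    rw [onFirst_eq_place, onFirst_eq_place, ← map_mul, F_mul_Finv s hs, map_one]
  case inv_Y h =>
    rw [onFirst_eq_place, onFirst_eq_place, ← map_mul, Finv_mul_F s hs, map_one]
  case X_inv i h =>
    rw [onPair_eq_place, onPair_eq_place, ← map_mul, B_mul_Binv s hs, map_one]
  case inv_X i h =>
    rw [onPair_eq_place, onPair_eq_place, ← map_mul, Binv_mul_B s hs, map_one]
  case comm i j hi hj hij => exact onPair_commute _ _ hi hj hij
  case braid i hi hj =>
    rw [onPair_eq_place_left _ i hi hj, onPair_eq_place_right _ i hj]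
    simp only [← map_mul, braid_B s hs]
  case X_e i h =>
    rw [onPair_eq_place, onPair_eq_place, ← map_mul, B_mul_E s hs, map_smul]
  case e_X i h =>
    rw [onPair_eq_place, onPair_eq_place, ← map_mul, E_mul_B s hs, map_smul]
  case e_X_e i hi hj =>
    rw [onPair_eq_place_left _ i hi hj, onPair_eq_place_right _ i hj, ← map_mul, ← map_mul,
      EBE s hs, map_smul]
  case e_Xinv_e i hi hj =>
    rw [onPair_eq_place_left _ i hi hj, onPair_eq_place_right _ i hj, ← map_mul, ← map_mul,
      EBinvE s hs, map_smul]
  case braidB hY hX =>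
    rw [onFirst_eq_place_fst _ hY hX, onPair_eq_place]
    simp only [← map_mul, reflection s hs]
  case Y_sq h =>
    rw [onFirst_eq_place, ← map_mul, F_sq s hs, map_add, map_smul, map_smul, map_one,
      Algebra.algebraMap_eq_smul_one]
    rfl
  case YXYe hY hX =>
    rw [onFirst_eq_place_fst _ hY hX, onPair_eq_place, onPair_eq_place]
    simp only [← map_mul, FBFE s hs]
  case Y_comm hY i hi hpos => exact onFirst_commute _ _ hY hi hpos
  case eYe hY hX =>
    rw [onFirst_eq_place_fst _ hY hX, onPair_eq_place]
    simp only [← map_mul, ← map_smul, EFE s hs hd hx]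

theorem exists_isTensorRep (s : K) (hs : s ≠ 0) (hd : dl s ≠ 0) (hx : (params m s).x ≠ 0) :
    ∃ φ : ∀ n, BB (params m s) n →ₐ[K] EndTensor K m n, IsTensorRep m s φ := by
  refine ⟨fun n => RingQuot.liftAlgHom K ⟨freeRep m n s, fun _ _ h => freeRep_rel s hs hd hx h⟩,
    fun n h => ?_, fun n i h => ?_⟩
  · rw [BB.Y, RingQuot.liftAlgHom_mkAlgHom_apply, freeRep_Y]
  · rw [BB.X, RingQuot.liftAlgHom_mkAlgHom_apply, freeRep_X]

end TensorRep

end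

namespace BB

variable {K : Type*} [Field K] (p : BBParams K) {n : ℕ}

/-! ### Homomorphisms out of `BB_n` -/

theorem Y_mul_Yinv (h : 0 < n) : Y p h * Yinv p h = 1 := by
  rw [Y, Yinv, ← map_mul, rel p (BBRel.Y_inv h), map_one]

theorem Yinv_mul_Y (h : 0 < n) : Yinv p h * Y p h = 1 := by
  rw [Y, Yinv, ← map_mul, rel p (BBRel.inv_Y h), map_one]

theorem X_mul_Xinv (i : ℕ) (h : i + 1 < n) : X p i h * Xinv p i h = 1 := by
  rw [X, Xinv, ← map_mul, rel p (BBRel.X_inv i h), map_one]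

theorem Xinv_mul_X (i : ℕ) (h : i + 1 < n) : Xinv p i h * X p i h = 1 := by
  rw [X, Xinv, ← map_mul, rel p (BBRel.inv_X i h), map_one]

theorem algHom_ext {R : Type*} [Ring R] [Algebra K R] {f g : BB p n →ₐ[K] R}
    (hY : ∀ h, f (Y p h) = g (Y p h)) (hX : ∀ i h, f (X p i h) = g (X p i h)) : f = g := by
  refine AlgHom.ext fun a =>
    mem_of_generators p (AlgHom.equalizer f g) hY (fun h => ?_) hX (fun i h => ?_) a
  · refine left_inv_eq_right_inv (a := f (Y p h)) ?_ ?_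
    · rw [← map_mul, Yinv_mul_Y, map_one]
    · rw [hY, ← map_mul, Y_mul_Yinv, map_one]
  · refine left_inv_eq_right_inv (a := f (X p i h)) ?_ ?_
    · rw [← map_mul, Xinv_mul_X, map_one]
    · rw [hX, ← map_mul, X_mul_Xinv, map_one]

theorem zero_eq_algebraMap (a : BB p 0) : a = algebraMap K _ (zeroHom p a) := by
  have h : (Algebra.ofId K (BB p 0)).comp (zeroHom p) = AlgHom.id K _ :=
    algHom_ext p (fun h => absurd h (lt_irrefl 0)) fun i h => absurd h (Nat.not_lt_zero _)
  exact (DFunLike.congr_fun h a).symm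

end BB

noncomputable section

namespace TensorRep

variable {K : Type*} [Field K] {m n : ℕ}

/-! ### Adding a strand -/

/-- Splitting off the last factor. -/
def lastEquiv (m n : ℕ) : (Fin (n + 1) → Idx m) ≃ (Fin n → Idx m) × Idx m where
  toFun u := (Fin.init u, u (Fin.last n))
  invFun p := Fin.snoc p.1 p.2
  left_inv u := Fin.snoc_init_self u
  right_inv p := by simp

/-- `A ↦ A ⊗ 1`. -/
def extend (K : Type*) [Field K] (m n : ℕ) : EndTensor K m n →ₐ[K] EndTensor K m (n + 1) :=
  place (lastEquiv m n)

theorem extend_apply (A : EndTensor K m n) (u v : Fin (n + 1) → Idx m) :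
    extend K m n A u v
      = if u (Fin.last n) = v (Fin.last n) then A (Fin.init u) (Fin.init v) else 0 := by
  rw [extend, place_apply]; rfl

theorem extend_snoc (A : EndTensor K m n) (u v : Fin n → Idx m) (i j : Idx m) :
    extend K m n A (Fin.snoc u i) (Fin.snoc v j) = if i = j then A u v else 0 := by
  rw [extend_apply]; simp

theorem extend_onFirst (A : Matrix (Idx m) (Idx m) K) (h : 0 < n) :
    extend K m n (onFirst A h) = onFirst A (Nat.lt_succ_of_lt h) := by
  ext u v
  rw [extend_apply, onFirst, onFirst, ← ite_and]
  refine if_congr ⟨?_, fun H => ⟨H _ ?_, fun k hk => H k.castSucc ?_⟩⟩ rfl rfl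
  · rintro ⟨H1, H2⟩ k
    refine Fin.lastCases (fun _ => H1) (fun k hk => H2 k ?_) k
    rintro rfl
    exact hk rfl
  · intro e
    exact h.ne' (congrArg Fin.val e)
  · intro e
    exact hk (Fin.ext (Fin.val_eq_of_eq e :))

theorem extend_onPair (A : Matrix (Idx m × Idx m) (Idx m × Idx m) K) (i : ℕ) (h : i + 1 < n) :
    extend K m n (onPair A i h) = onPair A i (Nat.lt_succ_of_lt h) := by
  ext u v
  rw [extend_apply, onPair, onPair, ← ite_and]
  refine if_congr ⟨?_, fun H => ⟨H _ ?_ ?_, fun k h0 h1 => H k.castSucc h0 h1⟩⟩ rfl rfl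
  · rintro ⟨H1, H2⟩ k
    exact Fin.lastCases (fun _ _ => H1) (fun k h0 h1 => H2 k h0 h1) k
  · rw [Fin.val_last]; omega
  · rw [Fin.val_last]; omega

variable {s : K} {φ : ∀ n, BB (params m s) n →ₐ[K] EndTensor K m n}

theorem IsTensorRep.succHom (hφ : IsTensorRep m s φ) (n : ℕ) (a : BB (params m s) n) :
    φ (n + 1) (BB.succHom _ n a) = extend K m n (φ n a) := by
  have h : (φ (n + 1)).comp (BB.succHom _ n) = (extend K m n).comp (φ n) := by
    refine BB.algHom_ext _ (fun h => ?_) fun i h => ?_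
    · rw [AlgHom.comp_apply, AlgHom.comp_apply, BB.succHom_Y, hφ.1, hφ.1, extend_onFirst]
    · rw [AlgHom.comp_apply, AlgHom.comp_apply, BB.succHom_X, hφ.2, hφ.2, extend_onPair]
  exact DFunLike.congr_fun h a

theorem IsTensorRep.map_e (hφ : IsTensorRep m s φ) (hs : s ≠ 0) (hd : dl s ≠ 0) (n i : ℕ)
    (h : i + 1 < n) : φ n (BB.e _ i h) = onPair (E m s) i h := by
  have h1 : φ n (BB.Xinv _ i h) = onPair (Binv m s) i h := by
    refine left_inv_eq_right_inv (a := φ n (BB.X _ i h)) ?_ ?_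
    · rw [← map_mul, BB.Xinv_mul_X, map_one]
    · rw [hφ.2, onPair_eq_place, onPair_eq_place, ← map_mul, B_mul_Binv s hs, map_one]
  rw [BB.e_eq, map_sub, map_one, map_smul, map_sub, h1, hφ.2, delta_params, onPair_E s hd]

/-! ### The Markov trace -/

theorem sum_snoc {W : Type*} [AddCommMonoid W] (g : (Fin (n + 1) → Idx m) → W) :
    ∑ u, g u = ∑ u : Fin n → Idx m, ∑ i : Idx m, g (Fin.snoc u i) := by
  rw [← Fintype.sum_prod_type' (f := fun (u : Fin n → Idx m) (i : Idx m) => g (Fin.snoc u i))]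
  exact ((lastEquiv m n).symm.sum_comp g).symm

/-- The configuration `u` extended by `i` and `j`. -/
def snocTwo (u : Fin n → Idx m) (i j : Idx m) : Fin (n + 2) → Idx m :=
  Fin.snoc (Fin.snoc u i : Fin (n + 1) → Idx m) j

theorem onPair_snocTwo (A : Matrix (Idx m × Idx m) (Idx m × Idx m) K) (u v : Fin n → Idx m)
    (i j k l : Idx m) :
    onPair A n (Nat.lt_succ_self (n + 1)) (snocTwo u i j) (snocTwo v k l)
      = if u = v then A (i, j) (k, l) else 0 := by
  have e1 : ∀ (w : Fin n → Idx m) (a b : Idx m) (r : Fin n),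
      snocTwo w a b r.castSucc.castSucc = w r := fun w a b r => by
    simp only [snocTwo, Fin.snoc_castSucc]
  have e2 : ∀ (w : Fin n → Idx m) (a b : Idx m), snocTwo w a b (Fin.last n).castSucc = a :=
    fun w a b => by simp only [snocTwo, Fin.snoc_castSucc, Fin.snoc_last]
  have e3 : ∀ (w : Fin n → Idx m) (a b : Idx m), snocTwo w a b (Fin.last (n + 1)) = b :=
    fun w a b => by simp only [snocTwo, Fin.snoc_last]
  rw [onPair]
  refine if_congr ⟨fun H => funext fun r => ?_, fun H r h0 h1 => by
      subst H
      revert h0 h1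
      refine Fin.lastCases (fun _ h1 => absurd rfl h1) (fun r => ?_) r
      refine Fin.lastCases (fun h0 => absurd rfl h0) (fun r _ _ => ?_) r
      rw [e1, e1]⟩ ?_ rfl
  · have := H r.castSucc.castSucc r.2.ne (by simp; omega)
    rwa [e1, e1] at this
  · exact congrArg₂ A (Prod.ext (e2 u i j) (e3 u i j)) (Prod.ext (e2 v k l) (e3 v k l))

theorem sum_snocTwo {W : Type*} [AddCommMonoid W] (g : (Fin (n + 2) → Idx m) → W) :
    ∑ u, g u = ∑ u : Fin n → Idx m, ∑ i : Idx m, ∑ j : Idx m, g (snocTwo u i j) := by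
  rw [sum_snoc, sum_snoc]; rfl

theorem cup_zero (s : K) : cup s ((0 : Idx m), 0) = 1 := by simp [cup]

theorem sum_E_zero (s : K) (g : Idx m → Idx m → K) :
    ∑ i, ∑ j, E m s (0, 0) (i, j) * g i j = ∑ i : Idx m, s ^ i.1 * g i (-i) := by
  have h := sum_cup_smul s (fun p : Idx m × Idx m => g p.1 p.2)
  rw [Fintype.sum_prod_type] at h
  simp only [E, Matrix.vecMulVec_apply, cup_zero, one_mul]
  exact h

theorem onPair_E_mul_apply (s : K) (A : EndTensor K m (n + 2)) (u : Fin n → Idx m)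
    (v : Fin (n + 2) → Idx m) :
    (onPair (E m s) n (Nat.lt_succ_self (n + 1)) * A) (snocTwo u 0 0) v
      = ∑ i : Idx m, s ^ i.1 * A (snocTwo u i (-i)) v := by
  rw [Matrix.mul_apply, sum_snocTwo, Fintype.sum_eq_single u]
  · simp only [onPair_snocTwo, if_true]
    exact sum_E_zero s fun i j => A (snocTwo u i j) v
  · intro w hw
    simp only [onPair_snocTwo, if_neg hw.symm, zero_mul, Finset.sum_const_zero]

theorem mul_onPair_E_apply (s : K) (A : EndTensor K m (n + 2)) (u : Fin (n + 2) → Idx m)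
    (v : Fin n → Idx m) :
    (A * onPair (E m s) n (Nat.lt_succ_self (n + 1))) u (snocTwo v 0 0)
      = ∑ i : Idx m, s ^ i.1 * A u (snocTwo v i (-i)) := by
  rw [Matrix.mul_apply, sum_snocTwo, Fintype.sum_eq_single v]
  · simp only [onPair_snocTwo, if_true]
    rw [← sum_E_zero s fun i j => A u (snocTwo v i j)]
    refine Finset.sum_congr rfl fun i _ => Finset.sum_congr rfl fun j _ => ?_
    rw [mul_comm, ← Matrix.transpose_apply (E m s), E_transpose]
  · intro w hw
    simp only [onPair_snocTwo, if_neg hw, mul_zero, Finset.sum_const_zero]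

theorem partialTrace (hs : s ≠ 0) (hd : dl s ≠ 0) (hφ : IsTensorRep m s φ)
    {ε : ∀ n, BB (params m s) (n + 1) → BB (params m s) n} (hε : BB.IsCondExp (params m s) ε)
    (n : ℕ) (a : BB (params m s) (n + 1)) (u v : Fin n → Idx m) :
    ∑ i : Idx m, s ^ (2 * i.1) * φ (n + 1) a (Fin.snoc u i) (Fin.snoc v i)
      = (params m s).x * φ n (ε n a) u v := by
  have h := congrArg (φ (n + 2)) (hε n a)
  rw [map_mul, map_mul, map_smul, map_mul, hφ.map_e hs hd, hφ.succHom, hφ.succHom, hφ.succHom] at h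
  have h1 := congrFun (congrFun h (snocTwo u 0 0)) (snocTwo v 0 0)
  rw [mul_assoc, onPair_E_mul_apply, Matrix.smul_apply, mul_onPair_E_apply, smul_eq_mul] at h1
  simp_rw [mul_onPair_E_apply] at h1
  simp only [snocTwo, extend_snoc] at h1
  have h2 : ∀ i : Idx m, ∑ j : Idx m, s ^ j.1 *
      (if -i = -j then φ (n + 1) a (Fin.snoc u i) (Fin.snoc v j) else 0)
        = s ^ i.1 * φ (n + 1) a (Fin.snoc u i) (Fin.snoc v i) := by
    intro i
    rw [Fintype.sum_eq_single i]
    · rw [if_pos rfl]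
    · intro j hj
      rw [if_neg fun e => hj (idx_neg_inj.1 e).symm, mul_zero]
  have h3 : ∑ i : Idx m, s ^ i.1 *
      (if 0 = -i then (if 0 = i then φ n (ε n a) u v else 0) else 0) = φ n (ε n a) u v := by
    rw [Fintype.sum_eq_single 0]
    · simp
    · intro j hj
      rw [if_neg (c := 0 = j) hj.symm, ite_self, mul_zero]
  simp only [h2, h3] at h1
  rw [← h1]
  refine Finset.sum_congr rfl fun i _ => ?_
  rw [two_mul, zpow_add₀ hs, mul_assoc]

theorem trace_mul_tensorPower (s : K) (A : EndTensor K m n) :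
    Matrix.trace (A * tensorPower (D m s) n) = ∑ u, A u u * ∏ k, s ^ (2 * (u k).1) := by
  rw [Matrix.trace]
  refine Finset.sum_congr rfl fun u _ => ?_
  rw [Matrix.diag_apply, Matrix.mul_apply, Fintype.sum_eq_single u]
  · congr 1
    refine Finset.prod_congr rfl fun k _ => ?_
    rw [D, Matrix.diagonal_apply_eq, zpow_mul, zpow_ofNat]
  · intro v hv
    obtain ⟨k, hk⟩ := Function.ne_iff.1 hv
    rw [tensorPower, Finset.prod_eq_zero (Finset.mem_univ k), mul_zero]
    rw [D, Matrix.diagonal_apply_ne _ hk]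

theorem trace_tensorPower (s : K) :
    Matrix.trace (tensorPower (D m s) n) = (∑ i : Idx m, s ^ (2 * i.1)) ^ n := by
  have h := trace_mul_tensorPower (m := m) (n := n) s 1
  simp only [one_mul, Matrix.one_apply_eq] at h
  rw [h, ← Fintype.prod_sum (fun (_ : Fin n) (i : Idx m) => s ^ (2 * i.1)), Finset.prod_const,
    Finset.card_univ, Fintype.card_fin]

theorem trace_condExp (hs : s ≠ 0) (hd : dl s ≠ 0) (hφ : IsTensorRep m s φ)
    {ε : ∀ n, BB (params m s) (n + 1) → BB (params m s) n} (hε : BB.IsCondExp (params m s) ε)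
    (n : ℕ) (a : BB (params m s) (n + 1)) :
    Matrix.trace (φ (n + 1) a * tensorPower (D m s) (n + 1))
      = (params m s).x * Matrix.trace (φ n (ε n a) * tensorPower (D m s) n) := by
  rw [trace_mul_tensorPower, trace_mul_tensorPower, sum_snoc, Finset.mul_sum]
  refine Finset.sum_congr rfl fun u _ => ?_
  rw [← mul_assoc, ← partialTrace hs hd hφ hε, Finset.sum_mul]
  refine Finset.sum_congr rfl fun i _ => ?_
  rw [Fin.prod_univ_castSucc]
  simp only [Fin.snoc_castSucc, Fin.snoc_last]
  ring

theorem markovTrace_eq_Psi (hs : s ≠ 0) (hd : dl s ≠ 0) (hx : (params m s).x ≠ 0)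
    (hφ : IsTensorRep m s φ) {ε : ∀ n, BB (params m s) (n + 1) → BB (params m s) n}
    (hε : BB.IsCondExp (params m s) ε) (n : ℕ) (a : BB (params m s) n) :
    BB.markovTrace (params m s) ε n a = Psi m s n (φ n a) := by
  induction n with
  | zero =>
    have h : Matrix.trace (tensorPower (D m s) 0) = 1 := by rw [trace_tensorPower, pow_zero]
    rw [Psi, h, div_one]
    conv_rhs => rw [BB.zero_eq_algebraMap _ a, AlgHom.commutes, Algebra.algebraMap_eq_smul_one,
      smul_mul_assoc, one_mul, Matrix.trace_smul, h, smul_eq_mul, mul_one]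
    rfl
  | succ n ih =>
    have h : BB.markovTrace (params m s) ε (n + 1) a
      = BB.markovTrace (params m s) ε n (ε n a) := rfl
    rw [h, ih, Psi, Psi, trace_condExp hs hd hφ hε, trace_tensorPower, trace_tensorPower,
      ← x_params s hs hd, pow_succ', mul_div_mul_left _ _ hx]

end TensorRep

end

theorem mainTheorem8 {K : Type*} [Field K] (m : ℕ) (s : K) (hs : s ≠ 0)
    (hδ : (TensorRep.params m s).delta ≠ 0) (hx : (TensorRep.params m s).x ≠ 0) :
    (∃ φ : ∀ n, BB (TensorRep.params m s) n →ₐ[K] TensorRep.EndTensor K m n,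
      TensorRep.IsTensorRep m s φ) ∧
    (∃ ε : ∀ n, BB (TensorRep.params m s) (n + 1) →ₗ[K] BB (TensorRep.params m s) n,
      BB.IsCondExp (TensorRep.params m s) (fun n => ε n)) ∧
    ∀ (φ : ∀ n, BB (TensorRep.params m s) n →ₐ[K] TensorRep.EndTensor K m n)
      (ε : ∀ n, BB (TensorRep.params m s) (n + 1) → BB (TensorRep.params m s) n),
      TensorRep.IsTensorRep m s φ → BB.IsCondExp (TensorRep.params m s) ε →
      ∀ (n : ℕ) (a : BB (TensorRep.params m s) n),
        BB.markovTrace (TensorRep.params m s) ε n a = TensorRep.Psi m s n (φ n a) := by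
  refine ⟨TensorRep.exists_isTensorRep s hs hδ hx, ?_, fun φ ε hφ hε n a =>
    TensorRep.markovTrace_eq_Psi hs hδ hx hφ hε n a⟩
  refine BB.exists_condExp _ hδ ?_ (inv_ne_zero (pow_ne_zero 2 hs)) hx
  rw [TensorRep.lam_params]
  exact TensorRep.lm_ne s hs
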